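/- Let $\mathcal H$ be a $k$-uniform hypergraph with $n$ vertices ($k\ge 2$). Its adjacency tensor $\mathcal A(\mathcal H)$ is the $k$-order $n$-dimensional tensor with entries $a_{i_1\cdots i_k}=\frac1{(k-1)!}$ if $\{i_1,\dots,i_k\}$ is a hyperedge and $0$ otherwise, $\mathcal D(\mathcal H)$ is the diagonal tensor of vertex degrees, and $\mathcal A_\alpha(\mathcal H)=\alpha\mathcal D(\mathcal H)+(1-\alpha)\mathcal A(\mathcal H)$. The $d$-th order trace of a $k$-order $n$-dimensional tensor $\mathcal A$ is $$\mathrm{Tr}_d(\mathcal A)=(k-1)^{n-1}\sum_{d_1+\cdots+d_n=d}\ \prod_{i=1}^n\frac1{(d_i(k-1))!}\Bigl(\sum_{\beta\in[n]^{k-1}}\mathcal A_{i\beta}\frac{\partial}{\partial a_{i\beta}}\Bigr)^{d_i}\mathrm{tr}\bigl(A^{d(k-1)}\bigr),$$ where $A=(a_{ij})$ is an $n\times n$ matrix of indeterminates, the $d_i$ are nonnegative integers, and $\frac{\partial}{\partial a_{i\beta}}=\frac{\partial}{\partial a_{ii_2}}\cdots\frac{\partial}{\partial a_{ii_k}}$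 for $\beta=i_2\cdots i_k$. For two $k$-uniform hypergraphs with $n$ vertices, write $\mathcal H_1\prec_\alpha\mathcal H_2$ if for some integer $s$ with $1\le s\le n(k-1)^{n-1}-1$ we have $\mathrm{Tr}_t(\mathcal A_\alpha(\mathcal H_1))=\mathrm{Tr}_t(\mathcal A_\alpha(\mathcal H_2))$ for $0\le t<s$ and $\mathrm{Tr}_s(\mathcal A_\alpha(\mathcal H_1))<\mathrm{Tr}_s(\mathcal A_\alpha(\mathcal H_2))$; write $\mathcal H_1=_\alpha\mathcal H_2$ if $\mathrm{Tr}_t(\mathcal A_\alpha(\mathcal H_1))=\mathrm{Tr}_t(\mathcal A_\alpha(\mathcal H_2))$ for $0\le t\le n(k-1)^{n-1}-1$; and write $\mathcal H_1\preceq_\alpha\mathcal H_2$ if $\mathcal H_1\prec_\alpha\mathcal H_2$ or $\mathcal H_1=_\alpha\mathcal H_2$. A $k$-uniform hypertree is a connected $k$-uniform hypergraph without cycles (a cycle being an alternating closed sequence of $l\ge2$ distinct vertices and $l$ distinct hyperedges, each hyperedge containing the two vertices next to it). The starlike hypertree $S^{(k)}_{n_1,\dots,n_p}$ is obtained from $p$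 $k$-uniform hyperpaths with $n_1,\dots,n_p$ hyperedges by identifying one end vertex of each of them to a common vertex. **Theorem.** Let $k\ge2$, $0<\alpha<1$ and $2\le d\le m$. Put $t=\lfloor d/2\rfloor$ and let $S=S^{(k)}_{t,d-t,1,\dots,1}$ with $m-d$ ones (that is, the hyperpath with $d$ hyperedges with $m-d$ pendant hyperedges attached at the common vertex of its $t$-th and $(t+1)$-th hyperedges). Then $S$ is a $k$-uniform hypertree with $m$ hyperedges and diameter $d$, and it is the last such hypertree in $S_\alpha$-order: every $k$-uniform hypertree $T$ with $m$ hyperedges and diameter $d$ satisfies $T\preceq_\alpha S$, with $T=_\alpha S$ if and only if $T\cong S$. -/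

import Mathlib

open MvPolynomial in
/-- Partial derivatives of polynomials commute. -/
theorem MvPolynomial.pderiv_commute {σ R : Type*} [CommSemiring R] (i j : σ) :
    Commute ((pderiv i : Derivation R (MvPolynomial σ R) (MvPolynomial σ R)) :
        Module.End R (MvPolynomial σ R))
      ((pderiv j : Derivation R (MvPolynomial σ R) (MvPolynomial σ R)) :
        Module.End R (MvPolynomial σ R)) := by
  classical
  apply LinearMap.ext
  intro p
  ext s
  simp only [Module.End.mul_apply, Derivation.coeFn_coe, coeff_pderiv]
  by_cases h : i = j
  · subst h; rfl
  · simp only [Finsupp.add_apply, Finsupp.single_apply, h, Ne.symm h, if_false, add_zero,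
      add_right_comm s, mul_assoc]
    congr 1
    exact mul_comm _ _

namespace Tensor

/-- A tensor of order `k` and dimension `|V|` over `R`, with index set `V`: the entry
`a_{i i₂ ⋯ i_k}` is `A i β` with `β = (i₂, …, i_k)`. -/
abbrev KTensor (k : ℕ) (V R : Type*) := V → (Fin (k - 1) → V) → R

section
variable {k : ℕ} {V R : Type*}

/-- The differential operator `∂/∂a_{i i₂} ⋯ ∂/∂a_{i i_k}` for `β = (i₂, …, i_k)`, acting on
polynomials in the entries `a_{ij}` of an auxiliary matrix. -/
noncomputable def rowDeriv (R : Type*) [CommSemiring R] (i : V) (β : Fin (k - 1) → V) :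
    Module.End R (MvPolynomial (V × V) R) :=
  (List.ofFn fun j =>
    ((MvPolynomial.pderiv (i, β j) : Derivation R (MvPolynomial (V × V) R)
      (MvPolynomial (V × V) R)) : Module.End R (MvPolynomial (V × V) R))).prod

/-- The differential operator `∑_β A_{iβ} ∂/∂a_{iβ}`. -/
noncomputable def rowOp [Fintype V] [CommSemiring R] (A : KTensor k V R) (i : V) :
    Module.End R (MvPolynomial (V × V) R) :=
  ∑ β : Fin (k - 1) → V, A i β • rowDeriv R i β

theorem rowDeriv_commute [CommSemiring R] (i j : V) (β γ : Fin (k - 1) → V) :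
    Commute (rowDeriv R i β) (rowDeriv R j γ) := by
  unfold rowDeriv
  refine Commute.list_prod_left _ _ fun x hx => Commute.list_prod_right _ _ fun y hy => ?_
  obtain ⟨a, rfl⟩ := (List.mem_ofFn' _ _).1 hx
  obtain ⟨b, rfl⟩ := (List.mem_ofFn' _ _).1 hy
  exact MvPolynomial.pderiv_commute _ _

theorem rowOp_commute [Fintype V] [CommSemiring R] (A : KTensor k V R) (i j : V) :
    Commute (rowOp A i) (rowOp A j) := by
  unfold rowOp
  refine Commute.sum_left _ _ _ fun β _ => Commute.sum_right _ _ _ fun γ _ => ?_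
  exact ((rowDeriv_commute i j β γ).smul_left _).smul_right _

/-- The `d`-th order trace of a tensor `A` of order `k` and dimension `n = |V|`:
`(k-1)^{n-1} ∑_{d₁+⋯+d_n=d} ∏_i (1/(d_i(k-1))!) (∑_β A_{iβ} ∂/∂a_{iβ})^{d_i} tr(X^{d(k-1)})`,
where `X = (a_{ij})` is a matrix of indeterminates. As `tr(X^{d(k-1)})` is homogeneous of degree
`d(k-1)` and as many derivatives are taken, each summand is a constant polynomial;
`constantCoeff` reads off its value. The operators commute (`rowOp_commute`), so the order in
which the elements of `V` are listed does not matter. -/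
noncomputable def trace [Fintype V] [DecidableEq V] [Field R] (A : KTensor k V R) (d : ℕ) : R :=
  ((k - 1 : ℕ) : R) ^ (Fintype.card V - 1) *
    ∑ f ∈ Finset.piAntidiag (Finset.univ : Finset V) d,
      (∏ i, (((f i * (k - 1)).factorial : ℕ) : R)⁻¹) *
        MvPolynomial.constantCoeff
          (((Finset.univ : Finset V).toList.map fun i => rowOp A i ^ f i).prod
            ((Matrix.mvPolynomialX V V R ^ (d * (k - 1))).trace))

end

end Tensor

namespace Hypergraph

section
variable {V W : Type*}

/-- Every hyperedge has exactly `k` vertices. -/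
def IsUniform (k : ℕ) (H : Hypergraph V) : Prop := ∀ e ∈ H.edgeSet, e.ncard = k

/-- The degree of a vertex: the number of hyperedges containing it. -/
noncomputable def degree (H : Hypergraph V) (v : V) : ℕ := {e ∈ H.edgeSet | v ∈ e}.ncard

/-- There is a path of length `l` from `u` to `v`: pairwise distinct vertices
`u = x₀, …, x_l = v` and pairwise distinct hyperedges `e₁, …, e_l` with `x_{i-1}, x_i ∈ e_i`. -/
def HasPath (H : Hypergraph V) (u v : V) (l : ℕ) : Prop :=
  ∃ (x : Fin (l + 1) → V) (e : Fin l → Set V),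
    Function.Injective x ∧ Function.Injective e ∧ x 0 = u ∧ x (Fin.last l) = v ∧
      (∀ i, x i ∈ H.vertexSet) ∧
      ∀ i : Fin l, e i ∈ H.edgeSet ∧ x i.castSucc ∈ e i ∧ x i.succ ∈ e i

/-- Any two vertices are joined by a path (and there is at least one vertex). -/
def IsConnected (H : Hypergraph V) : Prop :=
  H.vertexSet.Nonempty ∧ ∀ u ∈ H.vertexSet, ∀ v ∈ H.vertexSet, ∃ l, H.HasPath u v l

/-- There is a cycle of length `l = p + 2 ≥ 2`: pairwise distinct vertices `x₁, …, x_l` and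
pairwise distinct hyperedges `e₁, …, e_l` with `x_i, x_{i+1} ∈ e_i`, indices modulo `l`. -/
def HasCycle (H : Hypergraph V) : Prop :=
  ∃ (p : ℕ) (x : Fin (p + 2) → V) (e : Fin (p + 2) → Set V),
    Function.Injective x ∧ Function.Injective e ∧
      ∀ i, e i ∈ H.edgeSet ∧ x i ∈ e i ∧ x (i + 1) ∈ e i

/-- A `k`-uniform hypertree: a connected `k`-uniform hypergraph without cycles. -/
def IsHypertree (k : ℕ) (H : Hypergraph V) : Prop :=
  H.IsUniform k ∧ H.IsConnected ∧ ¬ H.HasCycle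

/-- The length of a shortest path from `u` to `v`. -/
noncomputable def dist (H : Hypergraph V) (u v : V) : ℕ := sInf {l | H.HasPath u v l}

/-- `d` is the diameter, the largest distance between two vertices, of the (connected)
hypergraph `H`. -/
def HasDiameter (H : Hypergraph V) (d : ℕ) : Prop :=
  IsGreatest {l | ∃ u ∈ H.vertexSet, ∃ v ∈ H.vertexSet, H.dist u v = l} d

/-- Isomorphism of hypergraphs whose vertex sets are the whole types `V` and `W`. -/
def Iso (H : Hypergraph V) (H' : Hypergraph W) : Prop :=
  ∃ φ : V ≃ W, H.image φ = H'

open Classical in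
/-- The adjacency tensor of a `k`-uniform hypergraph with vertex set `V`. -/
noncomputable def adjTensor (k : ℕ) (H : Hypergraph V) : Tensor.KTensor k V ℝ := fun i β =>
  if insert i (Set.range β) ∈ H.edgeSet then 1 / ((k - 1).factorial : ℝ) else 0

open Classical in
/-- The degree tensor: the diagonal tensor of vertex degrees. -/
noncomputable def degTensor (k : ℕ) (H : Hypergraph V) : Tensor.KTensor k V ℝ := fun i β =>
  if ∀ j, β j = i then (H.degree i : ℝ) else 0

/-- The `A_α`-tensor `α D(H) + (1 - α) A(H)`. -/
noncomputable def alphaTensor (k : ℕ) (α : ℝ) (H : Hypergraph V) : Tensor.KTensor k V ℝ :=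
  fun i β => α * H.degTensor k i β + (1 - α) * H.adjTensor k i β

/-- The `d`-th order `A_α`-spectral moment `Tr_d(A_α(H))` of a `k`-uniform hypergraph with
vertex set `V`. -/
noncomputable def moment [Fintype V] [DecidableEq V] (k : ℕ) (α : ℝ) (H : Hypergraph V) (d : ℕ) :
    ℝ :=
  Tensor.trace (H.alphaTensor k α) d

variable [Fintype V] [DecidableEq V] [Fintype W] [DecidableEq W]

/-- `H ≺_α H'`: both have `n` vertices, and for some `d` with `1 ≤ d ≤ n (k-1)^{n-1} - 1` the
moments of order `0, …, d - 1` agree and the `d`-th moment of `H` is smaller. -/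
def Before (k : ℕ) (α : ℝ) (H : Hypergraph V) (H' : Hypergraph W) : Prop :=
  Fintype.card V = Fintype.card W ∧
    ∃ d, 1 ≤ d ∧ d < Fintype.card V * (k - 1) ^ (Fintype.card V - 1) ∧
      (∀ t < d, H.moment k α t = H'.moment k α t) ∧ H.moment k α d < H'.moment k α d

/-- `H =_α H'`: both have `n` vertices, and the moments of order `0, …, n (k-1)^{n-1} - 1`
agree. -/
def MomentEq (k : ℕ) (α : ℝ) (H : Hypergraph V) (H' : Hypergraph W) : Prop :=
  Fintype.card V = Fintype.card W ∧
    ∀ t < Fintype.card V * (k - 1) ^ (Fintype.card V - 1), H.moment k α t = H'.moment k α t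

/-- `H ⪯_α H'`: `H ≺_α H'` or `H =_α H'`. -/
def BeforeEq (k : ℕ) (α : ℝ) (H : Hypergraph V) (H' : Hypergraph W) : Prop :=
  H.Before k α H' ∨ H.MomentEq k α H'

end

/-- The vertices of the starlike hypertree with arm lengths `L`: the common vertex `none`, and for
each arm `a` and each position `j` on it the `k - 1` new vertices `some ⟨a, j, r⟩` of the
`j`-th hyperedge of that arm. -/
abbrev StarlikeVertex (k : ℕ) (L : List ℕ) : Type :=
  Option (Σ a : Fin L.length, Fin (L.get a) × Fin (k - 1))

/-- The `j`-th hyperedge of arm `a` (counted from `0` at the common vertex): its `k - 1` new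
vertices, together with the common vertex if `j = 0`, and otherwise with the last new vertex
(index `k - 2`) of the preceding hyperedge of the same arm. -/
def starlikeEdge (k : ℕ) (L : List ℕ) (a : Fin L.length) (j : Fin (L.get a)) :
    Set (StarlikeVertex k L) :=
  {v | (v = none ∧ j.val = 0) ∨ (∃ r, v = some ⟨a, j, r⟩) ∨
    ∃ (i : Fin (L.get a)) (r : Fin (k - 1)), v = some ⟨a, i, r⟩ ∧ i.val + 1 = j.val ∧
      r.val + 2 = k}

/-- The `k`-uniform starlike hypertree `S_{n₁,…,n_p}^{(k)}`, `L = [n₁, …, n_p]`: hyperpaths of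
lengths `n₁, …, n_p` sharing a common end vertex. -/
def starlike (k : ℕ) (L : List ℕ) : Hypergraph (StarlikeVertex k L) where
  vertexSet := Set.univ
  edgeSet := {e | ∃ (a : Fin L.length) (j : Fin (L.get a)), e = starlikeEdge k L a j}
  subset_vertexSet_of_mem_edgeSet' := fun _ _ => Set.subset_univ _

/-- The list `t, d - t, 1, …, 1` with `t = ⌊d/2⌋` and `m - d` ones. -/
abbrev armLengths (m d : ℕ) : List ℕ := d / 2 :: (d - d / 2) :: List.replicate (m - d) 1

end Hypergraph

/-! Traces expand over closed walks. For the pairing `diffPairing`, differentiation is adjoint to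
multiplication, and this turns Tr_d(A), d > 0, into (k-1)^{n-1} times a sum over d-tuples of indices
(u_s, β_s). Each tuple contributes ∏ A(u_s, β_s) times a coefficient `circuitCoeff` ≥ 0, which is
positive exactly when the arcs u_s → β_{s,q} can be enumerated as one closed walk
(`trace_eq_circuitSum`). The coefficients are invariant under injections of the vertex set. Hence
moments are isomorphism invariants, and `circuitSum` does not see isolated vertices.

Moments of order 0 and 1 depend only on n and m. In order 2 the only further quantity is α² ∑ deg²
(`circuitSum_alphaTensor_two`). A hypertree has n = m(k-1) + 1 vertices, because its incidence graph
is a tree. A path of length d forces degree at least 2 at its d - 1 interior vertices, and what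
remains of the degree sum is an excess of m - d. The sum of squares is largest exactly when the
whole excess sits on one interior vertex (`IsHypertree.sum_degree_sq`). Then the m - d hyperedges
outside the path all hang at that vertex, so T is S_{p,d-p,1,…,1} with 1 ≤ p ≤ d/2
(`IsHypertree.exists_iso_starlike`). Every other T is already smaller in order 2.

It remains to compare p < t = ⌊d/2⌋ when m > d. Let F(x, ε) be the circuit sum of the spider with
arms x and d - x, with (ε = 1) or without (ε = 0) the pendant hyperedges. F(x, 0) belongs to the
hyperpath with d hyperedges and does not depend on x, so F(t,1) - F(p,1) is a second difference.
Term by term it factors into a difference over the indices on the two long arms and a difference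
over the remaining ones (`armWeight_prod_eq`). A nonzero term therefore needs an index off the long
arms as well as an index that notices the change of arm lengths. A closed walk using a hyperedge of
a spider uses it with each of its k vertices as root (`IsCircuit.exists_root`), so going out along p
hyperedges costs kp indices, and two more are needed. Hence the moments agree below order kp + 2. At
order kp + 2 all terms are nonnegative, and one is positive: a loop at the centre, the first p
hyperedges of the first arm, and a loop at the vertex where they end (`spider_circuitSum_eq`,
`spider_circuitSum_lt`). -/

set_option linter.unusedSectionVars false

/-! ### The differential pairing of polynomials -/

namespace MvPolynomial

variable {σ R : Type*} [CommRing R]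

theorem diffPairing_ext {f g : MvPolynomial σ R →ₗ[R] R}
    (h : ∀ M, f (monomial M 1) = g (monomial M 1)) : f = g :=
  (basisMonomials σ R).ext fun M => by simpa [coe_basisMonomials] using h M

theorem prod_X_eq_monomial {ι : Type*} [Fintype ι] (a : ι → σ) :
    ∏ q, (X (a q) : MvPolynomial σ R) = monomial (∑ q, Finsupp.single (a q) 1) 1 := by
  rw [monomial_sum_one]; rfl

theorem sum_single_apply_eq_card {ι : Type*} [Fintype ι] [DecidableEq σ] (a : ι → σ) (s : σ) :
    (∑ q, Finsupp.single (a q) 1 : σ →₀ ℕ) s = Fintype.card {q // a q = s} := by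
  rw [Finsupp.finsetSum_apply, Fintype.card_subtype, Finset.card_filter]
  exact Finset.sum_congr rfl fun q _ => by rw [Finsupp.single_apply]

theorem exists_equiv_labels {ι τ : Type*} [Fintype ι] [Fintype τ] (a : ι → σ) (b : τ → σ)
    (h : (∑ q, Finsupp.single (a q) 1 : σ →₀ ℕ) = ∑ t, Finsupp.single (b t) 1) :
    ∃ e : τ ≃ ι, ∀ t, b t = a (e t) := by
  have := Classical.decEq σ
  have hc : ∀ s, Fintype.card {t // b t = s} = Fintype.card {q // a q = s} := fun s => by
    rw [← sum_single_apply_eq_card, ← sum_single_apply_eq_card, h]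
  exact ⟨(Equiv.sigmaFiberEquiv b).symm.trans
      ((Equiv.sigmaCongrRight fun s => Fintype.equivOfCardEq (hc s)).trans
        (Equiv.sigmaFiberEquiv a)),
    fun t => (Fintype.equivOfCardEq (hc (b t)) ⟨t, rfl⟩).2.symm⟩

variable [Fintype σ]

/-- The pairing `⟨P(∂) Q⟩₀ = ∑_M M! P_M Q_M`, linear in `P`. -/
noncomputable def diffPairing (Q : MvPolynomial σ R) : MvPolynomial σ R →ₗ[R] R :=
  (basisMonomials σ R).constr R fun M => (∏ i, ((M i).factorial : R)) * coeff M Q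

theorem diffPairing_monomial (Q : MvPolynomial σ R) (M : σ →₀ ℕ) :
    diffPairing Q (monomial M 1) = (∏ i, ((M i).factorial : R)) * coeff M Q := by
  have h := (basisMonomials σ R).constr_basis R
    (fun M => (∏ i, ((M i).factorial : R)) * coeff M Q) M
  rwa [coe_basisMonomials] at h

theorem diffPairing_add (Q Q' : MvPolynomial σ R) :
    diffPairing (Q + Q') = diffPairing Q + diffPairing Q' :=
  diffPairing_ext fun M => by simp [diffPairing_monomial, mul_add]

theorem diffPairing_smul (c : R) (Q : MvPolynomial σ R) :
    diffPairing (c • Q) = c • diffPairing Q :=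
  diffPairing_ext fun M => by
    simp only [diffPairing_monomial, coeff_smul, LinearMap.smul_apply, smul_eq_mul]; ring

theorem diffPairing_sum {ι : Type*} (s : Finset ι) (Q : ι → MvPolynomial σ R) :
    diffPairing (∑ i ∈ s, Q i) = ∑ i ∈ s, diffPairing (Q i) := by
  classical
  induction s using Finset.induction_on with
  | empty => exact diffPairing_ext fun M => by simp [diffPairing_monomial]
  | insert a s ha ih => rw [Finset.sum_insert ha, Finset.sum_insert ha, diffPairing_add, ih]

theorem diffPairing_one (Q : MvPolynomial σ R) : diffPairing Q 1 = constantCoeff Q := by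
  have h := diffPairing_monomial Q 0
  simpa [constantCoeff_eq] using h

/-- `O` is the operator `p(∂)`, expressed by adjointness to multiplication by `p`. -/
def IsDiffAdjoint (p : MvPolynomial σ R) (O : Module.End R (MvPolynomial σ R)) : Prop :=
  ∀ P Q, diffPairing Q (p * P) = diffPairing (O Q) P

/-- Raising the exponent of X_s by one multiplies M! by M_s + 1, which is the factor that
differentiation produces. -/
theorem isDiffAdjoint_pderiv (s : σ) :
    IsDiffAdjoint (X s : MvPolynomial σ R)
      ((pderiv s : Derivation R (MvPolynomial σ R) (MvPolynomial σ R)) :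
        Module.End R (MvPolynomial σ R)) := by
  classical
  intro P Q
  have h : (diffPairing Q) ∘ₗ (LinearMap.mulLeft R (X s)) = diffPairing (pderiv s Q) := by
    refine diffPairing_ext fun M => ?_
    rw [LinearMap.comp_apply, LinearMap.mulLeft_apply, diffPairing_monomial, coeff_pderiv,
      X, monomial_mul, one_mul, add_comm, diffPairing_monomial]
    have h1 : ∏ i, (((M + Finsupp.single s 1 : σ →₀ ℕ) i).factorial : R) =
        (M s + 1) * ∏ i, ((M i).factorial : R) := by
      rw [← Finset.mul_prod_erase _ _ (Finset.mem_univ s),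
        ← Finset.mul_prod_erase _ (fun i => ((M i).factorial : R)) (Finset.mem_univ s), ← mul_assoc]
      congr 1
      · simp [Nat.factorial_succ]
      · refine Finset.prod_congr rfl fun i hi => ?_
        rw [Finsupp.add_apply, Finsupp.single_eq_of_ne (Finset.ne_of_mem_erase hi), add_zero]
    rw [h1]; ring
  exact LinearMap.congr_fun h P

theorem IsDiffAdjoint.one : IsDiffAdjoint (1 : MvPolynomial σ R) 1 := fun P Q => by simp

/-- Adjoints reverse compositions; commutativity of polynomial multiplication undoes the reversal.
-/
theorem IsDiffAdjoint.mul {p q : MvPolynomial σ R} {O O' : Module.End R (MvPolynomial σ R)}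
    (h : IsDiffAdjoint p O) (h' : IsDiffAdjoint q O') : IsDiffAdjoint (p * q) (O * O') := by
  intro P Q
  rw [mul_comm p q, mul_assoc, h', h, Module.End.mul_apply]

theorem IsDiffAdjoint.pow {p : MvPolynomial σ R} {O : Module.End R (MvPolynomial σ R)}
    (h : IsDiffAdjoint p O) (n : ℕ) : IsDiffAdjoint (p ^ n) (O ^ n) := by
  induction n with
  | zero => simpa using IsDiffAdjoint.one
  | succ n ih => rw [pow_succ, pow_succ]; exact ih.mul h

theorem IsDiffAdjoint.list_prod {ι : Type*} (l : List ι) {p : ι → MvPolynomial σ R}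
    {O : ι → Module.End R (MvPolynomial σ R)} (h : ∀ i, IsDiffAdjoint (p i) (O i)) :
    IsDiffAdjoint (l.map p).prod (l.map O).prod := by
  induction l with
  | nil => simpa using IsDiffAdjoint.one
  | cons a l ih => simpa using (h a).mul ih

theorem IsDiffAdjoint.sum_smul {ι : Type*} (s : Finset ι) {p : ι → MvPolynomial σ R}
    {O : ι → Module.End R (MvPolynomial σ R)} (c : ι → R) (h : ∀ i, IsDiffAdjoint (p i) (O i)) :
    IsDiffAdjoint (∑ i ∈ s, c i • p i) (∑ i ∈ s, c i • O i) := by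
  intro P Q
  rw [Finset.sum_mul, map_sum, LinearMap.sum_apply, diffPairing_sum, LinearMap.sum_apply]
  refine Finset.sum_congr rfl fun i _ => ?_
  rw [smul_mul_assoc, map_smul, h i, LinearMap.smul_apply, diffPairing_smul, LinearMap.smul_apply]

/-- The number of bijections compatible with two families of labels. -/
theorem card_equiv_labels {ι τ : Type*} [Fintype ι] [Fintype τ] [DecidableEq ι] [DecidableEq τ]
    [DecidableEq σ] (a : ι → σ) (b : τ → σ) :
    Fintype.card {e : τ ≃ ι // ∀ t, b t = a (e t)} =
      if (∑ q, Finsupp.single (a q) 1 : σ →₀ ℕ) = ∑ t, Finsupp.single (b t) 1 then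
        ∏ s, (Fintype.card {q // a q = s}).factorial else 0 := by
  split_ifs with h
  · obtain ⟨e₀, he₀⟩ := exists_equiv_labels a b h
    -- Once one compatible bijection `e₀` exists, all of them differ from it by permutations
    -- preserving the labelling `a`.
    rw [← DomMulAct.stabilizer_card a]
    refine Fintype.card_congr
      { toFun := fun e => ⟨e₀.symm.trans e.1, ?_⟩
        invFun := fun g => ⟨e₀.trans g.1, ?_⟩
        left_inv := fun e => Subtype.ext (by ext; simp)
        right_inv := fun g => Subtype.ext (by ext; simp) }
    · funext q
      have := e.2 (e₀.symm q)
      rw [he₀, Equiv.apply_symm_apply] at this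
      simpa using this.symm
    · intro t
      rw [he₀ t]
      exact (congrFun g.2 (e₀ t)).symm
  · rw [Fintype.card_eq_zero_iff]
    refine ⟨fun e => h ?_⟩
    rw [← Equiv.sum_comp e.1]
    exact Finset.sum_congr rfl fun t _ => by rw [e.2 t]

/-- The factor M! in the pairing counts the matchings of two lists of variables with the same
monomial. -/
theorem diffPairing_prod_X {ι τ : Type*} [Fintype ι] [Fintype τ] [DecidableEq ι] [DecidableEq τ]
    [DecidableEq σ] (a : ι → σ) (b : τ → σ) :
    diffPairing (∏ t, (X (b t) : MvPolynomial σ R)) (∏ q, X (a q)) =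
      (Fintype.card {e : τ ≃ ι // ∀ t, b t = a (e t)} : R) := by
  rw [prod_X_eq_monomial, prod_X_eq_monomial, diffPairing_monomial, coeff_monomial,
    card_equiv_labels]
  simp only [sum_single_apply_eq_card, eq_comm (b := ∑ q, Finsupp.single (a q) 1)]
  split_ifs <;> simp

end MvPolynomial

/-! ### Traces of powers of the generic matrix -/

theorem Fin.sum_pi_succ {V M : Type*} [Fintype V] [AddCommMonoid M] {n : ℕ}
    (F : (Fin (n + 1) → V) → M) :
    ∑ w, F w = ∑ a, ∑ w : Fin n → V, F (Fin.cons a w) := by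
  rw [← Fintype.sum_prod_type']
  exact (Fintype.sum_equiv (Fin.consEquiv fun _ => V) _ _ fun _ => rfl).symm

theorem Matrix.pow_succ_apply_eq_sum {V R : Type*} [Fintype V] [DecidableEq V] [CommSemiring R]
    (M : Matrix V V R) (n : ℕ) (i j : V) :
    (M ^ (n + 1)) i j = ∑ w : Fin n → V, ∏ t : Fin (n + 1),
      M ((Fin.cons i w : Fin (n + 1) → V) t) ((Fin.snoc w j : Fin (n + 1) → V) t) := by
  induction n generalizing i with
  | zero => simp [Fin.snoc]
  | succ n ih =>
    have h : (M ^ (n + 1 + 1)) i j = ∑ a, M i a * (M ^ (n + 1)) a j := by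
      rw [pow_succ', Matrix.mul_apply]
    rw [h, Fin.sum_pi_succ]
    refine Finset.sum_congr rfl fun a _ => ?_
    rw [ih, Finset.mul_sum]
    refine Finset.sum_congr rfl fun w _ => ?_
    rw [Fin.prod_univ_succ (n := n + 1), ← Fin.cons_snoc_eq_snoc_cons]
    simp

/-- The words `w` are closed walks, with `finRotate` as cyclic successor. Positivity of `N` is
needed: for `N = 0` the trace is `|V|`, while there is one empty word. -/
theorem Matrix.trace_pow_eq_sum {V R : Type*} [Fintype V] [DecidableEq V] [CommSemiring R]
    (M : Matrix V V R) {N : ℕ} (hN : 0 < N) :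
    (M ^ N).trace = ∑ w : Fin N → V, ∏ t, M (w t) (w (finRotate N t)) := by
  obtain ⟨n, rfl⟩ : ∃ n, N = n + 1 := ⟨N - 1, by omega⟩
  rw [Fin.sum_pi_succ]
  refine Finset.sum_congr rfl fun i _ => ?_
  rw [Matrix.diag_apply, Matrix.pow_succ_apply_eq_sum]
  refine Finset.sum_congr rfl fun w _ => ?_
  rw [Fin.snoc_eq_cons_rotate]

/-! ### Expansion of the trace of a tensor over closed walks -/

namespace Tensor

open MvPolynomial

section
variable {V W R : Type*}

/-- The number of terms of a sequence equal to `i`. -/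
def rootCount [DecidableEq V] {d : ℕ} (u : Fin d → V) (i : V) : ℕ := Fintype.card {r // u r = i}

/-- The number of rearrangements of a sequence. -/
def arrangementCount [Fintype V] [DecidableEq V] {d : ℕ} (u : Fin d → V) : ℕ :=
  Fintype.card {u' : Fin d → V // rootCount u' = rootCount u}

/-- An enumeration of the arcs `u_r → β_{r,q}` as a closed walk. -/
def IsCircuit {d κ : ℕ} (u : Fin d → V) (β : Fin d → Fin κ → V)
    (σ : Fin (d * κ) ≃ Fin d × Fin κ) : Prop :=
  ∀ t, β (σ t).1 (σ t).2 = u (σ (finRotate _ t)).1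

open Classical in
/-- The number of ways to enumerate the arcs `u_r → β_{r,q}` as a closed walk. -/
noncomputable def circuitCount {d κ : ℕ} (u : Fin d → V) (β : Fin d → Fin κ → V) : ℕ :=
  Fintype.card {σ : Fin (d * κ) ≃ Fin d × Fin κ // IsCircuit u β σ}

/-- The coefficient of `∏_r A_{u_r β_r}` in the normalized trace of order `d`. -/
noncomputable def circuitCoeff (R : Type*) [Field R] [Fintype V] [DecidableEq V] {d κ : ℕ}
    (u : Fin d → V) (β : Fin d → Fin κ → V) : R :=
  (arrangementCount u : R)⁻¹ * (∏ i, (((rootCount u i * κ).factorial : ℕ) : R)⁻¹) *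
    (circuitCount u β : R)

/-- The trace of order `d` without the factor `(k-1)^{n-1}`. -/
noncomputable def circuitSum {k : ℕ} [Field R] [Fintype V] [DecidableEq V] (A : KTensor k V R)
    (d : ℕ) : R :=
  ∑ u : Fin d → V, ∑ β : Fin d → Fin (k - 1) → V, circuitCoeff R u β * ∏ r, A (u r) (β r)

/-- The polynomial whose differential operator is `rowOp A i`. -/
noncomputable def rowPoly {k : ℕ} [CommRing R] [Fintype V] (A : KTensor k V R) (i : V) :
    MvPolynomial (V × V) R :=
  ∑ β : Fin (k - 1) → V, A i β • ∏ q, X (i, β q)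

theorem isDiffAdjoint_rowOp {k : ℕ} [CommRing R] [Fintype V] (A : KTensor k V R) (i : V) :
    IsDiffAdjoint (rowPoly A i) (rowOp A i) := by
  refine IsDiffAdjoint.sum_smul _ _ fun β => ?_
  have h := IsDiffAdjoint.list_prod (List.finRange (k - 1))
    (fun q => isDiffAdjoint_pderiv (R := R) (i, β q))
  unfold rowDeriv
  rwa [← List.ofFn_eq_map, ← List.ofFn_eq_map, List.prod_ofFn] at h

/-- Pairing with 1 reads off the constant coefficient, and adjointness moves all operators to the
other side, where they are commuting polynomials. -/
theorem constantCoeff_rowOps {k : ℕ} [CommRing R] [Fintype V] (A : KTensor k V R) (f : V → ℕ)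
    (Q : MvPolynomial (V × V) R) :
    constantCoeff (((Finset.univ : Finset V).toList.map fun i => rowOp A i ^ f i).prod Q) =
      diffPairing Q (∏ i, rowPoly A i ^ f i) := by
  have h := IsDiffAdjoint.list_prod (Finset.univ : Finset V).toList
    (fun i => (isDiffAdjoint_rowOp A i).pow (f i)) 1 Q
  rw [mul_one, diffPairing_one, Finset.prod_map_toList] at h
  exact h.symm

theorem prod_rowCount [DecidableEq V] [Fintype V] [CommMonoid R] {d : ℕ} (u : Fin d → V)
    (g : V → R) : ∏ r, g (u r) = ∏ i, g i ^ rootCount u i := by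
  rw [← Finset.prod_fiberwise_of_maps_to (g := u) (t := Finset.univ) (fun _ _ => Finset.mem_univ _)]
  refine Finset.prod_congr rfl fun i _ => ?_
  rw [Finset.prod_congr rfl (g := fun _ => g i) (fun r hr => by rw [(Finset.mem_filter.1 hr).2]),
    Finset.prod_const, rootCount, Fintype.card_subtype]

theorem sum_rootCount [DecidableEq V] [Fintype V] {d : ℕ} (u : Fin d → V) :
    ∑ i, rootCount u i = d := by
  simp only [rootCount]
  rw [← Fintype.card_sigma, Fintype.card_congr (Equiv.sigmaFiberEquiv u), Fintype.card_fin]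

theorem exists_rootCount_eq [DecidableEq V] [Fintype V] {d : ℕ} (f : V → ℕ) (hf : ∑ i, f i = d) :
    ∃ u : Fin d → V, rootCount u = f := by
  have e : Fin d ≃ Σ i, Fin (f i) := Fintype.equivOfCardEq (by simp [hf])
  refine ⟨fun r => (e r).1, funext fun i => ?_⟩
  rw [rootCount, ← Fintype.card_fin (f i)]
  exact Fintype.card_congr ((e.subtypeEquiv (q := fun x => x.1 = i) fun _ => Iff.rfl).trans
    (Equiv.sigmaSubtype i))

theorem arrangementCount_pos [DecidableEq V] [Fintype V] {d : ℕ} (u : Fin d → V) :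
    0 < arrangementCount u :=
  Fintype.card_pos_iff.2 ⟨⟨u, rfl⟩⟩

/-- A matching of the steps of a closed walk `w` with the given arcs determines `w` as its sequence
of roots, so pairs (walk, matching) are the same as circuit enumerations. -/
theorem diffPairing_trace_pow [CommRing R] [DecidableEq V] [Fintype V] {d κ : ℕ}
    (hN : 0 < d * κ) (u : Fin d → V) (β : Fin d → Fin κ → V) :
    diffPairing (Matrix.mvPolynomialX V V R ^ (d * κ)).trace
      (∏ r, ∏ q, X (u r, β r q)) = (circuitCount u β : R) := by
  classical
  rw [Matrix.trace_pow_eq_sum _ hN, diffPairing_sum, LinearMap.sum_apply,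
    ← Fintype.prod_prod_type' (f := fun r q => (X (u r, β r q) : MvPolynomial (V × V) R))]
  simp only [Matrix.mvPolynomialX_apply]
  have h : ∀ w : Fin (d * κ) → V,
      diffPairing (∏ t, (X (w t, w (finRotate _ t)) : MvPolynomial (V × V) R))
        (∏ x : Fin d × Fin κ, X (u x.1, β x.1 x.2)) =
      ((Fintype.card {e : Fin (d * κ) ≃ Fin d × Fin κ //
        ∀ t, (w t, w (finRotate _ t)) = (u (e t).1, β (e t).1 (e t).2)} : ℕ) : R) := fun w => by
    convert diffPairing_prod_X (R := R) (fun x : Fin d × Fin κ => (u x.1, β x.1 x.2))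
      (fun t => (w t, w (finRotate _ t)))
  rw [Finset.sum_congr rfl fun w _ => h w, ← Nat.cast_sum, ← Fintype.card_sigma]
  congr 1
  refine Fintype.card_congr
    { toFun := fun x => ⟨x.2.1, fun t => ?_⟩
      invFun := fun σ => ⟨fun t => u (σ.1 t).1, σ.1, fun t => ?_⟩
      left_inv := ?_
      right_inv := fun σ => rfl }
  · have h1 := (Prod.ext_iff.1 (x.2.2 t)).2
    have h2 := (Prod.ext_iff.1 (x.2.2 (finRotate _ t))).1
    exact h1.symm.trans h2
  · exact Prod.ext rfl (σ.2 t).symm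
  · rintro ⟨w, e, h⟩
    obtain rfl : w = fun t => u (e t).1 := funext fun t => (Prod.ext_iff.1 (h t)).1
    rfl

theorem prod_rowPoly {k : ℕ} [CommRing R] [Fintype V] (A : KTensor k V R) {d : ℕ}
    (u : Fin d → V) :
    ∏ r, rowPoly A (u r) = ∑ β : Fin d → Fin (k - 1) → V,
      (∏ r, A (u r) (β r)) • ∏ r, ∏ q, X (u r, β r q) := by
  classical
  simp only [rowPoly]
  rw [Fintype.prod_sum]
  refine Finset.sum_congr rfl fun β _ => ?_
  rw [Finset.prod_smul]

/-- The exponents (d_i) are the root counts of a sequence `u`. All sequences with the same root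
counts give the same value, so dividing by their number replaces the sum over exponents by a sum
over sequences. -/
theorem trace_eq_circuitSum {k : ℕ} [Field R] [CharZero R] [Fintype V] [DecidableEq V]
    (hk : 2 ≤ k) (A : KTensor k V R) {d : ℕ} (hd : 0 < d) :
    trace A d = ((k - 1 : ℕ) : R) ^ (Fintype.card V - 1) * circuitSum A d := by
  have hN : 0 < d * (k - 1) := Nat.mul_pos hd (by omega)
  unfold trace circuitSum
  congr 1
  rw [← Finset.sum_fiberwise_of_maps_to (g := rootCount) (t := Finset.piAntidiag Finset.univ d)
    (s := (Finset.univ : Finset (Fin d → V)))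
    (fun u _ => by simp [Finset.mem_piAntidiag, sum_rootCount])]
  refine Finset.sum_congr rfl fun f hf => ?_
  obtain ⟨u₀, hu₀⟩ := exists_rootCount_eq f (d := d) (by simpa using (Finset.mem_piAntidiag.1 hf).1)
  have h1 : ∀ u ∈ Finset.univ.filter (fun u : Fin d → V => rootCount u = f),
      ∑ β : Fin d → Fin (k - 1) → V, circuitCoeff R u β * ∏ r, A (u r) (β r) =
        (arrangementCount u₀ : R)⁻¹ * ((∏ i, (((f i * (k - 1)).factorial : ℕ) : R)⁻¹) *
          diffPairing (Matrix.mvPolynomialX V V R ^ (d * (k - 1))).trace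
            (∏ i, rowPoly A i ^ f i)) := by
    intro u hu
    have hu' : rootCount u = f := (Finset.mem_filter.1 hu).2
    have ha : arrangementCount u = arrangementCount u₀ := by
      unfold arrangementCount; rw [hu', hu₀]
    rw [← hu', ← prod_rowCount u (rowPoly A), prod_rowPoly, map_sum, Finset.mul_sum,
      Finset.mul_sum]
    refine Finset.sum_congr rfl fun β _ => ?_
    rw [map_smul, diffPairing_trace_pow hN, circuitCoeff, ha, smul_eq_mul]
    ring
  rw [Finset.sum_congr rfl h1, Finset.sum_const, constantCoeff_rowOps, nsmul_eq_mul]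
  have h2 : (Finset.univ.filter (fun u : Fin d → V => rootCount u = f)).card =
      arrangementCount u₀ := by
    rw [arrangementCount, Fintype.card_subtype, hu₀]
  rw [h2, mul_inv_cancel_left₀ (Nat.cast_ne_zero.2 (arrangementCount_pos u₀).ne')]

/-- Order zero stands apart: the trace of the zeroth power is `|V|`, whereas `circuitSum A 0` is 1.
-/
theorem trace_zero {k : ℕ} [Field R] [Fintype V] [DecidableEq V] (A : KTensor k V R) :
    trace A 0 = ((k - 1 : ℕ) : R) ^ (Fintype.card V - 1) * (Fintype.card V : R) := by
  simp [trace, constantCoeff_rowOps, diffPairing_one]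

end

end Tensor

/-! ### Properties of the circuit coefficients -/

namespace Tensor

section
variable {V W : Type*}

section Circuit
variable {d κ : ℕ} {u : Fin d → V} {β : Fin d → Fin κ → V} {σ : Fin (d * κ) ≃ Fin d × Fin κ}

theorem IsCircuit.head_mem_range (h : IsCircuit u β σ) (r : Fin d) (q : Fin κ) :
    β r q ∈ Set.range u := by
  have := h (σ.symm (r, q))
  rw [Equiv.apply_symm_apply] at this
  exact ⟨_, this.symm⟩

/-- A set of vertices that no arc of a closed walk leaves contains all its vertices or none. -/
theorem IsCircuit.mem_of_closed (h : IsCircuit u β σ) (hκ : 0 < κ) (U : Set V)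
    (hU : ∀ r, u r ∈ U → ∀ q, β r q ∈ U) {r₀ : Fin d} (h₀ : u r₀ ∈ U) (r : Fin d) : u r ∈ U := by
  have hstep : ∀ t, u (σ t).1 ∈ U → u (σ (finRotate _ t)).1 ∈ U := fun t ht => by
    rw [← h t]; exact hU _ ht _
  have hN : d * κ ≠ 0 := Nat.mul_ne_zero (Nat.ne_zero_of_lt r.isLt) hκ.ne'
  have : NeZero (d * κ) := ⟨hN⟩
  -- Adding `j` cyclically is taking `j` steps along the walk, so the difference of two positions
  -- leads from one to the other.
  have key : ∀ (t₀ : Fin (d * κ)), u (σ t₀).1 ∈ U → ∀ j : ℕ,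
      u (σ (t₀ + Fin.ofNat (d * κ) j)).1 ∈ U := by
    intro t₀ ht₀ j
    induction j with
    | zero => simpa using ht₀
    | succ j ih =>
      have := hstep _ ih
      rw [finRotate_apply, add_assoc] at this
      convert this using 5
      apply Fin.ext
      simp [Fin.val_add]
  have h1 := key (σ.symm (r₀, ⟨0, hκ⟩)) (by simpa using h₀)
    (σ.symm (r, ⟨0, hκ⟩) - σ.symm (r₀, ⟨0, hκ⟩)).val
  simpa using h1

/-- A closed walk enters every vertex as often as it leaves it. -/
theorem IsCircuit.balanced {M : Type*} [AddCommMonoid M] (h : IsCircuit u β σ) (f : V → M) :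
    ∑ r, ∑ q, f (β r q) = ∑ r, κ • f (u r) := by
  have h1 : ∑ r, ∑ q, f (β r q) = ∑ t, f (β (σ t).1 (σ t).2) := by
    rw [← Fintype.sum_prod_type', ← σ.sum_comp]
  have h2 : ∑ r, κ • f (u r) = ∑ t, f (u (σ t).1) := by
    rw [σ.sum_comp (fun x => f (u x.1)), Fintype.sum_prod_type]
    simp
  rw [h1, h2, ← Equiv.sum_comp (finRotate (d * κ)) (fun t => f (u (σ t).1))]
  exact Finset.sum_congr rfl fun t _ => by rw [h t]

end Circuit

theorem circuitCount_comp {d κ : ℕ} {φ : V → W} (hφ : Function.Injective φ) (u : Fin d → V) (β : Fin d → Fin κ → V) :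
    circuitCount (φ ∘ u) (fun r => φ ∘ β r) = circuitCount u β := by
  classical
  unfold circuitCount
  refine Fintype.card_congr (Equiv.subtypeEquivRight fun σ => ?_)
  simp only [IsCircuit, Function.comp, hφ.eq_iff]

section Coeff
variable [DecidableEq V] [DecidableEq W] {d κ : ℕ} {φ : V → W}

theorem rootCount_comp (hφ : Function.Injective φ) (u : Fin d → V) (i : V) :
    rootCount (φ ∘ u) (φ i) = rootCount u i :=
  Fintype.card_congr (Equiv.subtypeEquivRight fun _ => hφ.eq_iff)

theorem rootCount_eq_zero_iff (u : Fin d → V) (i : V) : rootCount u i = 0 ↔ i ∉ Set.range u := by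
  rw [rootCount, Fintype.card_eq_zero_iff, isEmpty_subtype]
  simp

variable [Fintype V]

theorem circuitCoeff_nonneg (u : Fin d → V) (β : Fin d → Fin κ → V) : 0 ≤ circuitCoeff ℝ u β := by
  unfold circuitCoeff; positivity

theorem exists_isCircuit_of_circuitCoeff_ne_zero {u : Fin d → V} {β : Fin d → Fin κ → V}
    (h : circuitCoeff ℝ u β ≠ 0) : ∃ σ, IsCircuit u β σ := by
  by_contra! hσ
  refine h ?_
  have : circuitCount u β = 0 := by
    classical
    unfold circuitCount
    rw [Fintype.card_eq_zero_iff]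
    exact ⟨fun σ => hσ _ σ.2⟩
  rw [circuitCoeff, this]; simp

theorem IsCircuit.circuitCoeff_pos {u : Fin d → V} {β : Fin d → Fin κ → V}
    {σ : Fin (d * κ) ≃ Fin d × Fin κ} (h : IsCircuit u β σ) : 0 < circuitCoeff ℝ u β := by
  have h1 : 0 < circuitCount u β := by
    classical
    unfold circuitCount
    exact Fintype.card_pos_iff.2 ⟨⟨σ, h⟩⟩
  have h2 := arrangementCount_pos u
  unfold circuitCoeff
  refine mul_pos (mul_pos (by positivity) (Finset.prod_pos fun i _ => ?_)) (by positivity)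
  exact inv_pos.2 (Nat.cast_pos.2 (Nat.factorial_pos _))

variable [Fintype W]

/-- A rearrangement of `φ ∘ u` takes no value outside the range of `φ`, hence comes from a
rearrangement of `u`. -/
theorem arrangementCount_comp (hφ : Function.Injective φ) (u : Fin d → V) :
    arrangementCount (φ ∘ u) = arrangementCount u := by
  have hr : ∀ i ∉ Set.range φ, rootCount (φ ∘ u) i = 0 := fun i hi =>
    (rootCount_eq_zero_iff _ _).2 fun ⟨r, hr⟩ => hi ⟨_, hr⟩
  have hm : ∀ u' : Fin d → V, rootCount u' = rootCount u →
      rootCount (φ ∘ u') = rootCount (φ ∘ u) := fun u' hu' => by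
    funext i
    by_cases hi : i ∈ Set.range φ
    · obtain ⟨v, rfl⟩ := hi
      rw [rootCount_comp hφ, rootCount_comp hφ, hu']
    · rw [hr i hi]
      exact (rootCount_eq_zero_iff _ _).2 fun ⟨r, hr⟩ => hi ⟨_, hr⟩
  refine (Fintype.card_congr (Equiv.ofBijective (fun u' : {u' : Fin d → V //
    rootCount u' = rootCount u} => (⟨φ ∘ u'.1, hm u'.1 u'.2⟩ : {w : Fin d → W //
    rootCount w = rootCount (φ ∘ u)})) ⟨?_, ?_⟩)).symm
  · intro a b hab
    exact Subtype.ext (hφ.comp_left (Subtype.ext_iff.1 hab))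
  · rintro ⟨w, hw⟩
    have : ∀ r, ∃ v, φ v = w r := fun r => by
      by_contra hn
      have h0 : rootCount w (w r) = 0 := by rw [hw]; exact hr _ fun ⟨v, hv⟩ => hn ⟨v, hv⟩
      exact (rootCount_eq_zero_iff _ _).1 h0 ⟨r, rfl⟩
    choose v hv using this
    obtain rfl : φ ∘ v = w := funext hv
    refine ⟨⟨v, funext fun i => ?_⟩, rfl⟩
    rw [← rootCount_comp hφ, hw, rootCount_comp hφ]

theorem circuitCoeff_comp (hφ : Function.Injective φ) (u : Fin d → V) (β : Fin d → Fin κ → V) :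
    circuitCoeff ℝ (φ ∘ u) (fun r => φ ∘ β r) = circuitCoeff ℝ u β := by
  unfold circuitCoeff
  rw [circuitCount_comp hφ, arrangementCount_comp hφ]
  congr 2
  refine (Fintype.prod_of_injective φ hφ _ _ (fun i hi => ?_) fun i => ?_).symm
  · rw [(rootCount_eq_zero_iff _ _).2 fun ⟨r, hr⟩ => hi ⟨_, hr⟩]; simp
  · rw [rootCount_comp hφ]

/-- Tuples with an entry outside the image have weight zero, so enlarging the index set changes
nothing. -/
theorem circuitSum_eq_of_injective {k : ℕ} (hφ : Function.Injective φ) (A : KTensor k V ℝ)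
    (B : KTensor k W ℝ) (hAB : ∀ i β, B (φ i) (φ ∘ β) = A i β)
    (hB : ∀ i β, B i β ≠ 0 → i ∈ Set.range φ ∧ ∀ q, β q ∈ Set.range φ) (d : ℕ) :
    circuitSum A d = circuitSum B d := by
  unfold circuitSum
  rw [← Fintype.sum_prod_type', ← Fintype.sum_prod_type']
  refine Fintype.sum_of_injective
    (fun x : (Fin d → V) × (Fin d → Fin (k - 1) → V) => (φ ∘ x.1, fun r => φ ∘ x.2 r))
    ?_ _ _ ?_ ?_
  · rintro ⟨u, β⟩ ⟨u', β'⟩ h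
    obtain ⟨h1, h2⟩ := Prod.ext_iff.1 h
    exact Prod.ext (hφ.comp_left h1) (funext fun r => hφ.comp_left (congrFun h2 r))
  · rintro ⟨u, β⟩ h
    by_contra hne
    have h1 : ∀ r, B (u r) (β r) ≠ 0 := fun r hr =>
      hne (mul_eq_zero_of_right _ (Finset.prod_eq_zero (Finset.mem_univ r) hr))
    choose v hv using fun r => (hB _ _ (h1 r)).1
    choose γ hγ using fun r => (hB _ _ (h1 r)).2
    exact h ⟨(v, γ), Prod.ext (funext hv) (funext fun r => funext fun q => hγ r q)⟩
  · rintro ⟨u, β⟩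
    simp only [circuitCoeff_comp hφ]
    congr 1
    exact Finset.prod_congr rfl fun r _ => (hAB _ _).symm

/-- The loops at a single vertex have coefficient one. -/
theorem circuitCoeff_const (i : V) :
    circuitCoeff ℝ (fun _ : Fin d => i) (fun _ (_ : Fin κ) => i) = 1 := by
  classical
  have h1 : circuitCount (fun _ : Fin d => i) (fun _ (_ : Fin κ) => i) = (d * κ).factorial := by
    unfold circuitCount
    rw [Fintype.card_congr (Equiv.subtypeUnivEquiv
      (p := IsCircuit (fun _ : Fin d => i) (fun _ (_ : Fin κ) => i)) fun σ t => rfl),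
      Fintype.card_equiv finProdFinEquiv.symm, Fintype.card_fin]
  have h2 : ∀ j, rootCount (fun _ : Fin d => i) j = if j = i then d else 0 := fun j => by
    split_ifs with h
    · subst h
      rw [rootCount, Fintype.card_congr (Equiv.subtypeUnivEquiv fun _ => rfl), Fintype.card_fin]
    · refine (rootCount_eq_zero_iff _ _).2 ?_
      rintro ⟨r, hr⟩; exact h hr.symm
  have h3 : arrangementCount (fun _ : Fin d => i) = 1 := by
    refine Fintype.card_eq_one_iff.2 ⟨⟨_, rfl⟩, fun u' => Subtype.ext (funext fun r => ?_)⟩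
    by_contra hne
    have := congrFun u'.2 (u'.1 r)
    rw [h2, if_neg hne, rootCount_eq_zero_iff] at this
    exact this ⟨r, rfl⟩
  unfold circuitCoeff
  rw [h1, h3, Finset.prod_eq_single i]
  · rw [h2, if_pos rfl, Nat.cast_one, inv_one, one_mul]
    exact inv_mul_cancel₀ (Nat.cast_ne_zero.2 (Nat.factorial_ne_zero _))
  · intro j _ hj
    rw [h2, if_neg hj]; simp
  · simp

/-- The heads of a closed walk are among its roots. A constant root sequence thus forces constant
heads, and such tuples contribute the power sum of the diagonal entries. -/
theorem circuitSum_eq_add {k : ℕ} (A : KTensor k V ℝ) (hd : 0 < d) :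
    circuitSum A d = ∑ i, A i (fun _ => i) ^ d +
      ∑ u : Fin d → V with ∀ i, u ≠ fun _ => i, ∑ β : Fin d → Fin (k - 1) → V,
        circuitCoeff ℝ u β * ∏ r, A (u r) (β r) := by
  classical
  have hinj : Function.Injective fun (i : V) (_ : Fin d) => i := fun i j h => congrFun h ⟨0, hd⟩
  have himg : (Finset.univ.filter fun u : Fin d → V => ∃ i, u = fun _ => i) =
      Finset.univ.image fun (i : V) (_ : Fin d) => i := by
    ext u; simp [eq_comm]
  unfold circuitSum
  rw [← Finset.sum_filter_add_sum_filter_not Finset.univ (fun u : Fin d → V => ∃ i, u = fun _ => i)]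
  congr 1
  · rw [himg, Finset.sum_image hinj.injOn]
    refine Finset.sum_congr rfl fun i _ => ?_
    rw [Finset.sum_eq_single fun _ _ => i]
    · rw [circuitCoeff_const i, one_mul, Finset.prod_const, Finset.card_univ, Fintype.card_fin]
    · intro β _ hβ
      by_contra hne
      obtain ⟨σ, hσ⟩ := exists_isCircuit_of_circuitCoeff_ne_zero (left_ne_zero_of_mul hne)
      refine hβ (funext fun r => funext fun q => ?_)
      obtain ⟨_, h⟩ := hσ.head_mem_range r q
      exact h.symm
    · simp
  · refine Finset.sum_congr (Finset.filter_congr fun u _ => by push Not; rfl) fun _ _ => rfl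

end Coeff
end
end Tensor

/-! ### Moments of low order and invariance under embeddings -/

namespace Hypergraph

open Tensor

section
variable {V W : Type*}

theorem degree_eq_of_injective {H : Hypergraph V} {H' : Hypergraph W} {φ : V → W}
    (hφ : Function.Injective φ) (hE : H'.edgeSet = Set.image φ '' H.edgeSet) (v : V) :
    H'.degree (φ v) = H.degree v := by
  unfold degree
  rw [← Set.ncard_image_of_injective _ (Set.image_injective.2 hφ)]
  congr 1
  ext e'
  simp only [hE, Set.mem_ofPred_eq, Set.mem_image]
  constructor
  · rintro ⟨⟨e, he, rfl⟩, h⟩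
    exact ⟨e, ⟨he, by simpa [hφ.eq_iff] using h⟩, rfl⟩
  · rintro ⟨e, ⟨he, hv⟩, rfl⟩
    exact ⟨⟨e, he, rfl⟩, v, hv, rfl⟩

/-- Vertices outside the image lie in no hyperedge, so even their diagonal entries vanish. This
allows hypergraphs of different shapes to be placed in one vertex set. -/
theorem circuitSum_alphaTensor_eq [Fintype V] [DecidableEq V] [Fintype W] [DecidableEq W]
    {H : Hypergraph V} {H' : Hypergraph W} {φ : V → W} (hφ : Function.Injective φ)
    (hE : H'.edgeSet = Set.image φ '' H.edgeSet) (k : ℕ) (α : ℝ) (d : ℕ) :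
    circuitSum (H.alphaTensor k α) d = circuitSum (H'.alphaTensor k α) d := by
  classical
  refine circuitSum_eq_of_injective hφ _ _ (fun i β => ?_) (fun i β h => ?_) d
  · have h1 : H'.degTensor k (φ i) (φ ∘ β) = H.degTensor k i β := by
      have hj : (∀ j, (φ ∘ β) j = φ i) ↔ ∀ j, β j = i := forall_congr' fun j => hφ.eq_iff
      by_cases h : ∀ j, β j = i
      · rw [degTensor, degTensor, if_pos h, if_pos (hj.2 h), degree_eq_of_injective hφ hE]
      · rw [degTensor, degTensor, if_neg h, if_neg (mt hj.1 h)]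
    have h2 : H'.adjTensor k (φ i) (φ ∘ β) = H.adjTensor k i β := by
      have : insert (φ i) (Set.range (φ ∘ β)) = φ '' insert i (Set.range β) := by
        rw [Set.image_insert_eq, Set.range_comp]
      simp only [adjTensor, this, hE, (Set.image_injective.2 hφ).mem_set_image]
    simp only [alphaTensor, h1, h2]
  · by_cases h1 : insert i (Set.range β) ∈ H'.edgeSet
    · rw [hE] at h1
      obtain ⟨e, _, he⟩ := h1
      have hsub : insert i (Set.range β) ⊆ Set.range φ := he ▸ Set.image_subset_range _ _
      exact ⟨hsub (Set.mem_insert _ _), fun q => hsub (Set.mem_insert_of_mem _ ⟨q, rfl⟩)⟩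
    · have h2 : H'.degTensor k i β ≠ 0 := fun h0 => h (by simp [alphaTensor, adjTensor, h1, h0])
      have h3 : ∀ j, β j = i := by
        by_contra hn; exact h2 (if_neg hn)
      have h4 : H'.degree i ≠ 0 := fun h0 => h2 (by simp [degTensor, h0])
      obtain ⟨e', he', hi⟩ := Set.nonempty_of_ncard_ne_zero h4
      rw [hE] at he'
      obtain ⟨e, _, rfl⟩ := he'
      have : i ∈ Set.range φ := Set.image_subset_range _ _ hi
      exact ⟨this, fun q => (h3 q).symm ▸ this⟩

variable [Fintype V] [DecidableEq V]

theorem moment_zero (k : ℕ) (α : ℝ) (H : Hypergraph V) :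
    H.moment k α 0 = ((k - 1 : ℕ) : ℝ) ^ (Fintype.card V - 1) * (Fintype.card V : ℝ) :=
  trace_zero _

theorem moment_eq_circuitSum {k : ℕ} (hk : 2 ≤ k) (α : ℝ) (H : Hypergraph V) {d : ℕ} (hd : 0 < d) :
    H.moment k α d =
      ((k - 1 : ℕ) : ℝ) ^ (Fintype.card V - 1) * circuitSum (H.alphaTensor k α) d :=
  trace_eq_circuitSum hk _ hd

variable [Fintype W] [DecidableEq W]

theorem Iso.card_eq {H : Hypergraph V} {H' : Hypergraph W} (h : H.Iso H') :
    Fintype.card V = Fintype.card W :=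
  Fintype.card_congr h.choose

theorem Iso.moment_eq {H : Hypergraph V} {H' : Hypergraph W} (h : H.Iso H') {k : ℕ} (hk : 2 ≤ k)
    (α : ℝ) (d : ℕ) : H.moment k α d = H'.moment k α d := by
  rcases Nat.eq_zero_or_pos d with rfl | hd
  · rw [moment_zero, moment_zero, h.card_eq]
  · rw [moment_eq_circuitSum hk α H hd, moment_eq_circuitSum hk α H' hd, h.card_eq]
    obtain ⟨φ, rfl⟩ := h
    rw [circuitSum_alphaTensor_eq (H' := H.image φ) φ.injective rfl]

theorem Iso.momentEq {H : Hypergraph V} {H' : Hypergraph W} (h : H.Iso H') {k : ℕ} (hk : 2 ≤ k)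
    (α : ℝ) : H.MomentEq k α H' :=
  ⟨h.card_eq, fun d _ => h.moment_eq hk α d⟩

/-- Double counting of incidences. -/
theorem sum_degree {k : ℕ} {H : Hypergraph V} (hH : H.IsUniform k) :
    ∑ v, H.degree v = k * H.edgeSet.ncard := by
  classical
  have h1 : ∀ v, H.degree v = ∑ e : Set V with e ∈ H.edgeSet, if v ∈ e then 1 else 0 := fun v => by
    rw [← Finset.card_filter, Finset.filter_filter, degree, ← Set.ncard_coe_finset]
    simp
  have h2 : H.edgeSet.ncard = ({e | e ∈ H.edgeSet} : Finset (Set V)).card := by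
    rw [← Set.ncard_coe_finset]; simp
  simp only [h1]
  rw [Finset.sum_comm, h2, mul_comm, ← smul_eq_mul, ← Finset.sum_const]
  refine Finset.sum_congr rfl fun e he => ?_
  rw [← hH e (by simpa using he), ← Finset.card_filter, ← Set.ncard_coe_finset]
  simp

theorem alphaTensor_const {k : ℕ} (hk : 2 ≤ k) (α : ℝ) {H : Hypergraph V} (hH : H.IsUniform k)
    (i : V) : H.alphaTensor k α i (fun _ => i) = α * H.degree i := by
  have h : insert i (Set.range fun _ : Fin (k - 1) => i) ∉ H.edgeSet := fun h => by
    have h1 := hH _ h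
    have h2 : insert i (Set.range fun _ : Fin (k - 1) => i) = {i} := by
      ext; simp; tauto
    rw [h2, Set.ncard_singleton] at h1
    omega
  simp [alphaTensor, degTensor, adjTensor, h]

theorem circuitSum_alphaTensor_one {k : ℕ} (hk : 2 ≤ k) (α : ℝ) {H : Hypergraph V}
    (hH : H.IsUniform k) :
    circuitSum (H.alphaTensor k α) 1 = α * (k * H.edgeSet.ncard : ℕ) := by
  rw [circuitSum_eq_add _ Nat.one_pos, Finset.filter_false_of_mem, Finset.sum_empty, add_zero,
    ← sum_degree hH, Nat.cast_sum, Finset.mul_sum]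
  · exact Finset.sum_congr rfl fun i _ => by rw [pow_one, alphaTensor_const hk α hH]
  · intro u _ h
    exact h (u 0) (funext fun r => by rw [Subsingleton.elim r 0])

/-- The coefficient of a pair of opposite arcs. -/
noncomputable def digonCoeff : ℝ :=
  circuitCoeff ℝ (fun r : Fin 2 => r) (fun r (_ : Fin 1) => finRotate 2 r)

theorem circuitCoeff_digon (u : Fin 2 → V) (hu : u 0 ≠ u 1) :
    circuitCoeff ℝ u (fun r (_ : Fin 1) => u (finRotate 2 r)) = digonCoeff := by
  refine circuitCoeff_comp (φ := u) ?_ (fun r : Fin 2 => r) (fun r (_ : Fin 1) => finRotate 2 r)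
  intro a b h
  fin_cases a <;> fin_cases b <;> simp_all

/-- If no arc left `u r` for the other root, `{u r}` would be closed under arcs and the walk would
never reach that root. -/
theorem _root_.Tensor.IsCircuit.exists_head_eq {κ : ℕ} (hκ : 0 < κ) {u : Fin 2 → V}
    (hu : u 0 ≠ u 1) {β : Fin 2 → Fin κ → V} {σ : Fin (2 * κ) ≃ Fin 2 × Fin κ}
    (h : IsCircuit u β σ) (r : Fin 2) : ∃ q, β r q = u (finRotate 2 r) := by
  have hne : u (finRotate 2 r) ≠ u r := by fin_cases r <;> simp [hu, hu.symm]
  have h2 : ∀ s : Fin 2, s = r ∨ s = finRotate 2 r := by fin_cases r <;> decide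
  by_contra! hq
  have hr : ∀ q, β r q = u r := fun q => by
    obtain ⟨s, hs⟩ := h.head_mem_range r q
    rcases h2 s with rfl | rfl
    · exact hs.symm
    · exact absurd hs.symm (hq q)
  refine hne (h.mem_of_closed hκ {u r} (fun s hs q => ?_) (r₀ := r) rfl (finRotate 2 r))
  rcases h2 s with rfl | rfl
  · exact hr q
  · exact absurd hs hne

theorem degree_eq_card_filter {H : Hypergraph V} (hH : H.IsUniform 2) (v : V)
    [DecidablePred fun w => v ≠ w ∧ {v, w} ∈ H.edgeSet] :
    H.degree v = (Finset.univ.filter fun w => v ≠ w ∧ {v, w} ∈ H.edgeSet).card := by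
  rw [degree, ← Set.ncard_coe_finset, ← Set.InjOn.ncard_image (f := fun w => ({v, w} : Set V))]
  · congr 1
    ext e
    simp only [Set.mem_ofPred_eq, Finset.coe_filter, Finset.mem_univ, true_and, Set.mem_image]
    constructor
    · rintro ⟨he, hv⟩
      obtain ⟨x, y, hxy, rfl⟩ := Set.ncard_eq_two.1 (hH e he)
      rcases hv with rfl | rfl
      · exact ⟨y, ⟨hxy, he⟩, rfl⟩
      · exact ⟨x, ⟨hxy.symm, Set.pair_comm x v ▸ he⟩, Set.pair_comm v x⟩
    · rintro ⟨w, ⟨_, h⟩, rfl⟩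
      exact ⟨h, Set.mem_insert _ _⟩
  · intro w hw w' hw' h
    have h1 : w ∈ ({v, w'} : Set V) := by
      rw [← show ({v, w} : Set V) = {v, w'} from h]; simp
    simp only [Finset.coe_filter, Set.mem_ofPred_eq] at hw
    rcases h1 with h1 | h1
    · exact absurd h1.symm hw.2.1
    · exact h1

/-- With two distinct roots all heads lie in `{u 0, u 1}`, so a hyperedge used by the walk has at
most two vertices. This is impossible for `k ≥ 3`; for `k = 2` the walk runs back and forth along an
edge, once for each ordered pair of adjacent vertices. -/
theorem sum_nonconst_eq {k : ℕ} (hk : 2 ≤ k) (α : ℝ) {H : Hypergraph V} (hH : H.IsUniform k) :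
    ∑ u : Fin 2 → V with ∀ i, u ≠ fun _ => i, ∑ β : Fin 2 → Fin (k - 1) → V,
        circuitCoeff ℝ u β * ∏ r, H.alphaTensor k α (u r) (β r) =
      if k = 2 then digonCoeff * (1 - α) ^ 2 * (k * H.edgeSet.ncard : ℕ) else 0 := by
  classical
  have hne : ∀ u : Fin 2 → V, (∀ i, u ≠ fun _ => i) ↔ u 0 ≠ u 1 := fun u => by
    constructor
    · exact fun h h01 => h (u 0) (funext fun r => by fin_cases r <;> simp [h01])
    · rintro h i rfl; exact h rfl
  simp only [hne]
  split_ifs with hk2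
  · subst hk2
    have hA : ∀ v w, v ≠ w → H.alphaTensor 2 α v (fun _ => w) =
        if {v, w} ∈ H.edgeSet then 1 - α else 0 := fun v w hvw => by
      have h1 : insert v (Set.range fun _ : Fin (2 - 1) => w) = {v, w} := by
        ext; simp
      have h2 : H.degTensor 2 v (fun _ => w) = 0 := if_neg fun h => hvw (h 0).symm
      rw [alphaTensor, h2, adjTensor, h1]
      split_ifs <;> simp
    have hsum : ∀ u : Fin 2 → V, u 0 ≠ u 1 → ∑ β : Fin 2 → Fin (2 - 1) → V,
        circuitCoeff ℝ u β * ∏ r, H.alphaTensor 2 α (u r) (β r) =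
          if {u 0, u 1} ∈ H.edgeSet then digonCoeff * (1 - α) ^ 2 else 0 := fun u hu => by
      rw [Finset.sum_eq_single fun r _ => u (finRotate 2 r)]
      · have h := circuitCoeff_digon u hu
        have h1 : circuitCoeff ℝ u (fun r (_ : Fin (2 - 1)) => u (finRotate 2 r)) = digonCoeff := h
        rw [h1, Fin.prod_univ_two, hA _ _ (by simpa using hu), hA _ _ (by simpa using hu.symm)]
        simp only [finRotate_apply, zero_add, Fin.reduceAdd, Set.pair_comm (u 1) (u 0)]
        split_ifs <;> simp [sq]
      · intro β _ hβ
        by_contra h0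
        obtain ⟨σ, hσ⟩ := exists_isCircuit_of_circuitCoeff_ne_zero (left_ne_zero_of_mul h0)
        refine hβ (funext fun r => funext fun q => ?_)
        obtain ⟨q', hq'⟩ := hσ.exists_head_eq Nat.one_pos hu r
        rw [← hq']; congr 1; exact Fin.ext (by omega)
      · simp
    rw [Finset.sum_congr rfl fun u hu => hsum u (Finset.mem_filter.1 hu).2, Finset.sum_filter,
      ← (finTwoArrowEquiv V).symm.sum_comp, Fintype.sum_prod_type, ← sum_degree hH,
      Nat.cast_sum, Finset.mul_sum]
    refine Finset.sum_congr rfl fun v _ => ?_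
    rw [degree_eq_card_filter hH, Finset.card_filter, Nat.cast_sum, Finset.mul_sum]
    refine Finset.sum_congr rfl fun w _ => ?_
    by_cases h1 : v = w <;> by_cases h2 : {v, w} ∈ H.edgeSet <;> simp [h1, h2]
  · refine Finset.sum_eq_zero fun u hu => Finset.sum_eq_zero fun β _ => ?_
    replace hu := (Finset.mem_filter.1 hu).2
    by_contra h0
    obtain ⟨σ, hσ⟩ := exists_isCircuit_of_circuitCoeff_ne_zero (left_ne_zero_of_mul h0)
    obtain ⟨q, hq⟩ := hσ.exists_head_eq (by omega) hu 0
    have h1 := Finset.prod_ne_zero_iff.1 (right_ne_zero_of_mul h0) 0 (Finset.mem_univ _)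
    have h2 : H.degTensor k (u 0) (β 0) = 0 := if_neg fun h => by
      rw [h q] at hq; exact hu (by simpa using hq)
    have h3 : insert (u 0) (Set.range (β 0)) ∈ H.edgeSet := by
      by_contra hn; exact h1 (by simp [alphaTensor, h2, adjTensor, hn])
    have h4 : insert (u 0) (Set.range (β 0)) ⊆ {u 0, u 1} := by
      rintro x (rfl | ⟨q, rfl⟩)
      · simp
      · obtain ⟨s, hs⟩ := hσ.head_mem_range 0 q
        rw [← hs]; fin_cases s <;> simp
    have h5 := Set.ncard_le_ncard h4
    rw [hH _ h3, Set.ncard_pair hu] at h5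
    omega

/-- For a fixed number of hyperedges, the second moment is an increasing function of the sum of
squared degrees. -/
theorem circuitSum_alphaTensor_two {k : ℕ} (hk : 2 ≤ k) (α : ℝ) {H : Hypergraph V}
    (hH : H.IsUniform k) :
    circuitSum (H.alphaTensor k α) 2 = α ^ 2 * (∑ v, H.degree v ^ 2 : ℕ) +
      if k = 2 then digonCoeff * (1 - α) ^ 2 * (k * H.edgeSet.ncard : ℕ) else 0 := by
  rw [circuitSum_eq_add _ Nat.two_pos, sum_nonconst_eq hk α hH]
  congr 1
  push_cast
  rw [Finset.mul_sum]
  exact Finset.sum_congr rfl fun i _ => by rw [alphaTensor_const hk α hH, mul_pow]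

end
end Hypergraph

/-! ### Spiders: starlike hypertrees inside a common vertex set -/

namespace Hypergraph

open Tensor

/-- The vertices of `r` arms of length `D` sharing the vertex `none`. -/
abbrev SpiderVertex (k r D : ℕ) : Type := Option (Fin r × Fin D × Fin (k - 1))

section
variable {k r D : ℕ}

/-- The `j`-th hyperedge of arm `a`. -/
def spiderEdge (k : ℕ) {r D : ℕ} (a : Fin r) (j : Fin D) : Set (SpiderVertex k r D) :=
  {v | (v = none ∧ j.val = 0) ∨ (∃ x, v = some (a, j, x)) ∨
    ∃ (i : Fin D) (x : Fin (k - 1)), v = some (a, i, x) ∧ i.val + 1 = j.val ∧ x.val + 2 = k}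

/-- The starlike hypergraph in which arm `a` has `len a` hyperedges. -/
def spider (k : ℕ) {r D : ℕ} (len : Fin r → ℕ) : Hypergraph (SpiderVertex k r D) where
  vertexSet := Set.univ
  edgeSet := {e | ∃ (a : Fin r) (j : Fin D), j.val < len a ∧ e = spiderEdge k a j}
  subset_vertexSet_of_mem_edgeSet' := fun _ _ => Set.subset_univ _

theorem none_mem_spiderEdge {a : Fin r} {j : Fin D} :
    (none : SpiderVertex k r D) ∈ spiderEdge k a j ↔ j.val = 0 := by
  simp [spiderEdge]

theorem some_mem_spiderEdge {a b : Fin r} {i j : Fin D} {x : Fin (k - 1)} :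
    (some (b, i, x) : SpiderVertex k r D) ∈ spiderEdge k a j ↔
      b = a ∧ (i = j ∨ (i.val + 1 = j.val ∧ x.val + 2 = k)) := by
  simp only [spiderEdge, Set.mem_ofPred_eq, reduceCtorEq, false_and, false_or, Option.some.injEq,
    Prod.mk.injEq]
  constructor
  · rintro (⟨y, rfl, rfl, rfl⟩ | ⟨i', y, ⟨rfl, rfl, rfl⟩, h1, h2⟩)
    · exact ⟨rfl, Or.inl rfl⟩
    · exact ⟨rfl, Or.inr ⟨h1, h2⟩⟩
  · rintro ⟨rfl, rfl | h⟩
    · exact Or.inl ⟨x, rfl, rfl, rfl⟩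
    · exact Or.inr ⟨i, x, ⟨rfl, rfl, rfl⟩, h⟩

theorem spiderEdge_injective (hk : 2 ≤ k) {a b : Fin r} {i j : Fin D}
    (h : spiderEdge k a i = spiderEdge k b j) : a = b ∧ i = j := by
  have h1 : (some (a, i, ⟨0, by omega⟩) : SpiderVertex k r D) ∈ spiderEdge k b j :=
    h ▸ some_mem_spiderEdge.2 ⟨rfl, Or.inl rfl⟩
  have h2 : (some (b, j, ⟨0, by omega⟩) : SpiderVertex k r D) ∈ spiderEdge k a i :=
    h ▸ some_mem_spiderEdge.2 ⟨rfl, Or.inl rfl⟩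
  rw [some_mem_spiderEdge] at h1 h2
  refine ⟨h1.1, Fin.ext ?_⟩
  rcases h1.2 with h3 | ⟨h3, _⟩ <;> rcases h2.2 with h4 | ⟨h4, _⟩ <;>
    first | exact congrArg Fin.val h3 | exact (congrArg Fin.val h4).symm | omega

theorem mem_spider_edgeSet (hk : 2 ≤ k) {len : Fin r → ℕ} {a : Fin r} {j : Fin D} :
    spiderEdge k a j ∈ (spider k len).edgeSet ↔ j.val < len a := by
  constructor
  · rintro ⟨b, i, hi, h⟩
    obtain ⟨rfl, rfl⟩ := spiderEdge_injective hk h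
    exact hi
  · exact fun h => ⟨a, j, h, rfl⟩

/-- The vertex at which the `j`-th hyperedge of arm `a` is attached. -/
theorem exists_base (hk : 2 ≤ k) (a : Fin r) (j : Fin D) :
    ∃ b : SpiderVertex k r D, (∀ x, b ≠ some (a, j, x)) ∧
      spiderEdge k a j = insert b (Set.range fun x => some (a, j, x)) := by
  by_cases hj : j.val = 0
  · refine ⟨none, fun x => by simp, Set.ext fun v => ?_⟩
    rcases v with _ | ⟨b, i, x⟩
    · simp [none_mem_spiderEdge, hj]
    · simp only [some_mem_spiderEdge, Set.mem_insert_iff, reduceCtorEq, Set.mem_range,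
        Option.some.injEq, Prod.mk.injEq, false_or]
      constructor
      · rintro ⟨rfl, rfl | h⟩
        · exact ⟨x, rfl, rfl, rfl⟩
        · omega
      · rintro ⟨_, rfl, rfl, _⟩
        exact ⟨rfl, Or.inl rfl⟩
  · refine ⟨some (a, ⟨j.val - 1, by omega⟩, ⟨k - 2, by omega⟩), fun x => ?_, Set.ext fun v => ?_⟩
    · simp only [ne_eq, Option.some.injEq, Prod.mk.injEq, Fin.ext_iff]
      omega
    · rcases v with _ | ⟨b, i, x⟩
      · simp [none_mem_spiderEdge, hj]
      · simp only [some_mem_spiderEdge, Set.mem_insert_iff, Set.mem_range,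
          Option.some.injEq, Prod.mk.injEq, Fin.ext_iff]
        constructor
        · rintro ⟨h, h1 | h1⟩
          · exact Or.inr ⟨x, h.symm, h1.symm, rfl⟩
          · exact Or.inl ⟨h, by omega, by omega⟩
        · rintro (⟨h, h1, h2⟩ | ⟨_, h, h1, _⟩)
          · exact ⟨h, Or.inr ⟨by omega, by omega⟩⟩
          · exact ⟨h.symm, Or.inl h1.symm⟩

theorem ncard_spiderEdge (hk : 2 ≤ k) (a : Fin r) (j : Fin D) : (spiderEdge k a j).ncard = k := by
  obtain ⟨b, hb, h⟩ := exists_base hk a j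
  rw [h, Set.ncard_insert_of_notMem (by rintro ⟨x, hx⟩; exact hb x hx.symm), ← Set.image_univ,
    Set.ncard_image_of_injective _ (fun x y hxy => by simpa using hxy), Set.ncard_univ,
    Nat.card_eq_fintype_card, Fintype.card_fin]
  omega

theorem spider_isUniform (hk : 2 ≤ k) (len : Fin r → ℕ) :
    (spider k len : Hypergraph (SpiderVertex k r D)).IsUniform k := by
  rintro e ⟨a, j, _, rfl⟩
  exact ncard_spiderEdge hk a j

theorem spider_degree_le {len len' : Fin r → ℕ} (v : SpiderVertex k r D)
    (h : ∀ a (j : Fin D), v ∈ spiderEdge k a j → j.val < len a → j.val < len' a) :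
    (spider k len).degree v ≤ (spider k len').degree v := by
  refine Set.ncard_le_ncard ?_ (Set.toFinite _)
  rintro e ⟨⟨a, j, hj, rfl⟩, hv⟩
  exact ⟨⟨a, j, h a j hv hj, rfl⟩, hv⟩

theorem spider_degree_congr {len len' : Fin r → ℕ} (v : SpiderVertex k r D)
    (h : ∀ a (j : Fin D), v ∈ spiderEdge k a j → (j.val < len a ↔ j.val < len' a)) :
    (spider k len).degree v = (spider k len').degree v :=
  le_antisymm (spider_degree_le v fun a j hv => (h a j hv).1)
    (spider_degree_le v fun a j hv => (h a j hv).2)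

theorem spider_degree_lt (hk : 2 ≤ k) {len len' : Fin r → ℕ} (v : SpiderVertex k r D)
    (h : ∀ a (j : Fin D), v ∈ spiderEdge k a j → j.val < len a → j.val < len' a)
    {a : Fin r} {j : Fin D} (hv : v ∈ spiderEdge k a j) (h1 : len a ≤ j.val)
    (h2 : j.val < len' a) : (spider k len).degree v < (spider k len').degree v := by
  refine Set.ncard_lt_ncard ⟨?_, fun hsub => ?_⟩ (Set.toFinite _)
  · rintro e ⟨⟨a, j, hj, rfl⟩, hv⟩
    exact ⟨⟨a, j, h a j hv hj, rfl⟩, hv⟩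
  · have := (hsub ⟨(mem_spider_edgeSet hk).2 h2, hv⟩).1
    rw [mem_spider_edgeSet hk] at this
    omega

theorem spider_degree_pos {len : Fin r → ℕ} (v : SpiderVertex k r D)
    {a : Fin r} {j : Fin D} (hv : v ∈ spiderEdge k a j) (h : j.val < len a) :
    0 < (spider k len).degree v :=
  (Set.ncard_pos (Set.toFinite _)).2 ⟨_, ⟨a, j, h, rfl⟩, hv⟩

/-- The vertices of arm `a` beyond the attachment of its `j`-th hyperedge. -/
def beyond (k : ℕ) {r D : ℕ} (a : Fin r) (j : Fin D) : Set (SpiderVertex k r D) :=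
  {v | ∃ (i : Fin D) (x : Fin (k - 1)), v = some (a, i, x) ∧ j.val ≤ i.val}

theorem some_mem_beyond {a b : Fin r} {i j : Fin D} {x : Fin (k - 1)} :
    (some (b, i, x) : SpiderVertex k r D) ∈ beyond k a j ↔ b = a ∧ j.val ≤ i.val := by
  simp only [beyond, Set.mem_ofPred_eq, Option.some.injEq, Prod.mk.injEq]
  constructor
  · rintro ⟨i', x', ⟨rfl, rfl, rfl⟩, h⟩; exact ⟨rfl, h⟩
  · rintro ⟨rfl, h⟩; exact ⟨i, x, ⟨rfl, rfl, rfl⟩, h⟩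

/-- A hyperedge other than `e` does not cross `U`. -/
def Separates (e : Set (SpiderVertex k r D)) (U : Set (SpiderVertex k r D)) : Prop :=
  ∀ (b : Fin r) (i : Fin D), spiderEdge k b i ≠ e →
    ∀ v ∈ spiderEdge k b i, ∀ w ∈ spiderEdge k b i, v ∈ U → w ∈ U

theorem separates_beyond (a : Fin r) (j : Fin D) : Separates (spiderEdge k a j) (beyond k a j) := by
  intro b i hne v hv w hw hvU
  obtain ⟨i', x, rfl, hi'⟩ := hvU
  obtain ⟨rfl, hv'⟩ := some_mem_spiderEdge.1 hv
  have hij : i.val ≠ j.val := fun h => hne (by rw [Fin.ext h])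
  rcases w with _ | ⟨b', i'', y⟩
  · rw [none_mem_spiderEdge] at hw
    rcases hv' with rfl | ⟨h, _⟩ <;> omega
  · obtain ⟨rfl, hw'⟩ := some_mem_spiderEdge.1 hw
    rw [some_mem_beyond]
    refine ⟨rfl, ?_⟩
    rcases hv' with rfl | ⟨h, _⟩ <;> rcases hw' with rfl | ⟨h', _⟩ <;> omega

/-- Each vertex of a hyperedge can be separated from the others by a set that no other hyperedge
crosses. -/
theorem exists_separating (hk : 2 ≤ k) {a : Fin r} {j : Fin D} {v : SpiderVertex k r D}
    (hv : v ∈ spiderEdge k a j) :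
    ∃ U, Separates (spiderEdge k a j) U ∧ ∀ w ∈ spiderEdge k a j, w ∈ U ↔ w = v := by
  by_cases hvj : ∃ x, v = some (a, j, x)
  · obtain ⟨x, rfl⟩ := hvj
    -- If `v` is a new vertex of the hyperedge, `U` is `v` together with, when `v` is the last one
    -- (index `k - 2`), everything deeper on the arm.
    refine ⟨{w | ∃ (i : Fin D) (y : Fin (k - 1)), w = some (a, i, y) ∧
      ((i = j ∧ y = x) ∨ (j.val < i.val ∧ x.val + 2 = k))}, ?_, ?_⟩
    · intro b i hne v hv w hw hvU
      obtain ⟨i', y, rfl, hi'⟩ := hvU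
      obtain ⟨rfl, hv'⟩ := some_mem_spiderEdge.1 hv
      have hij : i.val ≠ j.val := fun h => hne (by rw [Fin.ext h])
      rcases w with _ | ⟨b', i'', z⟩
      · rw [none_mem_spiderEdge] at hw
        rcases hv' with rfl | ⟨h, _⟩ <;> rcases hi' with ⟨rfl, _⟩ | ⟨h', _⟩ <;> omega
      · obtain ⟨rfl, hw'⟩ := some_mem_spiderEdge.1 hw
        refine ⟨i'', z, rfl, ?_⟩
        simp only [Fin.ext_iff] at hv' hw' hi' ⊢
        omega
    · intro w hw
      rcases w with _ | ⟨b, i, y⟩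
      · simp
      · obtain ⟨rfl, hw'⟩ := some_mem_spiderEdge.1 hw
        simp only [Set.mem_ofPred_eq, Option.some.injEq, Prod.mk.injEq]
        constructor
        · rintro ⟨i', y', ⟨_, rfl, rfl⟩, h | ⟨h, _⟩⟩
          · exact ⟨trivial, h⟩
          · rcases hw' with rfl | ⟨h', _⟩ <;> omega
        · rintro ⟨_, h⟩
          exact ⟨i, y, ⟨trivial, rfl, rfl⟩, Or.inl h⟩
  · push Not at hvj
    -- Otherwise `v` is the attaching vertex, and `U` is the side of the hyperedge containing the
    -- centre.
    refine ⟨(beyond k a j)ᶜ, ?_, ?_⟩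
    · exact fun b i hne v hv w hw hvU hwU => hvU (separates_beyond a j b i hne w hw v hv hwU)
    · intro w hw
      have key : ∀ w ∈ spiderEdge k a j, (∀ x, w ≠ some (a, j, x)) → w ∉ beyond k a j := by
        rintro w hw hwj ⟨i, y, rfl, hi⟩
        rcases (some_mem_spiderEdge.1 hw).2 with rfl | ⟨h, _⟩
        · exact hwj y rfl
        · omega
      constructor
      · intro hwU
        obtain ⟨b, hb, hE⟩ := exists_base hk a j
        have hbase : ∀ w ∈ spiderEdge k a j, (∀ x, w ≠ some (a, j, x)) → w = b := by
          intro w hw hwj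
          rw [hE] at hw
          rcases hw with rfl | ⟨x, rfl⟩
          · rfl
          · exact absurd rfl (hwj x)
        rw [hbase v hv hvj]
        refine hbase w hw ?_
        rintro x rfl
        exact hwU (some_mem_beyond.2 ⟨rfl, le_rfl⟩)
      · rintro rfl
        exact key _ hv hvj

end
end Hypergraph

/-! ### Closed walks in spiders -/

namespace Hypergraph

open Tensor

section
variable {k r D : ℕ}

/-- The index `(i, β)` of a tensor belongs to the `j`-th hyperedge of arm `a`. -/
def OnEdge (i : SpiderVertex k r D) (β : Fin (k - 1) → SpiderVertex k r D) (a : Fin r)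
    (j : Fin D) : Prop :=
  insert i (Set.range β) = spiderEdge k a j

theorem OnEdge.root_mem {i : SpiderVertex k r D} {β : Fin (k - 1) → SpiderVertex k r D} {a : Fin r}
    {j : Fin D} (h : OnEdge i β a j) : i ∈ spiderEdge k a j :=
  h ▸ Set.mem_insert _ _

theorem OnEdge.head_mem {i : SpiderVertex k r D} {β : Fin (k - 1) → SpiderVertex k r D} {a : Fin r}
    {j : Fin D} (h : OnEdge i β a j) (q : Fin (k - 1)) : β q ∈ spiderEdge k a j :=
  h ▸ Set.mem_insert_of_mem _ ⟨q, rfl⟩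

theorem OnEdge.unique (hk : 2 ≤ k) {i : SpiderVertex k r D}
    {β : Fin (k - 1) → SpiderVertex k r D} {a b : Fin r}
    {j j' : Fin D} (h : OnEdge i β a j) (h' : OnEdge i β b j') : a = b ∧ j = j' :=
  spiderEdge_injective hk (h.symm.trans h')

theorem OnEdge.not_loop (hk : 2 ≤ k) {i : SpiderVertex k r D}
    {β : Fin (k - 1) → SpiderVertex k r D} {a : Fin r} {j : Fin D} (h : OnEdge i β a j) :
    ¬ ∀ q, β q = i := fun hl => by
  have h1 : insert i (Set.range β) = {i} := by
    refine Set.eq_singleton_iff_unique_mem.2 ⟨Set.mem_insert _ _, ?_⟩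
    rintro x (rfl | ⟨q, rfl⟩)
    · rfl
    · exact hl q
  have h2 := ncard_spiderEdge hk a j
  rw [← h, h1, Set.ncard_singleton] at h2
  omega

variable {N : ℕ} {u : Fin N → SpiderVertex k r D} {β : Fin N → Fin (k - 1) → SpiderVertex k r D}
  {σ : Fin (N * (k - 1)) ≃ Fin N × Fin (k - 1)}

/-- A closed walk that uses a hyperedge uses it with every vertex as a root. -/
theorem _root_.Tensor.IsCircuit.exists_root (h : IsCircuit u β σ) (hk : 2 ≤ k)
    (hval : ∀ s, (∀ q, β s q = u s) ∨ ∃ a j, OnEdge (u s) (β s) a j) {s₀ : Fin N} {a : Fin r}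
    {j : Fin D} (hs₀ : OnEdge (u s₀) (β s₀) a j) {v : SpiderVertex k r D}
    (hv : v ∈ spiderEdge k a j) : ∃ s, OnEdge (u s) (β s) a j ∧ u s = v := by
  classical
  by_contra! hno
  obtain ⟨U, hsep, hU⟩ := exists_separating hk hv
  -- Heads and roots in `U` must balance. Loops and indices on other hyperedges balance
  -- individually. Without the root `v`, indices on this hyperedge have no root in `U`, but that of
  -- `s₀` has the head `v` in `U`.
  have hbal := h.balanced fun w => if w ∈ U then 1 else 0
  have hon : ∀ s, OnEdge (u s) (β s) a j → u s ∉ U := fun s hs hsU =>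
    hno s hs ((hU _ hs.root_mem).1 hsU)
  refine (Finset.sum_lt_sum (s := Finset.univ) (fun s _ => ?_) ⟨s₀, Finset.mem_univ _, ?_⟩).ne'
    hbal
  · rcases hval s with hl | ⟨b, i, hb⟩
    · simp [hl]
    · by_cases hbi : spiderEdge k b i = spiderEdge k a j
      · rw [if_neg (hon s (hb.trans hbi))]; simp
      · have : ∀ q, β s q ∈ U ↔ u s ∈ U := fun q =>
          ⟨hsep b i hbi _ (hb.head_mem q) _ hb.root_mem,
            hsep b i hbi _ hb.root_mem _ (hb.head_mem q)⟩
        simp [this]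
  · rw [if_neg (hon s₀ hs₀), smul_zero, Finset.sum_pos_iff]
    have hv' := hv
    rw [← hs₀] at hv'
    rcases hv' with rfl | ⟨q, hq⟩
    · exact absurd rfl (hno s₀ hs₀)
    · exact ⟨q, Finset.mem_univ _, by rw [hq, if_pos ((hU v hv).2 rfl)]; exact Nat.one_pos⟩

/-- A closed walk with roots on both sides of a hyperedge uses it. -/
theorem _root_.Tensor.IsCircuit.exists_onEdge (h : IsCircuit u β σ) (hk : 2 ≤ k)
    (hval : ∀ s, (∀ q, β s q = u s) ∨ ∃ a j, OnEdge (u s) (β s) a j) {s₀ s₁ : Fin N} {a : Fin r}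
    {j : Fin D} (h₀ : u s₀ ∉ beyond k a j) (h₁ : u s₁ ∈ beyond k a j) :
    ∃ s, OnEdge (u s) (β s) a j := by
  by_contra! hno
  refine h₀ (h.mem_of_closed (by omega) _ (fun s hs q => ?_) h₁ s₀)
  rcases hval s with hl | ⟨b, i, hb⟩
  · rwa [hl q]
  · exact separates_beyond a j b i (fun hE => hno s (hb.trans hE)) _ hb.root_mem _
      (hb.head_mem q) hs

/-- Each of the hyperedges `0, …, j` accounts for at least `k` indices, one for every root, and
distinct hyperedges account for distinct indices. This is the length bound behind the order `k * p +
2`. -/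
theorem _root_.Tensor.IsCircuit.card_le (h : IsCircuit u β σ) (hk : 2 ≤ k)
    (hval : ∀ s, (∀ q, β s q = u s) ∨ ∃ a j, OnEdge (u s) (β s) a j) {a : Fin r} {j : Fin D}
    (huse : ∀ i ≤ j, ∃ s, OnEdge (u s) (β s) a i) (X : Finset (Fin N))
    (hX : ∀ s ∈ X, ∀ i ≤ j, ¬ OnEdge (u s) (β s) a i) :
    X.card + k * (j.val + 1) ≤ N := by
  classical
  let S : Fin D → Finset (Fin N) := fun i => {s | OnEdge (u s) (β s) a i}
  have hS : ∀ i ≤ j, k ≤ (S i).card := fun i hi => by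
    obtain ⟨s₀, hs₀⟩ := huse i hi
    rw [← ncard_spiderEdge hk a i, ← Set.ncard_coe_finset]
    refine (Set.ncard_le_ncard (t := u '' (S i)) ?_ (Set.toFinite _)).trans
      (Set.ncard_image_le (Set.toFinite _))
    intro v hv
    obtain ⟨s, hs, rfl⟩ := h.exists_root hk hval hs₀ hv
    exact ⟨s, by simpa [S] using hs, rfl⟩
  have hdisj : ∀ i ∈ Finset.Iic j, ∀ i' ∈ Finset.Iic j, i ≠ i' → Disjoint (S i) (S i') := by
    intro i _ i' _ hne
    rw [Finset.disjoint_left]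
    intro s hs hs'
    exact hne (OnEdge.unique hk (Finset.mem_filter.1 hs).2 (Finset.mem_filter.1 hs').2).2
  have hX' : Disjoint X ((Finset.Iic j).biUnion S) := by
    rw [Finset.disjoint_left]
    intro s hs hs'
    obtain ⟨i, hi, hsi⟩ := Finset.mem_biUnion.1 hs'
    exact hX s hs i (Finset.mem_Iic.1 hi) (Finset.mem_filter.1 hsi).2
  calc X.card + k * (j.val + 1) ≤ X.card + ((Finset.Iic j).biUnion S).card := by
        rw [Finset.card_biUnion hdisj]
        have := Finset.card_nsmul_le_sum (Finset.Iic j) (fun i => (S i).card) k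
          (fun i hi => hS i (Finset.mem_Iic.1 hi))
        rw [Fin.card_Iic, smul_eq_mul, mul_comm] at this
        omega
    _ = (X ∪ (Finset.Iic j).biUnion S).card := (Finset.card_union_of_disjoint hX').symm
    _ ≤ N := by simpa using Finset.card_le_univ (X ∪ (Finset.Iic j).biUnion S)

end

/-! ### Weights of indices in spiders with two long arms -/

section Weights
variable {k r D : ℕ}

theorem alphaTensor_spider_onEdge (hk : 2 ≤ k) (α : ℝ) (len : Fin r → ℕ)
    {i : SpiderVertex k r D} {β : Fin (k - 1) → SpiderVertex k r D} {a : Fin r} {j : Fin D}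
    (h : OnEdge i β a j) :
    (spider k len).alphaTensor k α i β =
      if j.val < len a then (1 - α) * (1 / ((k - 1).factorial : ℝ)) else 0 := by
  have h1 : (spider k len).degTensor k i β = 0 := if_neg (h.not_loop hk)
  rw [alphaTensor, h1, adjTensor, show insert i (Set.range β) = _ from h]
  simp only [mem_spider_edgeSet hk]
  split_ifs <;> simp

theorem alphaTensor_spider_loop (hk : 2 ≤ k) (α : ℝ) (len : Fin r → ℕ)
    {i : SpiderVertex k r D} {β : Fin (k - 1) → SpiderVertex k r D} (h : ∀ q, β q = i) :
    (spider k len).alphaTensor k α i β = α * (spider k len).degree i := by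
  obtain rfl : β = fun _ => i := funext h
  exact alphaTensor_const hk α (spider_isUniform hk len) i

theorem alphaTensor_spider_eq_zero (α : ℝ) (len : Fin r → ℕ)
    {i : SpiderVertex k r D} {β : Fin (k - 1) → SpiderVertex k r D}
    (h : ¬ ((∀ q, β q = i) ∨ ∃ a j, OnEdge i β a j)) :
    (spider k len).alphaTensor k α i β = 0 := by
  push Not at h
  have h1 : (spider k len).degTensor k i β = 0 := if_neg fun hl => h.1.elim fun q hq => hq (hl q)
  have h2 : (spider k len).adjTensor k i β = 0 :=
    if_neg fun ⟨a, j, _, he⟩ => h.2 a j he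
  rw [alphaTensor, h1, h2]; simp

/-- The arm lengths `x, y, ε, …, ε`. -/
def armLen (r x y ε : ℕ) (a : Fin r) : ℕ := if a.val = 0 then x else if a.val = 1 then y else ε

/-- The weight of the index `(i, β)` in the spider with arm lengths `x, d - x, ε, …, ε`. -/
noncomputable def armWeight (k : ℕ) {r D : ℕ} (α : ℝ) (d x ε : ℕ) (i : SpiderVertex k r D)
    (β : Fin (k - 1) → SpiderVertex k r D) : ℝ :=
  (spider k (armLen r x (d - x) ε)).alphaTensor k α i β

/-- The index `(i, β)` is supported outside the first two arms. -/
def OffArms (i : SpiderVertex k r D) (β : Fin (k - 1) → SpiderVertex k r D) : Prop :=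
  (∀ a j y, i = some (a, j, y) → 2 ≤ a.val) ∧ ∀ a j, OnEdge i β a j → 2 ≤ a.val

end Weights
end Hypergraph

namespace Hypergraph

open Tensor

section Weights
variable {k r D : ℕ} {i : SpiderVertex k r D} {β : Fin (k - 1) → SpiderVertex k r D}

theorem armLen_congr {x y ε ε' : ℕ} {a : Fin r} (ha : a.val < 2) :
    armLen r x y ε a = armLen r x y ε' a := by
  unfold armLen; split_ifs <;> first | rfl | omega

theorem armLen_of_two_le {x y ε : ℕ} {a : Fin r} (ha : 2 ≤ a.val) : armLen r x y ε a = ε := by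
  unfold armLen; split_ifs <;> first | rfl | omega

theorem armLen_mono {x y ε ε' : ℕ} (h : ε ≤ ε') (a : Fin r) :
    armLen r x y ε a ≤ armLen r x y ε' a := by
  unfold armLen; split_ifs <;> first | rfl | exact h

/-- An index is off the first two arms, or a loop on one of them, or on one of their hyperedges. -/
theorem offArms_or (hk : 2 ≤ k) (hval : (∀ q, β q = i) ∨ ∃ a j, OnEdge i β a j) :
    OffArms i β ∨ (∃ a j y, a.val < 2 ∧ i = some (a, j, y) ∧ ∀ q, β q = i) ∨
      ∃ a j, a.val < 2 ∧ OnEdge i β a j := by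
  rcases hval with hl | ⟨a, j, h⟩
  · by_cases h1 : ∃ a j y, a.val < 2 ∧ i = some (a, j, y)
    · obtain ⟨a, j, y, ha, hi⟩ := h1
      exact Or.inr (Or.inl ⟨a, j, y, ha, hi, hl⟩)
    · push Not at h1
      exact Or.inl ⟨fun a j y hi => by by_contra hn; exact h1 a j y (by omega) hi,
        fun a j h => absurd hl (h.not_loop hk)⟩
  · by_cases ha : a.val < 2
    · exact Or.inr (Or.inr ⟨a, j, ha, h⟩)
    · refine Or.inl ⟨fun b j' y hi => ?_, fun b j' h' => ?_⟩
      · have := h.root_mem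
        rw [hi, some_mem_spiderEdge] at this
        rw [this.1]; omega
      · rw [(h'.unique hk h).1]; omega

/-- The pendant hyperedges affect the degree of no vertex of the first two arms except the centre,
and loops at the centre count as off the arms. -/
theorem armWeight_eq_of_not_offArms (hk : 2 ≤ k) (α : ℝ) (d x ε ε' : ℕ)
    (h : ¬ OffArms i β) (hval : (∀ q, β q = i) ∨ ∃ a j, OnEdge i β a j) :
    armWeight k α d x ε i β = armWeight k α d x ε' i β := by
  unfold armWeight
  rcases (offArms_or hk hval).resolve_left h with ⟨a, j, y, ha, rfl, hl⟩ | ⟨a, j, ha, he⟩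
  · rw [alphaTensor_spider_loop hk _ _ hl, alphaTensor_spider_loop hk _ _ hl,
      spider_degree_congr]
    intro b i hb
    obtain ⟨rfl, _⟩ := some_mem_spiderEdge.1 hb
    rw [armLen_congr ha]
  · rw [alphaTensor_spider_onEdge hk _ _ he, alphaTensor_spider_onEdge hk _ _ he, armLen_congr ha]

/-- The degree of the centre sees only the first hyperedge of each arm, and `0 < x < d` keeps both
long arms nonempty. -/
theorem armWeight_eq_of_offArms (hk : 2 ≤ k) (α : ℝ) {d x x' : ℕ} (ε : ℕ) (hx : 0 < x)
    (hx' : 0 < x') (hxd : x < d) (hxd' : x' < d)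
    (h : OffArms i β) (hval : (∀ q, β q = i) ∨ ∃ a j, OnEdge i β a j) :
    armWeight k α d x ε i β = armWeight k α d x' ε i β := by
  unfold armWeight
  rcases hval with hl | ⟨a, j, he⟩
  · rw [alphaTensor_spider_loop hk _ _ hl, alphaTensor_spider_loop hk _ _ hl,
      spider_degree_congr]
    intro b j hb
    rcases i with _ | ⟨a, j', y⟩
    · rw [none_mem_spiderEdge.1 hb]
      unfold armLen; split_ifs <;> omega
    · obtain ⟨rfl, _⟩ := some_mem_spiderEdge.1 hb
      rw [armLen_of_two_le (h.1 _ _ _ rfl), armLen_of_two_le (h.1 _ _ _ rfl)]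
  · rw [alphaTensor_spider_onEdge hk _ _ he, alphaTensor_spider_onEdge hk _ _ he,
      armLen_of_two_le (h.2 _ _ he), armLen_of_two_le (h.2 _ _ he)]

theorem armWeight_nonneg {α : ℝ} (h0 : 0 ≤ α) (h1 : α ≤ 1) (d x ε : ℕ) :
    0 ≤ armWeight k α d x ε i β := by
  have h2 : 0 ≤ 1 - α := by linarith
  unfold armWeight alphaTensor degTensor adjTensor
  refine add_nonneg (mul_nonneg h0 ?_) (mul_nonneg h2 ?_) <;> split_ifs <;> positivity

theorem armWeight_mono (hk : 2 ≤ k) {α : ℝ} (h0 : 0 ≤ α) (h1 : α ≤ 1) (d x : ℕ) {ε ε' : ℕ}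
    (hε : ε ≤ ε') (hval : (∀ q, β q = i) ∨ ∃ a j, OnEdge i β a j) :
    armWeight k α d x ε i β ≤ armWeight k α d x ε' i β := by
  unfold armWeight
  rcases hval with hl | ⟨a, j, he⟩
  · rw [alphaTensor_spider_loop hk _ _ hl, alphaTensor_spider_loop hk _ _ hl]
    refine mul_le_mul_of_nonneg_left (Nat.cast_le.2 (spider_degree_le i fun a j _ h => ?_)) h0
    exact h.trans_le (armLen_mono hε a)
  · rw [alphaTensor_spider_onEdge hk _ _ he, alphaTensor_spider_onEdge hk _ _ he]
    have h2 : 0 ≤ 1 - α := by linarith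
    have := armLen_mono (x := x) (y := d - x) hε a
    split_ifs
    · exact le_rfl
    · omega
    · positivity
    · exact le_rfl

end Weights

/-! ### Comparison of the weights for two lengths of the first arm -/

section Comparison
variable {k r d N : ℕ} {u : Fin N → SpiderVertex k r d}
  {β : Fin N → Fin (k - 1) → SpiderVertex k r d}

open Classical in
/-- The second difference of the weights of a sequence of indices, in the length of the first arm
and in the presence of pendant hyperedges, factors over the two kinds of indices. -/
theorem armWeight_prod_eq (hk : 2 ≤ k) (α : ℝ) {p t : ℕ} (hp : 0 < p) (ht : 0 < t) (hpd : p < d)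
    (htd : t < d) (hval : ∀ s, (∀ q, β s q = u s) ∨ ∃ a j, OnEdge (u s) (β s) a j) :
    (∏ s, armWeight k α d t 1 (u s) (β s) - ∏ s, armWeight k α d t 0 (u s) (β s)) -
      (∏ s, armWeight k α d p 1 (u s) (β s) - ∏ s, armWeight k α d p 0 (u s) (β s)) =
    (∏ s with ¬ OffArms (u s) (β s), armWeight k α d t 1 (u s) (β s) -
      ∏ s with ¬ OffArms (u s) (β s), armWeight k α d p 1 (u s) (β s)) *
    (∏ s with OffArms (u s) (β s), armWeight k α d p 1 (u s) (β s) -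
      ∏ s with OffArms (u s) (β s), armWeight k α d p 0 (u s) (β s)) := by
  -- The factor off the arms does not depend on `x`, so it is written with `p`; the other does not
  -- depend on `ε`, so it is written with `1`.
  have hsplit : ∀ x ε, 0 < x → x < d → ∏ s, armWeight k α d x ε (u s) (β s) =
      (∏ s with OffArms (u s) (β s), armWeight k α d p ε (u s) (β s)) *
        ∏ s with ¬ OffArms (u s) (β s), armWeight k α d x 1 (u s) (β s) := by
    intro x ε hx hxd
    rw [← Finset.prod_filter_mul_prod_filter_not Finset.univ (fun s => OffArms (u s) (β s))]
    congr 1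
    · refine Finset.prod_congr rfl fun s hs => ?_
      exact armWeight_eq_of_offArms hk α ε hx hp hxd hpd (Finset.mem_filter.1 hs).2 (hval s)
    · refine Finset.prod_congr rfl fun s hs => ?_
      exact armWeight_eq_of_not_offArms hk α d x ε 1 (Finset.mem_filter.1 hs).2 (hval s)
  rw [hsplit t 1 ht htd, hsplit t 0 ht htd, hsplit p 1 hp hpd, hsplit p 0 hp hpd]
  ring

/-- A loop on one of the first two arms, close enough to the centre, does not weigh less when the
first arm is longer. -/
theorem armWeight_loop_le (hk : 2 ≤ k) {α : ℝ} (h0 : 0 ≤ α) {p t ε : ℕ} (hpt : p < t)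
    (htd : 2 * t ≤ d) {a : Fin r} {j : Fin d} {y : Fin (k - 1)} (hj : j.val < p)
    {γ : Fin (k - 1) → SpiderVertex k r d} (hl : ∀ q, γ q = some (a, j, y)) :
    armWeight k α d p ε (some (a, j, y)) γ ≤ armWeight k α d t ε (some (a, j, y)) γ := by
  unfold armWeight
  rw [alphaTensor_spider_loop hk _ _ hl, alphaTensor_spider_loop hk _ _ hl]
  refine mul_le_mul_of_nonneg_left (Nat.cast_le.2 (spider_degree_le _ fun b i hb hi => ?_)) h0
  obtain ⟨rfl, h⟩ := some_mem_spiderEdge.1 hb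
  -- The hyperedges at this vertex have position at most `p`. The second arm shrinks to `d - t ≥ t >
  -- p` and so keeps them; the first arm can only gain.
  have hij : i.val ≤ j.val + 1 := by rcases h with rfl | h <;> omega
  unfold armLen at hi ⊢
  split_ifs at hi ⊢ <;> omega

/-- The hyperedges at this vertex have position less than `p`, and both arms have at least `p`
hyperedges in both spiders. -/
theorem armWeight_loop_eq (hk : 2 ≤ k) {α : ℝ} {p t ε : ℕ} (hpt : p < t)
    (htd : 2 * t ≤ d) {a : Fin r} {j : Fin d} {y : Fin (k - 1)}
    (hj : j.val + 1 < p)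
    {γ : Fin (k - 1) → SpiderVertex k r d} (hl : ∀ q, γ q = some (a, j, y)) :
    armWeight k α d p ε (some (a, j, y)) γ = armWeight k α d t ε (some (a, j, y)) γ := by
  unfold armWeight
  rw [alphaTensor_spider_loop hk _ _ hl, alphaTensor_spider_loop hk _ _ hl, spider_degree_congr]
  intro b i hb
  obtain ⟨rfl, h⟩ := some_mem_spiderEdge.1 hb
  have hij : i.val ≤ j.val + 1 := by rcases h with rfl | h <;> omega
  unfold armLen
  split_ifs <;> omega

theorem armWeight_onEdge_eq (hk : 2 ≤ k) {α : ℝ} {p t ε : ℕ} (hpt : p < t)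
    (htd : 2 * t ≤ d) {a : Fin r} {j : Fin d} (ha : a.val < 2) (hj : j.val < p)
    {i : SpiderVertex k r d} {γ : Fin (k - 1) → SpiderVertex k r d} (he : OnEdge i γ a j) :
    armWeight k α d p ε i γ = armWeight k α d t ε i γ := by
  unfold armWeight
  rw [alphaTensor_spider_onEdge hk _ _ he, alphaTensor_spider_onEdge hk _ _ he]
  have h1 : j.val < armLen r p (d - p) ε a := by unfold armLen; split_ifs <;> omega
  have h2 : j.val < armLen r t (d - t) ε a := by unfold armLen; split_ifs <;> omega
  rw [if_pos h1, if_pos h2]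

variable {σ : Fin (N * (k - 1)) ≃ Fin N × Fin (k - 1)}

/-- A short closed walk meeting the rest of the spider stays near the centre on the first two
arms. -/
theorem armWeight_le_of_isCircuit (h : IsCircuit u β σ) (hk : 2 ≤ k) {α : ℝ} (h0 : 0 ≤ α)
    {p t ε : ℕ} (hpt : p < t) (htd : 2 * t ≤ d) (hN : N ≤ k * p + 2)
    (hval : ∀ s, (∀ q, β s q = u s) ∨ ∃ a j, OnEdge (u s) (β s) a j) {s₀ s : Fin N}
    (hs₀ : OffArms (u s₀) (β s₀)) (hs : ¬ OffArms (u s) (β s)) :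
    armWeight k α d p ε (u s) (β s) ≤ armWeight k α d t ε (u s) (β s) ∧
    (N < k * p + 2 → armWeight k α d p ε (u s) (β s) = armWeight k α d t ε (u s) (β s)) := by
  classical
  have hout : ∀ (a : Fin r) (i : Fin d), a.val < 2 → u s₀ ∉ beyond k a i := by
    rintro a i ha ⟨i', y, hi, _⟩
    have := hs₀.1 _ _ _ hi
    omega
  have huse : ∀ (a : Fin r) (j : Fin d) (y : Fin (k - 1)) (s₁ : Fin N), a.val < 2 →
      u s₁ = some (a, j, y) → ∀ i ≤ j, ∃ s, OnEdge (u s) (β s) a i :=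
    fun a j y s₁ ha hs₁ i hi => h.exists_onEdge hk hval (hout a i ha)
      (hs₁ ▸ some_mem_beyond.2 ⟨rfl, hi⟩)
  have hoff : ∀ (a : Fin r) (j : Fin d), a.val < 2 → ∀ i ≤ j, ¬ OnEdge (u s₀) (β s₀) a i :=
    fun a j ha i _ he => absurd (hs₀.2 _ _ he) (by omega)
  rcases (offArms_or hk (hval s)).resolve_left hs with ⟨a, j, y, ha, hsu, hl⟩ | ⟨a, j, ha, he⟩
  · have hne : s₀ ≠ s := fun hss => hs (hss ▸ hs₀)
    -- Two indices, the one off the arms and the loop itself, come on top of the `k * (j + 1)`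
    -- needed to reach position `j`. Hence `j + 1 ≤ p`, with equality only if `N = k * p + 2`.
    have hcard := h.card_le hk hval (huse a j y s ha hsu) {s₀, s} (by
      intro s' hs' i hi
      rcases Finset.mem_insert.1 hs' with rfl | hs'
      · exact hoff a j ha i hi
      · rw [Finset.mem_singleton.1 hs']
        exact fun he => he.not_loop hk hl)
    rw [Finset.card_pair hne] at hcard
    have hjp : j.val + 1 ≤ p := by
      by_contra hjp
      have : k * (p + 1) ≤ k * (j.val + 1) := Nat.mul_le_mul_left k (by omega)
      rw [mul_add] at this
      omega
    rw [hsu] at hl ⊢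
    refine ⟨armWeight_loop_le hk h0 hpt htd hjp hl, fun hN' => ?_⟩
    refine armWeight_loop_eq hk hpt htd ?_ hl
    by_contra hjp'
    rw [show j.val + 1 = p by omega] at hcard
    omega
  · obtain ⟨s₁, _, hs₁⟩ := h.exists_root hk hval he
      (v := some (a, j, ⟨0, by omega⟩)) (some_mem_spiderEdge.2 ⟨rfl, Or.inl rfl⟩)
    -- Only the index off the arms is additional here, but `k * (j + 1) + 1 ≤ k * p + 2` still
    -- forces `j < p` since `k ≥ 2`.
    have hcard := h.card_le hk hval (huse a j _ s₁ ha hs₁) {s₀} (by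
      intro s' hs' i hi
      rw [Finset.mem_singleton.1 hs']
      exact hoff a j ha i hi)
    rw [Finset.card_singleton] at hcard
    have hjp : j.val < p := by
      by_contra hjp
      have : k * (p + 1) ≤ k * (j.val + 1) := Nat.mul_le_mul_left k (by omega)
      rw [mul_add] at this
      omega
    have := armWeight_onEdge_eq (α := α) (ε := ε) hk hpt htd ha hjp he
    exact ⟨this.le, fun _ => this⟩

/-- If no index is off the arms, the second factor of the second difference is zero. If one is, the
shortness of the walk confines the others to the region where lengthening the first arm does not
decrease weights. -/
theorem armWeight_prod_nonneg (h : IsCircuit u β σ) (hk : 2 ≤ k) {α : ℝ} (h0 : 0 ≤ α) (h1 : α ≤ 1)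
    {p t : ℕ} (hp : 0 < p) (hpt : p < t) (htd : 2 * t ≤ d) (hN : N ≤ k * p + 2)
    (hval : ∀ s, (∀ q, β s q = u s) ∨ ∃ a j, OnEdge (u s) (β s) a j) :
    0 ≤ (∏ s, armWeight k α d t 1 (u s) (β s) - ∏ s, armWeight k α d t 0 (u s) (β s)) -
      (∏ s, armWeight k α d p 1 (u s) (β s) - ∏ s, armWeight k α d p 0 (u s) (β s)) ∧
    (N < k * p + 2 →
      (∏ s, armWeight k α d t 1 (u s) (β s) - ∏ s, armWeight k α d t 0 (u s) (β s)) -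
      (∏ s, armWeight k α d p 1 (u s) (β s) - ∏ s, armWeight k α d p 0 (u s) (β s)) = 0) := by
  classical
  rw [armWeight_prod_eq hk α hp (by omega) (by omega) (by omega) hval]
  by_cases hoff : ∃ s₀, OffArms (u s₀) (β s₀)
  · obtain ⟨s₀, hs₀⟩ := hoff
    refine ⟨mul_nonneg (sub_nonneg.2 ?_) (sub_nonneg.2 ?_), fun hN' => ?_⟩
    · exact Finset.prod_le_prod (fun s _ => armWeight_nonneg h0 h1 _ _ _) fun s hs =>
        (armWeight_le_of_isCircuit h hk h0 hpt htd hN hval hs₀ (Finset.mem_filter.1 hs).2).1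
    · exact Finset.prod_le_prod (fun s _ => armWeight_nonneg h0 h1 _ _ _) fun s _ =>
        armWeight_mono hk h0 h1 _ _ zero_le_one (hval s)
    · rw [mul_eq_zero, sub_eq_zero]
      exact Or.inl (Finset.prod_congr rfl fun s hs => ((armWeight_le_of_isCircuit h hk h0 hpt htd hN
        hval hs₀ (Finset.mem_filter.1 hs).2).2 hN').symm)
  · push Not at hoff
    have : (Finset.univ.filter fun s => OffArms (u s) (β s)) = ∅ :=
      Finset.filter_eq_empty_iff.2 fun s _ => hoff s
    simp [this]

/-- The loop at the centre detects the pendant hyperedges, which exist because `2 < r`. The loop at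
the end of the arm of length `p` detects its prolongation to `t`. The hyperedges in between belong
to both spiders. -/
theorem armWeight_prod_pos (hk : 2 ≤ k) {α : ℝ} (h0 : 0 < α) (h1 : α < 1)
    {p t : ℕ} (hp : 0 < p) (hpt : p < t) (htd : 2 * t ≤ d) (hr : 2 < r)
    (hconf : ∀ s, (u s = none ∧ ∀ q, β s q = u s) ∨
      (∃ j : Fin d, j.val < p ∧ OnEdge (u s) (β s) ⟨0, by omega⟩ j) ∨
      (u s = some (⟨0, by omega⟩, ⟨p - 1, by omega⟩, ⟨k - 2, by omega⟩) ∧ ∀ q, β s q = u s))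
    (hA : ∃ s, u s = none ∧ ∀ q, β s q = u s)
    (hC : ∃ s, u s = some (⟨0, by omega⟩, ⟨p - 1, by omega⟩, ⟨k - 2, by omega⟩) ∧
      ∀ q, β s q = u s) :
    0 < (∏ s, armWeight k α d t 1 (u s) (β s) - ∏ s, armWeight k α d t 0 (u s) (β s)) -
      (∏ s, armWeight k α d p 1 (u s) (β s) - ∏ s, armWeight k α d p 0 (u s) (β s)) := by
  classical
  have hval : ∀ s, (∀ q, β s q = u s) ∨ ∃ a j, OnEdge (u s) (β s) a j := fun s => by
    rcases hconf s with h | ⟨j, _, h⟩ | h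
    · exact Or.inl h.2
    · exact Or.inr ⟨_, _, h⟩
    · exact Or.inl h.2
  have h2 : 0 < 1 - α := by linarith
  have hnotC : ∀ s, u s = some (⟨0, by omega⟩, ⟨p - 1, by omega⟩, ⟨k - 2, by omega⟩) →
      ¬ OffArms (u s) (β s) := fun s hs ho => by
    have := ho.1 _ _ _ hs
    simp at this
  have hoffA : ∀ s, OffArms (u s) (β s) → u s = none ∧ ∀ q, β s q = u s := fun s hs => by
    rcases hconf s with h | ⟨j, _, h⟩ | h
    · exact h
    · have := hs.2 _ _ h
      simp at this
    · exact absurd hs (hnotC s h.1)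
  have hAoff : ∀ s, (u s = none ∧ ∀ q, β s q = u s) → OffArms (u s) (β s) := fun s hs =>
    ⟨fun a j y h => by rw [hs.1] at h; simp at h, fun a j h => absurd hs.2 (h.not_loop hk)⟩
  -- The vertex with index `k - 2` is the one shared with the next hyperedge, so it lies in the
  -- hyperedges `p - 1` and `p`.
  have hmem : ∀ j : ℕ, j = p - 1 ∨ j = p → ∀ hj : j < d,
      (some (⟨0, by omega⟩, ⟨p - 1, by omega⟩, ⟨k - 2, by omega⟩) : SpiderVertex k r d) ∈
        spiderEdge k ⟨0, by omega⟩ ⟨j, hj⟩ := fun j hj hjd => by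
    refine some_mem_spiderEdge.2 ⟨rfl, ?_⟩
    simp only [Fin.ext_iff]
    omega
  have hAlt : ∀ s, (u s = none ∧ ∀ q, β s q = u s) →
      0 < armWeight k α d p 0 (u s) (β s) ∧
        armWeight k α d p 0 (u s) (β s) < armWeight k α d p 1 (u s) (β s) := by
    rintro s ⟨hs, hl⟩
    unfold armWeight
    rw [alphaTensor_spider_loop hk _ _ hl, alphaTensor_spider_loop hk _ _ hl, hs]
    constructor
    · refine mul_pos h0 (Nat.cast_pos.2 (spider_degree_pos (a := ⟨0, by omega⟩)
        (j := ⟨0, by omega⟩) none (none_mem_spiderEdge.2 rfl) ?_))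
      simpa [armLen] using hp
    · refine mul_lt_mul_of_pos_left (Nat.cast_lt.2 (spider_degree_lt hk none
        (fun a j _ h => h.trans_le (armLen_mono zero_le_one a)) (a := ⟨2, hr⟩)
        (j := ⟨0, by omega⟩) (none_mem_spiderEdge.2 rfl) ?_ ?_)) h0 <;> simp [armLen]
  have hClt : ∀ s, (u s = some (⟨0, by omega⟩, ⟨p - 1, by omega⟩, ⟨k - 2, by omega⟩) ∧
      ∀ q, β s q = u s) → 0 < armWeight k α d p 1 (u s) (β s) ∧
        armWeight k α d p 1 (u s) (β s) < armWeight k α d t 1 (u s) (β s) := by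
    rintro s ⟨hs, hl⟩
    unfold armWeight
    rw [alphaTensor_spider_loop hk _ _ hl, alphaTensor_spider_loop hk _ _ hl, hs]
    constructor
    · refine mul_pos h0 (Nat.cast_pos.2 (spider_degree_pos _
        (hmem (p - 1) (Or.inl rfl) (by omega)) ?_))
      simp only [armLen, if_true]; omega
    · refine mul_lt_mul_of_pos_left (Nat.cast_lt.2 (spider_degree_lt hk _ (fun b i hb hi => ?_)
        (hmem p (Or.inr rfl) (by omega)) ?_ ?_)) h0
      · obtain ⟨rfl, h⟩ := some_mem_spiderEdge.1 hb
        have hij : i.val ≤ p := by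
          rcases h with rfl | h
          · simp
          · simp at h; omega
        simp only [armLen, if_true] at hi ⊢
        omega
      · simp [armLen]
      · simpa [armLen] using hpt
  rw [armWeight_prod_eq hk α hp (by omega) (by omega) (by omega) hval]
  refine mul_pos (sub_pos.2 ?_) (sub_pos.2 ?_)
  · have hB : ∀ s j, j.val < p → OnEdge (u s) (β s) ⟨0, by omega⟩ j →
        0 < armWeight k α d p 1 (u s) (β s) := fun s j hj he => by
      unfold armWeight
      rw [alphaTensor_spider_onEdge hk _ _ he, if_pos (by simpa [armLen] using hj)]
      positivity
    have hcases : ∀ s, ¬ OffArms (u s) (β s) → 0 < armWeight k α d p 1 (u s) (β s) ∧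
        armWeight k α d p 1 (u s) (β s) ≤ armWeight k α d t 1 (u s) (β s) := fun s hs => by
      rcases hconf s with h | ⟨j, hj, h⟩ | h
      · exact absurd (hAoff s h) hs
      · exact ⟨hB s j hj h, (armWeight_onEdge_eq hk hpt htd (by simp) hj h).le⟩
      · exact ⟨(hClt s h).1, (hClt s h).2.le⟩
    obtain ⟨s, hs⟩ := hC
    exact Finset.prod_lt_prod (fun s hs => (hcases s (Finset.mem_filter.1 hs).2).1)
      (fun s hs => (hcases s (Finset.mem_filter.1 hs).2).2)
      ⟨s, Finset.mem_filter.2 ⟨Finset.mem_univ _, hnotC s hs.1⟩, (hClt s hs).2⟩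
  · obtain ⟨s, hs⟩ := hA
    exact Finset.prod_lt_prod (fun s hs => (hAlt s (hoffA s (Finset.mem_filter.1 hs).2)).1)
      (fun s hs => (hAlt s (hoffA s (Finset.mem_filter.1 hs).2)).2.le)
      ⟨s, Finset.mem_filter.2 ⟨Finset.mem_univ _, hAoff s hs⟩, (hAlt s hs).2⟩

end Comparison
end Hypergraph

/-! ### Gluing closed walks -/

theorem Multiset.exists_map_univ_eq {α : Type*} (M : Multiset α) {n : ℕ} (h : card M = n) :
    ∃ f : Fin n → α, Finset.univ.val.map f = M := by
  induction M using Quotient.inductionOn with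
  | h l =>
    change l.length = n at h
    subst h
    exact ⟨l.get, (Fin.univ_val_map l.get).trans (congrArg _ (List.ofFn_get l))⟩

namespace Tensor

section
variable {V : Type*}

/-- There is a walk from `x` to `y` whose multiset of arcs is `M`. -/
inductive ArcWalk : V → V → Multiset (V × V) → Prop
  | nil (x : V) : ArcWalk x x 0
  | cons {y z : V} {M : Multiset (V × V)} (x : V) (h : ArcWalk y z M) : ArcWalk x z ((x, y) ::ₘ M)

namespace ArcWalk
variable {x y z : V} {M M' : Multiset (V × V)}

theorem append (h : ArcWalk x y M) (h' : ArcWalk y z M') : ArcWalk x z (M + M') := by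
  induction h with
  | nil => simpa using h'
  | cons x _ ih => rw [Multiset.cons_add]; exact (ih h').cons x

theorem single (x y : V) : ArcWalk x y {(x, y)} := (nil y).cons x

/-- An arc leaving `v` guarantees that the walk passes through `v`, and the closed walk is inserted
just before that arc. -/
theorem insert_closed (h : ArcWalk x z M) {v w : V} (hv : (v, w) ∈ M) (h' : ArcWalk v v M') :
    ArcWalk x z (M + M') := by
  induction h with
  | nil => simp at hv
  | @cons y z N x hN ih =>
    rcases Multiset.mem_cons.1 hv with hv | hv
    · obtain ⟨rfl, rfl⟩ := Prod.ext_iff.1 hv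
      rw [add_comm]
      exact h'.append (hN.cons _)
    · rw [Multiset.cons_add]
      exact (ih hv).cons x

theorem sum_closed {ι : Type*} (s : Finset ι) {f : ι → Multiset (V × V)}
    (h : ∀ i ∈ s, ArcWalk x x (f i)) : ArcWalk x x (∑ i ∈ s, f i) := by
  classical
  induction s using Finset.induction_on with
  | empty => exact nil x
  | insert a s ha ih =>
    rw [Finset.sum_insert ha]
    exact (h a (Finset.mem_insert_self _ _)).append
      (ih fun i hi => h i (Finset.mem_insert_of_mem hi))

/-- The complete digraph on a finite set has a closed Euler walk. -/
theorem complete [DecidableEq V] (b : V) (F : Finset V) (hb : b ∉ F) :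
    ArcWalk b b (∑ v ∈ insert b F, ∑ w ∈ (insert b F).erase v, {(v, w)}) := by
  induction F using Finset.induction_on with
  | empty => simpa using nil b
  | insert a F ha ih =>
    have hba : b ≠ a := fun h => hb (h ▸ Finset.mem_insert_self _ _)
    have hbF : b ∉ F := fun h => hb (Finset.mem_insert_of_mem h)
    have haF : a ∉ insert b F := by simp [ha, hba.symm]
    have h2 : ∀ v ∈ insert b F, ∑ w ∈ (insert a (insert b F)).erase v,
        ({(v, w)} : Multiset (V × V)) = {(v, a)} + ∑ w ∈ (insert b F).erase v, {(v, w)} := by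
      intro v hv
      have hav : a ≠ v := fun h => haF (by rwa [h])
      rw [Finset.erase_insert_of_ne hav, Finset.sum_insert
        (fun h => haF (Finset.mem_of_mem_erase h))]
    have h1 : ∑ v ∈ insert b (insert a F), ∑ w ∈ (insert b (insert a F)).erase v,
        ({(v, w)} : Multiset (V × V)) =
        (∑ v ∈ insert b F, ∑ w ∈ (insert b F).erase v, {(v, w)}) +
          ({(b, a)} + ((∑ w ∈ F, ({(a, w)} + {(w, a)})) + {(a, b)})) := by
      rw [Finset.insert_comm b a F, Finset.sum_insert haF, Finset.erase_insert haF,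
        Finset.sum_congr rfl h2, Finset.sum_add_distrib, Finset.sum_insert hbF,
        Finset.sum_insert hbF, Finset.sum_add_distrib]
      abel
    rw [h1]
    -- The arcs at the new vertex `a` form a detour: from `b` to `a`, back and forth to each vertex
    -- of `F`, then back to `b`.
    refine (ih hbF).append ((single b a).append ((sum_closed F fun w _ => ?_).append (single a b)))
    exact (single a w).append (single w a)

theorem exists_fun (h : ArcWalk x z M) : ∃ w : ℕ → V, w 0 = x ∧ w (Multiset.card M) = z ∧
    M = ∑ t ∈ Finset.range (Multiset.card M), {(w t, w (t + 1))} := by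
  induction h with
  | nil x => exact ⟨fun _ => x, rfl, rfl, rfl⟩
  | @cons y z N x hN ih =>
    obtain ⟨w, rfl, rfl, hw⟩ := ih
    refine ⟨fun t => Nat.casesOn t x w, rfl, by simp, ?_⟩
    rw [Multiset.card_cons, Finset.sum_range_succ', add_comm, Multiset.singleton_add]
    exact congrArg _ hw

end ArcWalk

/-- The arcs of an index `(i, β)`. -/
def itemArcs {κ : ℕ} (x : V × (Fin κ → V)) : Multiset (V × V) :=
  ∑ q, {(x.1, x.2 q)}

/-- Equality of the two multisets of arcs gives a bijection from the steps of the walk to the pairs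
(index, position of the head). -/
theorem exists_isCircuit_of_arcWalk {d κ : ℕ} {u : Fin d → V}
    {β : Fin d → Fin κ → V} {v : V} (h : ArcWalk v v (∑ s, itemArcs (u s, β s))) :
    ∃ σ, IsCircuit u β σ := by
  classical
  have hcard : Multiset.card (∑ s, itemArcs (u s, β s)) = d * κ := by
    simp [itemArcs]
  obtain ⟨w, hw0, hwN, hw⟩ := h.exists_fun
  rw [hcard] at hwN hw
  -- The cyclic successor of the last position is 0, which agrees with `w` at `d * κ` because the
  -- walk is closed.
  have hrot : ∀ t : Fin (d * κ), w (finRotate _ t).val = w (t.val + 1) := by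
    generalize d * κ = n at hwN
    intro t
    obtain ⟨n, rfl⟩ : ∃ m, n = m + 1 := ⟨n - 1, by have := t.isLt; omega⟩
    by_cases ht : t.val < n
    · rw [show t = ⟨t.val, t.isLt⟩ from rfl, finRotate_of_lt ht]
    · have : t = Fin.last n := Fin.ext (by have := t.isLt; simp; omega)
      rw [this, finRotate_last]
      simp [hw0, hwN]
  have key : ∃ σ : Fin (d * κ) ≃ Fin d × Fin κ,
      ∀ t : Fin (d * κ), (w t, w (t + 1)) = (u (σ t).1, β (σ t).1 (σ t).2) := by
    refine MvPolynomial.exists_equiv_labels (fun x : Fin d × Fin κ => (u x.1, β x.1 x.2))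
      (fun t : Fin (d * κ) => (w t, w (t + 1))) ?_
    have h3 := congrArg Multiset.toFinsupp hw
    simp only [itemArcs, map_sum, Multiset.toFinsupp_singleton] at h3
    rw [Finset.sum_range (fun t => Finsupp.single (w t, w (t + 1)) 1)] at h3
    rw [Fintype.sum_prod_type]
    exact h3
  obtain ⟨σ, hσ⟩ := key
  refine ⟨σ, fun t => ?_⟩
  have h1 : w (t.val + 1) = β (σ t).1 (σ t).2 := (Prod.ext_iff.1 (hσ t)).2
  have h2 : w (finRotate _ t).val = u (σ (finRotate _ t)).1 :=
    (Prod.ext_iff.1 (hσ (finRotate _ t))).1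
  rw [← h1, ← h2, hrot]

end
end Tensor

/-! ### Closed walks along the first hyperedges of an arm -/

namespace Hypergraph

open Tensor

section
variable {k r D : ℕ}

/-- The indices belonging to a hyperedge, one for each root, form a closed walk. -/
theorem exists_edge_items (hk : 2 ≤ k) (a : Fin r) (j : Fin D) {b : SpiderVertex k r D}
    (hb : b ∈ spiderEdge k a j) :
    ∃ I : Multiset (SpiderVertex k r D × (Fin (k - 1) → SpiderVertex k r D)),
      Multiset.card I = k ∧ (∀ x ∈ I, OnEdge x.1 x.2 a j) ∧
      (∀ v ∈ spiderEdge k a j, ∃ w, (v, w) ∈ (I.map itemArcs).sum) ∧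
      ArcWalk b b (I.map itemArcs).sum := by
  classical
  let F : Finset (SpiderVertex k r D) := (Set.toFinite (spiderEdge k a j)).toFinset
  have hFE : (F : Set (SpiderVertex k r D)) = spiderEdge k a j := by simp [F]
  have hFcard : F.card = k := by
    rw [← Set.ncard_coe_finset, hFE, ncard_spiderEdge hk]
  have hbF : b ∈ F := by rw [← Finset.mem_coe, hFE]; exact hb
  have hcard : ∀ v ∈ F, (F.erase v).card = k - 1 := fun v hv => by
    rw [Finset.card_erase_of_mem hv, hFcard]
  -- For each root `v`, the heads enumerate the remaining vertices of the hyperedge, so the arcs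
  -- form a complete digraph. The value off `F` is never used.
  let enum : SpiderVertex k r D → Fin (k - 1) → SpiderVertex k r D := fun v q =>
    if hv : v ∈ F then (((F.erase v).equivFinOfCardEq (hcard v hv)).symm q).1 else v
  have henum : ∀ v ∈ F, Set.range (enum v) = F.erase v := fun v hv => by
    ext w
    simp only [enum, hv, dif_pos, Set.mem_range, Finset.mem_coe]
    constructor
    · rintro ⟨q, rfl⟩
      exact (((F.erase v).equivFinOfCardEq (hcard v hv)).symm q).2
    · intro hw
      exact ⟨(F.erase v).equivFinOfCardEq (hcard v hv) ⟨w, hw⟩, by simp⟩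
  have harcs : ∀ v ∈ F, itemArcs (v, enum v) = ∑ w ∈ F.erase v, {(v, w)} := fun v hv => by
    rw [itemArcs, ← Finset.sum_coe_sort (F.erase v),
      ← ((F.erase v).equivFinOfCardEq (hcard v hv)).symm.sum_comp]
    exact Finset.sum_congr rfl fun q _ => by simp [enum, hv]
  have hsum : ((F.val.map fun v => (v, enum v)).map itemArcs).sum =
      ∑ v ∈ F, ∑ w ∈ F.erase v, {(v, w)} := by
    rw [Multiset.map_map]
    exact Finset.sum_congr rfl harcs
  refine ⟨F.val.map fun v => (v, enum v), by simpa using hFcard, ?_, ?_, ?_⟩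
  · intro x hx
    obtain ⟨v, hv, rfl⟩ := Multiset.mem_map.1 hx
    unfold OnEdge
    rw [henum v hv, ← hFE, ← Finset.coe_insert, Finset.insert_erase hv]
  · intro v hv
    rw [← hFE, Finset.mem_coe] at hv
    have h1 : 0 < (F.erase v).card := by rw [hcard v hv]; omega
    obtain ⟨w, hw⟩ := Finset.card_pos.1 h1
    refine ⟨w, ?_⟩
    rw [hsum, Multiset.mem_sum]
    exact ⟨v, hv, Multiset.mem_sum.2 ⟨w, hw, Multiset.mem_singleton_self _⟩⟩
  · rw [hsum, ← Finset.insert_erase hbF]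
    exact ArcWalk.complete b _ (Finset.notMem_erase _ _)

theorem itemArcs_loop (hk : 2 ≤ k) (v : SpiderVertex k r D) :
    ArcWalk v v (itemArcs (v, fun _ : Fin (k - 1) => v)) ∧
      (v, v) ∈ itemArcs (v, fun _ : Fin (k - 1) => v) :=
  ⟨ArcWalk.sum_closed _ fun _ _ => ArcWalk.single v v,
    Multiset.mem_sum.2 ⟨⟨0, by omega⟩, Finset.mem_univ _, Multiset.mem_singleton_self _⟩⟩

/-- A closed walk through the centre and all the hyperedges of an initial part of an arm. -/
theorem exists_arm_items (hk : 2 ≤ k) (a : Fin r) (p : ℕ) (hp : p < D) :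
    ∃ I : Multiset (SpiderVertex k r D × (Fin (k - 1) → SpiderVertex k r D)),
      Multiset.card I = k * p + 1 ∧ (none, fun _ => none) ∈ I ∧
      (∀ x ∈ I, (x.1 = none ∧ ∀ q, x.2 q = x.1) ∨ ∃ j : Fin D, j.val < p ∧ OnEdge x.1 x.2 a j) ∧
      (∃ v ∈ spiderEdge k a ⟨p, hp⟩, (p = 0 ∨ v = some (a, ⟨p - 1, by omega⟩, ⟨k - 2, by omega⟩)) ∧
        ∃ w, (v, w) ∈ (I.map itemArcs).sum) ∧
      ArcWalk none none (I.map itemArcs).sum := by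
  induction p with
  | zero =>
    refine ⟨{(none, fun _ => none)}, by simp, by simp, ?_, ⟨none, none_mem_spiderEdge.2 rfl,
      Or.inl rfl, none, ?_⟩, ?_⟩
    · intro x hx
      rw [Multiset.mem_singleton.1 hx]
      exact Or.inl ⟨rfl, fun _ => rfl⟩
    · simpa using (itemArcs_loop hk none).2
    · simpa using (itemArcs_loop hk none).1
  | succ p ih =>
    -- The vertex `v` lies in the next hyperedge and an arc already leaves it, so the closed walk of
    -- that hyperedge can be inserted there.
    obtain ⟨I, hcard, hnone, hmem, ⟨v, hv, _, w, hvw⟩, hwalk⟩ := ih (by omega)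
    obtain ⟨J, hJcard, hJmem, hJv, hJwalk⟩ := exists_edge_items hk a ⟨p, by omega⟩ hv
    refine ⟨I + J, ?_, Multiset.mem_add.2 (Or.inl hnone), ?_, ?_, ?_⟩
    · rw [Multiset.card_add, hcard, hJcard]; ring
    · intro x hx
      rcases Multiset.mem_add.1 hx with hx | hx
      · rcases hmem x hx with h | ⟨j, hj, h⟩
        · exact Or.inl h
        · exact Or.inr ⟨j, by omega, h⟩
      · exact Or.inr ⟨⟨p, by omega⟩, Nat.lt_succ_self p, hJmem x hx⟩
    · refine ⟨some (a, ⟨p, by omega⟩, ⟨k - 2, by omega⟩),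
        some_mem_spiderEdge.2 ⟨rfl, Or.inr ⟨rfl, ?_⟩⟩, Or.inr rfl, ?_⟩
      · simp only; omega
      · obtain ⟨w, hw⟩ := hJv _ (some_mem_spiderEdge.2 ⟨rfl, Or.inl rfl⟩)
        exact ⟨w, by rw [Multiset.map_add, Multiset.sum_add]; exact Multiset.mem_add.2 (Or.inr hw)⟩
    · rw [Multiset.map_add, Multiset.sum_add]
      exact hwalk.insert_closed hvw hJwalk

/-- The extremal walk: one loop at the centre, `k` indices for each of `p` hyperedges, and one loop
at the vertex where these end. -/
theorem exists_arm_circuit (hk : 2 ≤ k) (a : Fin r) {p : ℕ} (hp0 : 0 < p) (hp : p < D) :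
    ∃ (u : Fin (k * p + 2) → SpiderVertex k r D)
      (β : Fin (k * p + 2) → Fin (k - 1) → SpiderVertex k r D),
      (∃ σ, IsCircuit u β σ) ∧
      (∀ s, (u s = none ∧ ∀ q, β s q = u s) ∨ (∃ j : Fin D, j.val < p ∧ OnEdge (u s) (β s) a j) ∨
        (u s = some (a, ⟨p - 1, by omega⟩, ⟨k - 2, by omega⟩) ∧ ∀ q, β s q = u s)) ∧
      (∃ s, u s = none ∧ ∀ q, β s q = u s) ∧
      ∃ s, u s = some (a, ⟨p - 1, by omega⟩, ⟨k - 2, by omega⟩) ∧ ∀ q, β s q = u s := by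
  obtain ⟨I, hcard, hnone, hmem, ⟨v, _, hv, w, hvw⟩, hwalk⟩ := exists_arm_items hk a p hp
  replace hv := hv.resolve_left hp0.ne'
  set J := (v, fun _ => v) ::ₘ I with hJ
  have hJcard : Multiset.card J = k * p + 2 := by rw [hJ, Multiset.card_cons, hcard]
  have hJwalk : ArcWalk none none (J.map itemArcs).sum := by
    rw [hJ, Multiset.map_cons, Multiset.sum_cons, add_comm]
    exact hwalk.insert_closed hvw (itemArcs_loop hk v).1
  have hJmem : ∀ x ∈ J, (x.1 = none ∧ ∀ q, x.2 q = x.1) ∨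
      (∃ j : Fin D, j.val < p ∧ OnEdge x.1 x.2 a j) ∨
        (x.1 = some (a, ⟨p - 1, by omega⟩, ⟨k - 2, by omega⟩) ∧ ∀ q, x.2 q = x.1) := by
    intro x hx
    rcases Multiset.mem_cons.1 hx with rfl | hx
    · exact Or.inr (Or.inr ⟨hv, fun _ => rfl⟩)
    · rcases hmem x hx with h | h
      · exact Or.inl h
      · exact Or.inr (Or.inl h)
  obtain ⟨f, hf⟩ := J.exists_map_univ_eq hJcard
  refine ⟨fun s => (f s).1, fun s => (f s).2, ?_, ?_, ?_, ?_⟩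
  · refine exists_isCircuit_of_arcWalk (v := none) ?_
    have : ∑ s, itemArcs ((f s).1, (f s).2) = (J.map itemArcs).sum := by
      rw [← hf, Multiset.map_map]; rfl
    rw [this]
    exact hJwalk
  · intro s
    exact hJmem (f s) (hf ▸ Multiset.mem_map_of_mem f (Finset.mem_univ_val s))
  · have : (none, fun _ => none) ∈ Finset.univ.val.map f := by
      rw [hf]; exact Multiset.mem_cons_of_mem hnone
    obtain ⟨s, _, hs⟩ := Multiset.mem_map.1 this
    exact ⟨s, by simp [hs], fun q => by simp [hs]⟩
  · have : (v, fun _ => v) ∈ Finset.univ.val.map f := by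
      rw [hf]; exact Multiset.mem_cons_self _ _
    obtain ⟨s, _, hs⟩ := Multiset.mem_map.1 this
    exact ⟨s, by simpa [hs] using hv, fun q => by simp [hs]⟩

end
end Hypergraph

/-! ### Comparison of spiders -/

namespace Hypergraph

open Tensor

section
variable {k r d : ℕ}

/-- The four spiders share their vertex set and hence their circuit coefficients, so the second
difference may be taken term by term. -/
theorem spider_circuitSum_sub (k r d : ℕ) (α : ℝ) (p t N : ℕ) :
    (circuitSum ((spider k (armLen r t (d - t) 1) : Hypergraph (SpiderVertex k r d)).alphaTensor
        k α) N -
      circuitSum ((spider k (armLen r t (d - t) 0) : Hypergraph (SpiderVertex k r d)).alphaTensor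
        k α) N) -
      (circuitSum ((spider k (armLen r p (d - p) 1) : Hypergraph (SpiderVertex k r d)).alphaTensor
        k α) N -
      circuitSum ((spider k (armLen r p (d - p) 0) : Hypergraph (SpiderVertex k r d)).alphaTensor
        k α) N) =
    ∑ u : Fin N → SpiderVertex k r d, ∑ β : Fin N → Fin (k - 1) → SpiderVertex k r d,
      circuitCoeff ℝ u β *
        ((∏ s, armWeight k α d t 1 (u s) (β s) - ∏ s, armWeight k α d t 0 (u s) (β s)) -
          (∏ s, armWeight k α d p 1 (u s) (β s) - ∏ s, armWeight k α d p 0 (u s) (β s))) := by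
  simp only [circuitSum, armWeight, mul_sub, Finset.sum_sub_distrib]

theorem armWeight_term_nonneg (hk : 2 ≤ k) {α : ℝ} (h0 : 0 ≤ α) (h1 : α ≤ 1)
    {p t N : ℕ} (hp : 0 < p) (hpt : p < t) (htd : 2 * t ≤ d) (hN : N ≤ k * p + 2)
    (u : Fin N → SpiderVertex k r d) (β : Fin N → Fin (k - 1) → SpiderVertex k r d) :
    0 ≤ circuitCoeff ℝ u β *
        ((∏ s, armWeight k α d t 1 (u s) (β s) - ∏ s, armWeight k α d t 0 (u s) (β s)) -
          (∏ s, armWeight k α d p 1 (u s) (β s) - ∏ s, armWeight k α d p 0 (u s) (β s))) ∧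
    (N < k * p + 2 → circuitCoeff ℝ u β *
        ((∏ s, armWeight k α d t 1 (u s) (β s) - ∏ s, armWeight k α d t 0 (u s) (β s)) -
          (∏ s, armWeight k α d p 1 (u s) (β s) - ∏ s, armWeight k α d p 0 (u s) (β s))) = 0) := by
  by_cases hc : circuitCoeff ℝ u β = 0
  · simp [hc]
  obtain ⟨σ, hσ⟩ := exists_isCircuit_of_circuitCoeff_ne_zero hc
  by_cases hval : ∀ s, (∀ q, β s q = u s) ∨ ∃ a j, OnEdge (u s) (β s) a j
  · obtain ⟨h2, h3⟩ := armWeight_prod_nonneg hσ hk h0 h1 hp hpt htd hN hval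
    exact ⟨mul_nonneg (circuitCoeff_nonneg u β) h2, fun hN' => by rw [h3 hN', mul_zero]⟩
  · obtain ⟨s, hs⟩ := not_forall.1 hval
    have hz : ∀ x ε, ∏ s, armWeight k α d x ε (u s) (β s) = 0 := fun x ε =>
      Finset.prod_eq_zero (Finset.mem_univ s) (alphaTensor_spider_eq_zero α _ hs)
    simp [hz]

theorem spider_circuitSum_eq (hk : 2 ≤ k) {α : ℝ} (h0 : 0 ≤ α) (h1 : α ≤ 1)
    {p t N : ℕ} (hp : 0 < p) (hpt : p < t) (htd : 2 * t ≤ d) (hN : N < k * p + 2)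
    (hpath : circuitSum ((spider k (armLen r p (d - p) 0) :
        Hypergraph (SpiderVertex k r d)).alphaTensor k α) N =
      circuitSum ((spider k (armLen r t (d - t) 0) :
        Hypergraph (SpiderVertex k r d)).alphaTensor k α) N) :
    circuitSum ((spider k (armLen r p (d - p) 1) :
        Hypergraph (SpiderVertex k r d)).alphaTensor k α) N =
      circuitSum ((spider k (armLen r t (d - t) 1) :
        Hypergraph (SpiderVertex k r d)).alphaTensor k α) N := by
  have h := spider_circuitSum_sub k r d α p t N
  rw [Finset.sum_eq_zero fun u _ => Finset.sum_eq_zero fun β _ =>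
    (armWeight_term_nonneg hk h0 h1 hp hpt htd hN.le u β).2 hN] at h
  linarith

/-- Since the paths (`ε = 0`) agree, the second difference is the difference sought; its terms are
nonnegative and the extremal walk gives a positive one. -/
theorem spider_circuitSum_lt (hk : 2 ≤ k) {α : ℝ} (h0 : 0 < α) (h1 : α < 1)
    {p t : ℕ} (hp : 0 < p) (hpt : p < t) (htd : 2 * t ≤ d) (hr : 2 < r)
    (hpath : circuitSum ((spider k (armLen r p (d - p) 0) :
        Hypergraph (SpiderVertex k r d)).alphaTensor k α) (k * p + 2) =
      circuitSum ((spider k (armLen r t (d - t) 0) :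
        Hypergraph (SpiderVertex k r d)).alphaTensor k α) (k * p + 2)) :
    circuitSum ((spider k (armLen r p (d - p) 1) :
        Hypergraph (SpiderVertex k r d)).alphaTensor k α) (k * p + 2) <
      circuitSum ((spider k (armLen r t (d - t) 1) :
        Hypergraph (SpiderVertex k r d)).alphaTensor k α) (k * p + 2) := by
  have h := spider_circuitSum_sub k r d α p t (k * p + 2)
  have hnn := armWeight_term_nonneg (r := r) hk h0.le h1.le hp hpt htd le_rfl
  obtain ⟨u, β, ⟨σ, hσ⟩, hconf, hA, hC⟩ :=
    exists_arm_circuit (r := r) (D := d) hk ⟨0, by omega⟩ hp (by omega)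
  have hpos := mul_pos hσ.circuitCoeff_pos (armWeight_prod_pos hk h0 h1 hp hpt htd hr hconf hA hC)
  have hsum := Finset.sum_pos' (s := Finset.univ)
    (fun u _ => Finset.sum_nonneg fun β _ => (hnn u β).1)
    ⟨u, Finset.mem_univ _, Finset.sum_pos' (s := Finset.univ) (fun β _ => (hnn u β).1)
      ⟨β, Finset.mem_univ _, hpos⟩⟩
  rw [← h] at hsum
  linarith

/-! ### Starlike hypertrees as spiders -/

/-- The inclusion of the vertices of a starlike hypertree into those of a spider. -/
def starlikeToSpider (k : ℕ) (L : List ℕ) (hr : L.length ≤ r) (hD : ∀ a, L.get a ≤ d) :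
    StarlikeVertex k L → SpiderVertex k r d :=
  Option.map fun x => (Fin.castLE hr x.1, Fin.castLE (hD x.1) x.2.1, x.2.2)

theorem starlikeToSpider_injective (k : ℕ) (L : List ℕ) (hr : L.length ≤ r)
    (hD : ∀ a, L.get a ≤ d) : Function.Injective (starlikeToSpider k L hr hD) := by
  refine Option.map_injective ?_
  rintro ⟨a, j, x⟩ ⟨b, i, y⟩ h
  simp only [Prod.mk.injEq] at h
  obtain ⟨h1, h2, h3⟩ := h
  obtain rfl := Fin.castLE_injective hr h1
  obtain rfl : j = i := Fin.ext (by simpa [Fin.ext_iff] using h2)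
  rw [h3]

theorem image_starlikeEdge (k : ℕ) (L : List ℕ) (hr : L.length ≤ r)
    (hD : ∀ a, L.get a ≤ d) (a : Fin L.length) (j : Fin (L.get a)) :
    starlikeToSpider k L hr hD '' starlikeEdge k L a j =
      spiderEdge k (Fin.castLE hr a) (Fin.castLE (hD a) j) := by
  ext v
  constructor
  · rintro ⟨w, (⟨rfl, h⟩ | ⟨x, rfl⟩ | ⟨i, x, rfl, h⟩), rfl⟩
    · exact none_mem_spiderEdge.2 h
    · exact some_mem_spiderEdge.2 ⟨rfl, Or.inl rfl⟩
    · exact some_mem_spiderEdge.2 ⟨rfl, Or.inr h⟩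
  · rintro (⟨rfl, h⟩ | ⟨x, rfl⟩ | ⟨i, x, rfl, h1, h2⟩)
    · exact ⟨none, Or.inl ⟨rfl, h⟩, rfl⟩
    · exact ⟨some ⟨a, j, x⟩, Or.inr (Or.inl ⟨x, rfl⟩), rfl⟩
    · have hj : i.val + 1 = j.val := h1
      refine ⟨some ⟨a, ⟨i.val, by have := j.isLt; omega⟩, x⟩,
        Or.inr (Or.inr ⟨_, x, rfl, hj, h2⟩), rfl⟩

theorem image_starlike_edgeSet (k : ℕ) (L : List ℕ) (hr : L.length ≤ r)
    (hD : ∀ a, L.get a ≤ d) :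
    (spider k (fun a : Fin r => L.getD a 0) : Hypergraph (SpiderVertex k r d)).edgeSet =
      Set.image (starlikeToSpider k L hr hD) '' (starlike k L).edgeSet := by
  ext e
  constructor
  · rintro ⟨a, j, hj, rfl⟩
    replace hj : j.val < L.getD a.val 0 := hj
    -- Past the end of the list the default length 0 leaves an arm without hyperedges.
    have ha : a.val < L.length := by
      by_contra ha
      rw [List.getD_eq_default _ _ (by omega)] at hj
      omega
    rw [List.getD_eq_getElem _ _ ha] at hj
    exact ⟨_, ⟨⟨a.val, ha⟩, ⟨j.val, hj⟩, rfl⟩, image_starlikeEdge k L hr hD _ _⟩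
  · rintro ⟨_, ⟨a, j, rfl⟩, rfl⟩
    refine ⟨Fin.castLE hr a, Fin.castLE (hD a) j, ?_, image_starlikeEdge k L hr hD a j⟩
    have := j.isLt
    simp only [Fin.val_castLE, List.getD_eq_getElem _ _ a.isLt]
    exact this

theorem circuitSum_starlike (k : ℕ) (α : ℝ) (L : List ℕ) (len : Fin r → ℕ) (hr : L.length ≤ r)
    (hD : ∀ a, L.get a ≤ d) (hlen : ∀ a : Fin r, L.getD a 0 = len a) (N : ℕ) :
    circuitSum ((starlike k L).alphaTensor k α) N =
      circuitSum ((spider k len : Hypergraph (SpiderVertex k r d)).alphaTensor k α) N := by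
  obtain rfl : (fun a : Fin r => L.getD a 0) = len := funext hlen
  exact circuitSum_alphaTensor_eq (starlikeToSpider_injective k L hr hD)
    (image_starlike_edgeSet k L hr hD) k α N

end
end Hypergraph

/-! ### Paths, distances and cycles -/

namespace Hypergraph

section
variable {V W : Type*}

/-- The graph joining distinct vertices that share a hyperedge. -/
def twoSection (H : Hypergraph V) : SimpleGraph V where
  Adj u v := u ≠ v ∧ H.Adj u v
  symm := ⟨fun _ _ h => ⟨h.1.symm, h.2.symm⟩⟩
  loopless := ⟨fun _ h => h.1 rfl⟩

/-- A shortest walk in the two-section repeats no hyperedge: using one at two different steps would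
allow a shortcut inside it. -/
theorem exists_hasPath_of_walk {H : Hypergraph V} (hV : H.vertexSet = Set.univ) {u v : V}
    (w : H.twoSection.Walk u v) : ∃ l ≤ w.length, H.HasPath u v l := by
  obtain ⟨p, hp, hlen⟩ := w.reachable.exists_path_of_dist
  refine ⟨p.length, hlen ▸ SimpleGraph.dist_le w, ?_⟩
  have hadj : ∀ i : Fin p.length, ∃ e ∈ H.edgeSet, p.getVert i ∈ e ∧ p.getVert (i + 1) ∈ e :=
    fun i => (p.adj_getVert_succ i.isLt).2
  choose e he h1 h2 using hadj
  have hne : ∀ i j : Fin p.length, i < j → e i ≠ e j := by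
    intro i j hij hee
    have hle : H.twoSection.dist (p.getVert i) (p.getVert (j + 1)) ≤ 1 := by
      by_cases heq : p.getVert i = p.getVert (j + 1)
      · rw [heq, SimpleGraph.dist_self]; exact Nat.zero_le _
      · have hA : H.twoSection.Adj (p.getVert i) (p.getVert (j + 1)) :=
          ⟨heq, e j, he j, hee ▸ h1 i, h2 j⟩
        exact (SimpleGraph.dist_eq_one_iff_adj.2 hA).le
    have hd1 : H.twoSection.dist u (p.getVert i) ≤ i := by
      refine (SimpleGraph.dist_le (p.take i)).trans ?_
      simp
    have hd2 : H.twoSection.dist (p.getVert (j + 1)) v ≤ p.length - (j + 1) := by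
      refine (SimpleGraph.dist_le (p.drop (j + 1))).trans ?_
      simp
    have hr1 : H.twoSection.Reachable u (p.getVert i) := (p.take i).reachable
    have ht1 := hr1.dist_triangle_left v
    have hr2 : H.twoSection.Reachable (p.getVert i) (p.getVert (j + 1)) :=
      hr1.symm.trans (p.take (j + 1)).reachable
    have ht2 := hr2.dist_triangle_left v
    have := j.isLt
    have : i.val < j.val := hij
    omega
  refine ⟨fun i => p.getVert i, e, ?_, ?_, by simp, by simp, by simp [hV],
    fun i => ⟨he i, h1 i, h2 i⟩⟩
  · intro i j hij
    exact Fin.ext (hp.getVert_injOn (by simp; omega) (by simp; omega) hij)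
  · intro i j hij
    rcases lt_trichotomy i j with h | h | h
    · exact absurd hij (hne i j h)
    · exact h
    · exact absurd hij.symm (hne j i h)

/-- There is a walk of length at most `n` from `u` to `v`. -/
def Near (H : Hypergraph V) (n : ℕ) (u v : V) : Prop :=
  ∃ w : H.twoSection.Walk u v, w.length ≤ n

theorem Near.refl (H : Hypergraph V) (u : V) : H.Near 0 u u := ⟨.nil, le_rfl⟩

theorem Near.symm {H : Hypergraph V} {n : ℕ} {u v : V} (h : H.Near n u v) : H.Near n v u :=
  ⟨h.choose.reverse, by simpa using h.choose_spec⟩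

theorem Near.trans {H : Hypergraph V} {n m : ℕ} {u v w : V} (h : H.Near n u v) (h' : H.Near m v w) :
    H.Near (n + m) u w :=
  ⟨h.choose.append h'.choose, by
    rw [SimpleGraph.Walk.length_append]; exact Nat.add_le_add h.choose_spec h'.choose_spec⟩

theorem Near.mono {H : Hypergraph V} {n m : ℕ} {u v : V} (h : H.Near n u v) (hnm : n ≤ m) :
    H.Near m u v :=
  ⟨h.choose, h.choose_spec.trans hnm⟩

theorem near_of_mem {H : Hypergraph V} {e : Set V} (he : e ∈ H.edgeSet) {u v : V} (hu : u ∈ e)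
    (hv : v ∈ e) : H.Near 1 u v := by
  by_cases huv : u = v
  · subst huv; exact (Near.refl H u).mono zero_le_one
  · have hA : H.twoSection.Adj u v := ⟨huv, e, he, hu, hv⟩
    exact ⟨.cons hA .nil, by simp⟩

theorem Near.dist_le {H : Hypergraph V} (hV : H.vertexSet = Set.univ) {n : ℕ} {u v : V}
    (h : H.Near n u v) : H.dist u v ≤ n := by
  obtain ⟨w, hw⟩ := h
  obtain ⟨l, hl, hp⟩ := exists_hasPath_of_walk hV w
  exact (Nat.sInf_le hp).trans (hl.trans hw)

/-- A function varying by at most one on each hyperedge bounds lengths of paths from below. -/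
theorem HasPath.abs_sub_le {H : Hypergraph V} {f : V → ℤ}
    (hf : ∀ e ∈ H.edgeSet, ∀ u ∈ e, ∀ v ∈ e, f v - f u ≤ 1) {u v : V} {l : ℕ}
    (h : H.HasPath u v l) : f v - f u ≤ l := by
  obtain ⟨x, e, _, _, rfl, rfl, _, he⟩ := h
  have key : ∀ i : ℕ, ∀ hi : i < l + 1, f (x ⟨i, hi⟩) - f (x 0) ≤ i := by
    intro i
    induction i with
    | zero => intro hi; simp
    | succ i ih =>
      intro hi
      have h1 := ih (by omega)
      have h2 := hf _ (he ⟨i, by omega⟩).1 _ (he ⟨i, by omega⟩).2.1 _ (he ⟨i, by omega⟩).2.2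
      simp only [Fin.castSucc_mk, Fin.succ_mk] at h2
      push_cast
      linarith
  exact key l (Nat.lt_succ_self l)

theorem HasCycle.of_image {H : Hypergraph V} {H' : Hypergraph W} {φ : V → W}
    (hφ : Function.Injective φ) (hE : H'.edgeSet = Set.image φ '' H.edgeSet) (h : H.HasCycle) :
    H'.HasCycle := by
  obtain ⟨p, x, e, hx, he, h⟩ := h
  refine ⟨p, φ ∘ x, fun i => φ '' e i, hφ.comp hx, (Set.image_injective.2 hφ).comp he, fun i => ?_⟩
  obtain ⟨h1, h2, h3⟩ := h i
  exact ⟨hE ▸ ⟨_, h1, rfl⟩, ⟨_, h2, rfl⟩, ⟨_, h3, rfl⟩⟩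

/-- Take a hyperedge of the cycle at maximal depth. One of its two cycle vertices is not the
attaching vertex, so other hyperedges containing it are deeper; but the cycle has another hyperedge
through it. -/
theorem spider_not_hasCycle {k r D : ℕ} (hk : 2 ≤ k) (len : Fin r → ℕ) :
    ¬ (spider k len : Hypergraph (SpiderVertex k r D)).HasCycle := by
  rintro ⟨p, x, e, hx, he, h⟩
  choose a j _ hj using fun i => (h i).1
  obtain ⟨i, hi⟩ := Finite.exists_max j
  have key : ∀ y z i', x y = some (a i, j i, z) → x y ∈ e i' → i' = i := by
    intro y z i' hy hyi
    rw [hy, hj i', some_mem_spiderEdge] at hyi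
    obtain ⟨h1, h2 | ⟨h2, _⟩⟩ := hyi
    · exact he (by rw [hj i', hj i, h1, h2])
    · have : (j i').val ≤ (j i).val := hi i'
      omega
  obtain ⟨b, _, hE⟩ := exists_base hk (a i) (j i)
  have hmem : ∀ y, x y ∈ e i → x y = b ∨ ∃ z, x y = some (a i, j i, z) := fun y hy => by
    rw [hj i, hE] at hy
    rcases hy with h | ⟨z, h⟩
    · exact Or.inl h
    · exact Or.inr ⟨z, h.symm⟩
  have hne : (i + 1 : Fin (p + 2)) ≠ i := by simp
  rcases hmem i (h i).2.1 with h1 | ⟨z, h1⟩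
  · rcases hmem (i + 1) (h i).2.2 with h2 | ⟨z, h2⟩
    · exact hne (hx (h2.trans h1.symm))
    · exact hne (key _ z _ h2 (h (i + 1)).2.1)
  · have h3 := (h (i - 1)).2.2
    rw [sub_add_cancel] at h3
    have h4 := key _ z _ h1 h3
    exact hne (by rw [sub_eq_iff_eq_add] at h4; exact h4.symm)

end

/-! ### Starlike hypertrees -/

section Starlike
variable {k : ℕ} {L : List ℕ}

theorem get_le_sum (L : List ℕ) (a : Fin L.length) : L.get a ≤ L.sum :=
  List.le_sum_of_mem (List.get_mem L a)

theorem starlike_isUniform (hk : 2 ≤ k) : (starlike k L).IsUniform k := by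
  rintro _ ⟨a, j, rfl⟩
  rw [← Set.ncard_image_of_injective _ (starlikeToSpider_injective k L le_rfl (get_le_sum L)),
    image_starlikeEdge, ncard_spiderEdge hk]

theorem starlikeEdge_injective (hk : 2 ≤ k) : Function.Injective
    fun x : Σ a : Fin L.length, Fin (L.get a) => starlikeEdge k L x.1 x.2 := by
  rintro ⟨a, j⟩ ⟨b, i⟩ h
  have h1 := congrArg (Set.image (starlikeToSpider k L le_rfl (get_le_sum L))) h
  simp only [image_starlikeEdge] at h1
  obtain ⟨h2, h3⟩ := spiderEdge_injective hk h1
  obtain rfl := Fin.castLE_injective _ h2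
  obtain rfl : j = i := Fin.ext (by simpa [Fin.ext_iff] using h3)
  rfl

theorem starlike_edgeSet_ncard (hk : 2 ≤ k) : (starlike k L).edgeSet.ncard = L.sum := by
  have h : (starlike k L).edgeSet = Set.range
      fun x : Σ a : Fin L.length, Fin (L.get a) => starlikeEdge k L x.1 x.2 := by
    ext e
    constructor
    · rintro ⟨a, j, rfl⟩; exact ⟨⟨a, j⟩, rfl⟩
    · rintro ⟨⟨a, j⟩, rfl⟩; exact ⟨a, j, rfl⟩
  rw [h, ← Set.image_univ, Set.ncard_image_of_injective _ (starlikeEdge_injective hk),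
    Set.ncard_univ, Nat.card_eq_fintype_card, Fintype.card_sigma]
  simp

theorem starlikeVertex_card :
    Fintype.card (StarlikeVertex k L) = L.sum * (k - 1) + 1 := by
  rw [Fintype.card_option, Fintype.card_sigma]
  simp [← Finset.sum_mul]

theorem starlike_not_hasCycle (hk : 2 ≤ k) : ¬ (starlike k L).HasCycle := fun h =>
  spider_not_hasCycle hk _ (h.of_image (starlikeToSpider_injective k L le_rfl (get_le_sum L))
    (image_starlike_edgeSet k L le_rfl (get_le_sum L)))

theorem some_mem_starlikeEdge (a : Fin L.length) (j : Fin (L.get a)) (y : Fin (k - 1)) :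
    (some ⟨a, j, y⟩ : StarlikeVertex k L) ∈ starlikeEdge k L a j :=
  Or.inr (Or.inl ⟨y, rfl⟩)

theorem last_mem_starlikeEdge (hk : 2 ≤ k) (a : Fin L.length) (i j : Fin (L.get a))
    (hij : i.val + 1 = j.val) :
    (some ⟨a, i, ⟨k - 2, by omega⟩⟩ : StarlikeVertex k L) ∈ starlikeEdge k L a j :=
  Or.inr (Or.inr ⟨i, ⟨k - 2, by omega⟩, rfl, hij, by simp only; omega⟩)

theorem starlikeEdge_mem (a : Fin L.length) (j : Fin (L.get a)) :
    starlikeEdge k L a j ∈ (starlike k L).edgeSet :=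
  ⟨a, j, rfl⟩

theorem near_none (hk : 2 ≤ k) (a : Fin L.length) (j : ℕ) (hj : j < L.get a) (y : Fin (k - 1)) :
    (starlike k L).Near (j + 1) none (some ⟨a, ⟨j, hj⟩, y⟩) := by
  induction j generalizing y with
  | zero =>
    exact near_of_mem (starlikeEdge_mem a ⟨0, hj⟩) (Or.inl ⟨rfl, rfl⟩) (some_mem_starlikeEdge _ _ _)
  | succ j ih =>
    exact (ih (by omega) ⟨k - 2, by omega⟩).trans (near_of_mem (starlikeEdge_mem a ⟨j + 1, hj⟩)
      (last_mem_starlikeEdge hk a ⟨j, by omega⟩ ⟨j + 1, hj⟩ rfl) (some_mem_starlikeEdge _ _ _))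

theorem near_same_arm (hk : 2 ≤ k) (a : Fin L.length) (i : Fin (L.get a)) (y z : Fin (k - 1))
    (n : ℕ) (hj : i + n < L.get a) :
    (starlike k L).Near (n + 1) (some ⟨a, i, y⟩) (some ⟨a, ⟨i + n, hj⟩, z⟩) := by
  induction n generalizing z with
  | zero =>
    exact near_of_mem (starlikeEdge_mem a i) (some_mem_starlikeEdge _ _ _)
      (some_mem_starlikeEdge _ _ _)
  | succ n ih =>
    exact (ih ⟨k - 2, by omega⟩ (by omega)).trans (near_of_mem (starlikeEdge_mem a ⟨i + (n + 1), hj⟩)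
      (last_mem_starlikeEdge hk a ⟨i + n, by omega⟩ ⟨i + (n + 1), hj⟩ rfl)
      (some_mem_starlikeEdge _ _ _))

theorem starlike_near (hk : 2 ≤ k) {d : ℕ} (h1 : ∀ a, L.get a ≤ d)
    (h2 : ∀ a b, a ≠ b → L.get a + L.get b ≤ d) (u v : StarlikeVertex k L) :
    (starlike k L).Near d u v := by
  rcases u with _ | ⟨a, i, y⟩ <;> rcases v with _ | ⟨b, j, z⟩
  · exact (Near.refl _ _).mono (Nat.zero_le d)
  · exact (near_none hk b j j.isLt z).mono ((Nat.succ_le_of_lt j.isLt).trans (h1 b))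
  · exact (near_none hk a i i.isLt y).symm.mono ((Nat.succ_le_of_lt i.isLt).trans (h1 a))
  · by_cases hab : a = b
    · subst hab
      have hi := i.isLt
      have hj := j.isLt
      have := h1 a
      rcases le_total i.val j.val with hij | hij
      · obtain ⟨n, hn⟩ := Nat.exists_eq_add_of_le hij
        rw [show j = ⟨i + n, by omega⟩ from Fin.ext hn]
        exact (near_same_arm hk a i y z n _).mono (by omega)
      · obtain ⟨n, hn⟩ := Nat.exists_eq_add_of_le hij
        rw [show i = ⟨j + n, by omega⟩ from Fin.ext hn]
        exact (near_same_arm hk a j z y n _).symm.mono (by omega)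
    · have := h2 a b hab
      have hi := i.isLt
      have hj := j.isLt
      exact ((near_none hk a i i.isLt y).symm.trans (near_none hk b j j.isLt z)).mono (by omega)

theorem starlike_isHypertree (hk : 2 ≤ k) : (starlike k L).IsHypertree k := by
  refine ⟨starlike_isUniform hk, ⟨⟨none, trivial⟩, fun u _ v _ => ?_⟩, starlike_not_hasCycle hk⟩
  obtain ⟨w, _⟩ := starlike_near hk (d := L.sum + L.sum)
    (fun a => (get_le_sum L a).trans (Nat.le_add_left _ _))
    (fun a b _ => Nat.add_le_add (get_le_sum L a) (get_le_sum L b)) u v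
  obtain ⟨l, _, h⟩ := exists_hasPath_of_walk rfl w
  exact ⟨l, h⟩

/-- Signed distance along the arms `a` (negative) and `b` (positive). -/
def signedDepth (a b : Fin L.length) : StarlikeVertex k L → ℤ
  | none => 0
  | some ⟨c, j, _⟩ => if c = a then -(j.val + 1) else if c = b then j.val + 1 else 0

/-- This makes the signed depth a lower bound for path lengths, so the ends of the arms `a` and `b`
are at distance at least the sum of their lengths. -/
theorem signedDepth_sub_le (a b : Fin L.length) (e : Set (StarlikeVertex k L))
    (he : e ∈ (starlike k L).edgeSet) (u : StarlikeVertex k L) (hu : u ∈ e)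
    (v : StarlikeVertex k L) (hv : v ∈ e) :
    signedDepth a b v - signedDepth a b u ≤ 1 := by
  obtain ⟨c, j, rfl⟩ := he
  rcases hu with ⟨rfl, hu⟩ | ⟨y, rfl⟩ | ⟨i, y, rfl, hu, _⟩ <;>
  rcases hv with ⟨rfl, hv⟩ | ⟨z, rfl⟩ | ⟨i', z, rfl, hv, _⟩ <;>
  simp only [signedDepth] <;> (try split_ifs) <;> omega

theorem starlike_hasDiameter (hk : 2 ≤ k) {d : ℕ} (h1 : ∀ a, L.get a ≤ d)
    (h2 : ∀ a b, a ≠ b → L.get a + L.get b ≤ d) (a b : Fin L.length) (hab : a ≠ b)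
    (ha : 0 < L.get a) (hb : 0 < L.get b) (hd : L.get a + L.get b = d) :
    (starlike k L).HasDiameter d := by
  have hle : ∀ u v, (starlike k L).dist u v ≤ d := fun u v =>
    (starlike_near hk h1 h2 u v).dist_le rfl
  constructor
  · let u : StarlikeVertex k L := some ⟨a, ⟨L.get a - 1, by omega⟩, ⟨0, by omega⟩⟩
    let v : StarlikeVertex k L := some ⟨b, ⟨L.get b - 1, by omega⟩, ⟨0, by omega⟩⟩
    refine ⟨u, trivial, v, trivial, le_antisymm (hle u v) ?_⟩
    have hne : {l | (starlike k L).HasPath u v l}.Nonempty :=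
      (starlike_isHypertree hk).2.1.2 u trivial v trivial
    have hp : (starlike k L).HasPath u v ((starlike k L).dist u v) := Nat.sInf_mem hne
    have := hp.abs_sub_le (signedDepth_sub_le a b)
    have hf : signedDepth a b v - signedDepth a b u = L.get a + L.get b := by
      simp only [signedDepth, u, v, if_true, if_neg hab.symm]
      omega
    omega
  · rintro _ ⟨u, _, v, _, rfl⟩
    exact hle u v

/-- The arm lengths `p, q, 1, …, 1` with `s` ones. -/
abbrev armList (p q s : ℕ) : List ℕ := p :: q :: List.replicate s 1

theorem armList_get (p q s : ℕ) (a : Fin (armList p q s).length) :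
    (armList p q s).get a = if a.val = 0 then p else if a.val = 1 then q else 1 := by
  obtain ⟨n, hn⟩ := a
  rcases n with _ | _ | n <;> simp

theorem armList_sum (p q s : ℕ) : (armList p q s).sum = p + q + s := by
  simp; ring

theorem armList_hasDiameter (hk : 2 ≤ k) {p q : ℕ} (s : ℕ) (hp : 0 < p) (hq : 0 < q) :
    (starlike k (armList p q s)).HasDiameter (p + q) := by
  refine starlike_hasDiameter hk (fun a => ?_) (fun a b hab => ?_) ⟨0, by simp⟩ ⟨1, by simp⟩
    (by simp) hp hq rfl
  · rw [armList_get]; split_ifs <;> omega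
  · have : a.val ≠ b.val := fun h => hab (Fin.ext h)
    rw [armList_get, armList_get]; split_ifs <;> omega

end Starlike
end Hypergraph

/-! ### The number of vertices of a hypertree -/

namespace Hypergraph

section
variable {V : Type*}

/-- The bipartite graph joining each vertex to the hyperedges containing it. -/
def incidenceGraph (H : Hypergraph V) : SimpleGraph (V ⊕ H.edgeSet) where
  Adj a b := (∃ v e, a = .inl v ∧ b = .inr e ∧ v ∈ e.1) ∨ ∃ v e, a = .inr e ∧ b = .inl v ∧ v ∈ e.1
  symm := ⟨fun _ _ h => h.symm.imp (fun ⟨v, e, h1, h2, h3⟩ => ⟨v, e, h2, h1, h3⟩)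
    fun ⟨v, e, h1, h2, h3⟩ => ⟨v, e, h2, h1, h3⟩⟩
  loopless := ⟨fun a h => by rcases h with ⟨v, e, rfl, h, _⟩ | ⟨v, e, rfl, h, _⟩ <;> simp at h⟩

theorem incidenceGraph_adj {H : Hypergraph V} {v : V} {e : H.edgeSet} :
    H.incidenceGraph.Adj (.inl v) (.inr e) ↔ v ∈ e.1 := by
  simp [incidenceGraph]

theorem incidenceGraph_adj_inl {H : Hypergraph V} {v : V} {b : V ⊕ H.edgeSet} :
    H.incidenceGraph.Adj (.inl v) b ↔ ∃ e : H.edgeSet, b = .inr e ∧ v ∈ e.1 := by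
  simp [incidenceGraph]

theorem incidenceGraph_adj_inr {H : Hypergraph V} {e : H.edgeSet} {b : V ⊕ H.edgeSet} :
    H.incidenceGraph.Adj (.inr e) b ↔ ∃ v : V, b = .inl v ∧ v ∈ e.1 := by
  simp [incidenceGraph]

theorem HasPath.reachable {H : Hypergraph V} {u v : V} {l : ℕ} (h : H.HasPath u v l) :
    H.incidenceGraph.Reachable (.inl u) (.inl v) := by
  obtain ⟨x, e, _, _, rfl, rfl, _, he⟩ := h
  have key : ∀ i : ℕ, ∀ hi : i < l + 1,
      H.incidenceGraph.Reachable (.inl (x 0)) (.inl (x ⟨i, hi⟩)) := by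
    intro i
    induction i with
    | zero => exact fun _ => .rfl
    | succ i ih =>
      intro hi
      obtain ⟨h1, h2, h3⟩ := he ⟨i, by omega⟩
      refine (ih (by omega)).trans (SimpleGraph.Adj.reachable
        (v := .inr ⟨_, h1⟩) (incidenceGraph_adj.2 h2) |>.trans ?_)
      exact SimpleGraph.Adj.reachable (incidenceGraph_adj.2 h3).symm
  exact key l _

theorem incidenceGraph_connected {k : ℕ} (hk : 2 ≤ k) {H : Hypergraph V}
    (hV : H.vertexSet = Set.univ) (hU : H.IsUniform k) (hC : H.IsConnected) :
    H.incidenceGraph.Connected := by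
  obtain ⟨⟨v₀, -⟩, hC⟩ := hC
  rw [SimpleGraph.connected_iff_exists_forall_reachable]
  have hl : ∀ v, H.incidenceGraph.Reachable (.inl v₀) (.inl v) := fun v =>
    (hC v₀ (hV ▸ trivial) v (hV ▸ trivial)).choose_spec.reachable
  refine ⟨.inl v₀, ?_⟩
  rintro (v | e)
  · exact hl v
  · obtain ⟨v, hv⟩ := Set.nonempty_of_ncard_ne_zero (s := e.1) (by rw [hU e.1 e.2]; omega)
    exact (hl v).trans (SimpleGraph.Adj.reachable (incidenceGraph_adj.2 hv))

/-- Vertices occupy the even positions of the cycle and hyperedges the odd ones. -/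
theorem hasCycle_of_isCycle {H : Hypergraph V} {v : V}
    {w : H.incidenceGraph.Walk (.inl v) (.inl v)} (hw : w.IsCycle) : H.HasCycle := by
  have hpar : ∀ i, 2 * i ≤ w.length → ∃ x, w.getVert (2 * i) = .inl x := by
    intro i
    induction i with
    | zero => exact fun _ => ⟨v, by simp⟩
    | succ i ih =>
      intro hi
      obtain ⟨x, hx⟩ := ih (by omega)
      have h1 := w.adj_getVert_succ (i := 2 * i) (by omega)
      have h2 := w.adj_getVert_succ (i := 2 * i + 1) (by omega)
      rw [hx, incidenceGraph_adj_inl] at h1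
      obtain ⟨e, he, _⟩ := h1
      rw [he, incidenceGraph_adj_inr] at h2
      obtain ⟨y, hy, _⟩ := h2
      exact ⟨y, hy⟩
  have hstep : ∀ i, 2 * i < w.length → ∃ e : H.edgeSet, w.getVert (2 * i + 1) = .inr e := by
    intro i hi
    obtain ⟨x, hx⟩ := hpar i hi.le
    have h1 := w.adj_getVert_succ hi
    rw [hx, incidenceGraph_adj_inl] at h1
    exact ⟨_, h1.choose_spec.1⟩
  -- An odd length would put a hyperedge at the end of a closed walk based at a vertex. Being even
  -- and at least 3, the length is at least 4.
  have heven : ∃ p, w.length = 2 * (p + 2) := by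
    have h3 := hw.three_le_length
    rcases Nat.even_or_odd' w.length with ⟨c, hc | hc⟩
    · exact ⟨c - 2, by omega⟩
    · obtain ⟨e, he⟩ := hstep c (by omega)
      rw [← hc, w.getVert_length] at he
      simp at he
  obtain ⟨p, hp⟩ := heven
  choose x hx using fun i : Fin (p + 2) => hpar i.val (by omega)
  choose e he using fun i : Fin (p + 2) => hstep i.val (by omega)
  refine ⟨p, x, fun i => (e i).1, fun i j hij => ?_, fun i j hij => ?_, fun i => ⟨(e i).2, ?_, ?_⟩⟩
  · have := hw.getVert_injOn' (x₁ := 2 * i.val) (x₂ := 2 * j.val) (by simp; omega)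
      (by simp; omega) (by rw [hx, hx, hij])
    exact Fin.ext (by omega)
  · have := hw.getVert_injOn (x₁ := 2 * i.val + 1) (x₂ := 2 * j.val + 1) (by simp; omega)
      (by simp; omega) (by rw [he, he, Subtype.ext hij])
    exact Fin.ext (by omega)
  · have h1 := w.adj_getVert_succ (i := 2 * i.val) (by omega)
    rw [hx, he] at h1
    exact incidenceGraph_adj.1 h1
  · have h1 := w.adj_getVert_succ (i := 2 * i.val + 1) (by omega)
    have h2 : w.getVert (2 * i.val + 1 + 1) = .inl (x (i + 1)) := by
      by_cases hi : i = Fin.last (p + 1)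
      · subst hi
        rw [show 2 * (Fin.last (p + 1)).val + 1 + 1 = w.length by simp; omega, w.getVert_length,
          ← hx]
        simp
      · rw [← hx, Fin.val_add_one_of_lt (Fin.lt_last_iff_ne_last.2 hi)]
        rfl
    rw [h2, he] at h1
    exact incidenceGraph_adj.1 h1.symm

theorem incidenceGraph_isAcyclic {H : Hypergraph V} (h : ¬ H.HasCycle) :
    H.incidenceGraph.IsAcyclic := by
  classical
  rintro (v | e) c hc
  · exact h (hasCycle_of_isCycle hc)
  · have h1 := c.adj_getVert_succ (i := 0) (by have := hc.three_le_length; omega)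
    rw [c.getVert_zero, incidenceGraph_adj_inr] at h1
    obtain ⟨v, hv, _⟩ := h1
    have hm : (.inl v) ∈ c.support := hv ▸ c.getVert_mem_support _
    exact h (hasCycle_of_isCycle (hc.rotate hm))

/-- The incidence graph is a tree with n + m nodes and `k * m` edges. -/
theorem IsHypertree.card_eq [Fintype V] {k : ℕ} (hk : 2 ≤ k) {H : Hypergraph V}
    (hV : H.vertexSet = Set.univ) (hT : H.IsHypertree k) :
    Fintype.card V = H.edgeSet.ncard * (k - 1) + 1 := by
  classical
  obtain ⟨hU, hC, hA⟩ := hT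
  have : Fintype H.edgeSet := Fintype.ofFinite _
  have ht : H.incidenceGraph.IsTree :=
    ⟨incidenceGraph_connected hk hV hU hC, incidenceGraph_isAcyclic hA⟩
  have h1 := ht.card_edgeFinset
  have h2 := H.incidenceGraph.sum_degrees_eq_twice_card_edges
  have hm : Fintype.card H.edgeSet = H.edgeSet.ncard := by
    rw [Set.ncard_eq_toFinset_card', Set.toFinset_card]
  have hl : ∀ v, H.incidenceGraph.degree (.inl v) = H.degree v := fun v => by
    have h3 : H.incidenceGraph.neighborSet (.inl v) = Sum.inr '' {e : H.edgeSet | v ∈ e.1} := by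
      ext b
      rw [SimpleGraph.mem_neighborSet, incidenceGraph_adj_inl]
      exact ⟨fun ⟨e, h1, h2⟩ => ⟨e, h2, h1.symm⟩, fun ⟨e, h1, h2⟩ => ⟨e, h2.symm, h1⟩⟩
    have h4 : {e ∈ H.edgeSet | v ∈ e} = Subtype.val '' {e : H.edgeSet | v ∈ e.1} := by
      ext e
      simp [and_comm]
    rw [← SimpleGraph.card_neighborSet_eq_degree, ← Nat.card_eq_fintype_card,
      Nat.card_coe_set_eq, h3, Set.ncard_image_of_injective _ Sum.inr_injective, degree, h4,
      Set.ncard_image_of_injective _ Subtype.val_injective]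
  have hr : ∀ e, H.incidenceGraph.degree (.inr e) = k := fun e => by
    have h3 : H.incidenceGraph.neighborSet (.inr e) = Sum.inl '' e.1 := by
      ext b
      rw [SimpleGraph.mem_neighborSet, incidenceGraph_adj_inr]
      exact ⟨fun ⟨e, h1, h2⟩ => ⟨e, h2, h1.symm⟩, fun ⟨e, h1, h2⟩ => ⟨e, h2.symm, h1⟩⟩
    rw [← SimpleGraph.card_neighborSet_eq_degree, ← Nat.card_eq_fintype_card,
      Nat.card_coe_set_eq, h3, Set.ncard_image_of_injective _ Sum.inl_injective, hU e.1 e.2]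
  rw [Fintype.sum_sum_type] at h2
  simp only [hl, hr, sum_degree hU] at h2
  rw [Finset.sum_const, Finset.card_univ, smul_eq_mul, hm] at h2
  rw [Fintype.card_sum, hm] at h1
  obtain ⟨k, rfl⟩ : ∃ j, k = j + 1 := ⟨k - 1, by omega⟩
  simp only [Nat.add_sub_cancel]
  nlinarith

end
end Hypergraph

/-! ### Recognising starlike hypertrees -/

namespace Hypergraph

theorem exists_enumeration {V : Type*} {S : Set V} (hS : S.Finite) {N : ℕ} (hN : S.ncard = N)
    {y : V} (hy : y ∈ S) (i : Fin N) : ∃ ν : Fin N → V, Set.range ν = S ∧ ν i = y := by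
  classical
  have : Finite S := hS
  let f : S ≃ Fin N := Finite.equivFinOfCardEq (by rw [Nat.card_coe_set_eq, hN])
  refine ⟨fun r => f.symm (Equiv.swap i (f ⟨y, hy⟩) r), Set.ext fun v => ⟨?_, fun hv => ?_⟩,
    by simp⟩
  · rintro ⟨r, rfl⟩
    exact (f.symm _).2
  · exact ⟨Equiv.swap i (f ⟨y, hy⟩) (f ⟨v, hv⟩), by simp⟩

section
variable {V : Type*} [Fintype V] {k : ℕ}

/-- A hypergraph made of hyperedges `F a j`, attached to each other like the hyperedges of a
starlike hypertree, is starlike as soon as it has the same number of vertices. -/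
theorem iso_starlike (hk : 2 ≤ k) {H : Hypergraph V} (hV : H.vertexSet = Set.univ)
    (hU : H.IsUniform k) (hcov : ∀ v, ∃ e ∈ H.edgeSet, v ∈ e) (L : List ℕ)
    (hm : H.edgeSet.ncard = L.sum) (hcard : Fintype.card V = L.sum * (k - 1) + 1)
    (F : Fin L.length → ℕ → Set V) (B Y : Fin L.length → ℕ → V) (c : V)
    (hF : ∀ a, ∀ j < L.get a, F a j ∈ H.edgeSet)
    (hinj : ∀ a b, ∀ j < L.get a, ∀ i < L.get b, F a j = F b i → a = b ∧ j = i)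
    (hB : ∀ a, ∀ j < L.get a, B a j ∈ F a j) (hY : ∀ a, ∀ j < L.get a, Y a j ∈ F a j)
    (hBY : ∀ a, ∀ j < L.get a, B a j ≠ Y a j) (hB0 : ∀ a, B a 0 = c)
    (hBs : ∀ a j, j + 1 < L.get a → B a (j + 1) = Y a j) :
    H.Iso (starlike k L) := by
  classical
  have hν : ∀ a, ∀ j : Fin (L.get a), ∃ ν : Fin (k - 1) → V,
      Set.range ν = F a j \ {B a j} ∧ ν ⟨k - 2, by omega⟩ = Y a j := fun a j => by
    have hmem : Y a j ∈ F a j \ {B a j} := ⟨hY a j j.2, (hBY a j j.2).symm⟩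
    exact exists_enumeration (Set.toFinite _)
      (by rw [Set.ncard_sdiff_singleton_of_mem (hB a j j.2), hU _ (hF a j j.2)]) hmem _
  choose ν hν hνY using hν
  let ψ : StarlikeVertex k L → V := fun v => v.elim c fun x => ν x.1 x.2.1 x.2.2
  have himg : ∀ a j, ψ '' starlikeEdge k L a j = F a j := by
    intro a j
    rw [← Set.insert_sdiff_self_of_mem (hB a j j.2), ← hν]
    ext v
    constructor
    · rintro ⟨_, ⟨rfl, h⟩ | ⟨r, rfl⟩ | ⟨i, r, rfl, h1, h2⟩, rfl⟩
      · left; rw [h, hB0]; rfl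
      · right; exact ⟨r, rfl⟩
      · left
        have hr : r = ⟨k - 2, by omega⟩ := Fin.ext (by simp only; omega)
        have := hBs a i (by omega)
        rw [← h1, this, ← hνY, hr]
        rfl
    · rintro (rfl | ⟨r, rfl⟩)
      · rcases hj : j.val with _ | i
        · exact ⟨none, Or.inl ⟨rfl, hj⟩, (hB0 a).symm⟩
        · refine ⟨_, last_mem_starlikeEdge hk a ⟨i, by omega⟩ j hj.symm, ?_⟩
          rw [hBs a i (by omega)]
          exact hνY a ⟨i, by omega⟩
      · exact ⟨_, some_mem_starlikeEdge a j r, rfl⟩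
  have hall : ∀ e ∈ H.edgeSet, ∃ a, ∃ j : Fin (L.get a), e = F a j := by
    have hs : Set.range (fun x : Σ a : Fin L.length, Fin (L.get a) => F x.1 x.2) = H.edgeSet := by
      refine Set.eq_of_subset_of_ncard_le ?_ ?_ (Set.toFinite _)
      · rintro _ ⟨x, rfl⟩
        exact hF _ _ x.2.2
      · rw [← Set.image_univ, Set.ncard_image_of_injective, Set.ncard_univ,
          Nat.card_eq_fintype_card, Fintype.card_sigma, hm]
        · simp
        · rintro ⟨a, j⟩ ⟨b, i⟩ h
          obtain ⟨rfl, h2⟩ := hinj a b j j.2 i i.2 h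
          rw [Fin.ext h2]
    intro e he
    rw [← hs] at he
    obtain ⟨x, rfl⟩ := he
    exact ⟨x.1, x.2, rfl⟩
  have hsurj : Function.Surjective ψ := by
    intro v
    obtain ⟨e, he, hv⟩ := hcov v
    obtain ⟨a, j, rfl⟩ := hall e he
    rw [← himg] at hv
    exact ⟨hv.choose, hv.choose_spec.2⟩
  -- The count of vertices turns surjectivity into bijectivity, so it need not be checked that the
  -- hyperedges meet only where they are attached.
  have hbij : Function.Bijective ψ :=
    (Fintype.bijective_iff_surjective_and_card ψ).2 ⟨hsurj, by rw [starlikeVertex_card, hcard]⟩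
  let φ := Equiv.ofBijective ψ hbij
  have hφ : ∀ a (j : Fin (L.get a)), φ.symm '' F a j = starlikeEdge k L a j := fun a j => by
    rw [← himg, ← Set.image_comp]
    have : (φ.symm ∘ ψ) = id := funext fun v => φ.symm_apply_apply v
    rw [this, Set.image_id]
  refine ⟨φ.symm, Hypergraph.ext ?_ ?_⟩
  · change φ.symm '' H.vertexSet = Set.univ
    rw [hV, Set.image_univ, φ.symm.surjective.range_eq]
  · change Set.image φ.symm '' H.edgeSet = _
    ext e
    constructor
    · rintro ⟨e, he, rfl⟩
      obtain ⟨a, j, rfl⟩ := hall e he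
      exact ⟨a, j, hφ a j⟩
    · rintro ⟨a, j, rfl⟩
      exact ⟨_, hF a j j.2, hφ a j⟩

end

/-! ### Degrees along a path -/

section
variable {V : Type*} {k : ℕ}

/-- `x₀, …, x_d` and `e₀, …, e_{d-1}` are the vertices and hyperedges of a path. -/
structure IsPath (H : Hypergraph V) (x : ℕ → V) (e : ℕ → Set V) (d : ℕ) : Prop where
  vertex_inj : ∀ i ≤ d, ∀ j ≤ d, x i = x j → i = j
  edge_inj : ∀ i < d, ∀ j < d, e i = e j → i = j
  edge_mem : ∀ i < d, e i ∈ H.edgeSet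
  left_mem : ∀ i < d, x i ∈ e i
  right_mem : ∀ i < d, x (i + 1) ∈ e i

theorem HasPath.exists_isPath {H : Hypergraph V} {u v : V} {d : ℕ} (h : H.HasPath u v d) :
    ∃ x e, H.IsPath x e d := by
  obtain ⟨x, e, hx, he, _, _, _, h⟩ := h
  refine ⟨fun i => x ⟨min i d, by omega⟩, fun i => if hi : i < d then e ⟨i, hi⟩ else ∅, ?_, ?_, ?_,
    ?_, ?_⟩
  · intro i hi j hj hij
    have := congrArg Fin.val (hx hij)
    simp only at this
    omega
  · intro i hi j hj hij
    simp only [hi, hj, dif_pos] at hij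
    exact congrArg Fin.val (he hij)
  · intro i hi
    simp only [hi, dif_pos]
    exact (h ⟨i, hi⟩).1
  · intro i hi
    simp only [hi, dif_pos]
    convert (h ⟨i, hi⟩).2.1
    simp; omega
  · intro i hi
    simp only [hi, dif_pos]
    convert (h ⟨i, hi⟩).2.2
    simp; omega

theorem HasDiameter.exists_isPath {H : Hypergraph V} (hC : H.IsConnected) {d : ℕ}
    (h : H.HasDiameter d) : ∃ x e, H.IsPath x e d := by
  obtain ⟨⟨u, hu, v, hv, rfl⟩, _⟩ := h
  exact HasPath.exists_isPath (Nat.sInf_mem (s := {l | H.HasPath u v l}) (hC.2 u hu v hv))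

namespace IsPath
variable {H : Hypergraph V} {x : ℕ → V} {e : ℕ → Set V} {d : ℕ}

theorem reverse (h : H.IsPath x e d) :
    H.IsPath (fun i => x (d - i)) (fun i => e (d - 1 - i)) d where
  vertex_inj i hi j hj hij := by have := h.vertex_inj _ (by omega) _ (by omega) hij; omega
  edge_inj i hi j hj hij := by have := h.edge_inj _ (by omega) _ (by omega) hij; omega
  edge_mem i hi := h.edge_mem _ (by omega)
  left_mem i hi := by
    have := h.right_mem (d - 1 - i) (by omega)
    rwa [show d - 1 - i + 1 = d - i by omega] at this
  right_mem i hi := by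
    have := h.left_mem (d - 1 - i) (by omega)
    rwa [show d - 1 - i = d - (i + 1) by omega] at this ⊢

/-- The cycle consists of `x i, …, x j` and `e i, …, e j`, closed up by `x i ∈ e j`; its length is
`j - i + 1 = (j - i - 1) + 2`. -/
theorem hasCycle_of_mem (h : H.IsPath x e d) {i j : ℕ} (hij : i < j) (hj : j < d)
    (hm : x i ∈ e j) : H.HasCycle := by
  refine ⟨j - i - 1, fun a => x (i + a), fun a => e (i + a), fun a b hab => ?_, fun a b hab => ?_,
    fun a => ⟨h.edge_mem _ (by omega), h.left_mem _ (by omega), ?_⟩⟩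
  · have := h.vertex_inj _ (by omega) _ (by omega) hab
    exact Fin.ext (by omega)
  · have := h.edge_inj _ (by omega) _ (by omega) hab
    exact Fin.ext (by omega)
  · by_cases ha : a = Fin.last (j - i - 1 + 1)
    · subst ha
      simp only [Fin.last_add_one, Fin.val_zero, add_zero, Fin.val_last]
      rwa [show i + (j - i - 1 + 1) = j by omega]
    · simp only [Fin.val_add_one_of_lt (Fin.lt_last_iff_ne_last.2 ha)]
      exact h.right_mem _ (by omega)

/-- Any other incidence along the path would close a cycle, after reversing the path if the
hyperedge comes before the vertex. -/
theorem eq_or_eq_of_mem (h : H.IsPath x e d) (hA : ¬ H.HasCycle) {i j : ℕ} (hi : i ≤ d)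
    (hj : j < d) (hm : x i ∈ e j) : j = i ∨ j + 1 = i := by
  rcases lt_trichotomy i j with hij | hij | hij
  · exact absurd (h.hasCycle_of_mem hij hj hm) hA
  · exact Or.inl hij.symm
  · by_contra hne
    refine hA (h.reverse.hasCycle_of_mem (i := d - i) (j := d - 1 - j) (by omega) (by omega) ?_)
    rwa [show d - (d - i) = i by omega, show d - 1 - (d - 1 - j) = j by omega]

end IsPath

end

section
variable {V : Type*} [Fintype V] {k m d : ℕ}

/-- A hypertree in which all hyperedges outside a path of length `d` contain the vertex `x_q` of
the path is starlike. -/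
theorem IsHypertree.iso_starlike (hk : 2 ≤ k) {H : Hypergraph V} (hV : H.vertexSet = Set.univ)
    (hT : H.IsHypertree k) (hm : H.edgeSet.ncard = m) (hdm : d ≤ m)
    (hcov : ∀ v, ∃ e ∈ H.edgeSet, v ∈ e)
    {x : ℕ → V} {e : ℕ → Set V} (h : H.IsPath x e d) {q : ℕ} (hq : 0 < q) (hqd : q < d)
    (hdeg : H.degree (x q) = m - d + 2) :
    H.Iso (starlike k (armList q (d - q) (m - d))) := by
  classical
  have hne : e (q - 1) ≠ e q := fun h1 => by
    have := h.edge_inj _ (by omega) _ hqd h1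
    omega
  have hr : x q ∈ e (q - 1) := by
    have := h.right_mem (q - 1) (by omega)
    rwa [show q - 1 + 1 = q by omega] at this
  obtain ⟨g, hg, hgi⟩ : ∃ g : ℕ → Set V, (∀ i < m - d, g i ∈ H.edgeSet ∧ x q ∈ g i ∧
      g i ≠ e (q - 1) ∧ g i ≠ e q) ∧ ∀ i < m - d, ∀ j < m - d, g i = g j → i = j := by
    let S : Set (Set V) := {f ∈ H.edgeSet | x q ∈ f} \ {e (q - 1), e q}
    have hS : S.ncard = m - d := by
      rw [Set.ncard_sdiff (by
        rintro f (rfl | rfl)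
        · exact ⟨h.edge_mem _ (by omega), hr⟩
        · exact ⟨h.edge_mem _ hqd, h.left_mem _ hqd⟩) (Set.toFinite _), Set.ncard_pair hne]
      exact (congrArg (· - 2) hdeg).trans (by simp)
    let f : S ≃ Fin (m - d) := Finite.equivFinOfCardEq (by rw [Nat.card_coe_set_eq, hS])
    refine ⟨fun i => if hi : i < m - d then (f.symm ⟨i, hi⟩).1 else ∅, fun i hi => ?_,
      fun i hi j hj hij => ?_⟩
    · simp only [hi, dif_pos]
      obtain ⟨⟨h1, h2⟩, h3⟩ := (f.symm ⟨i, hi⟩).2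
      exact ⟨h1, h2, fun h4 => h3 (Or.inl h4), fun h4 => h3 (Or.inr h4)⟩
    · simp only [hi, hj, dif_pos] at hij
      exact congrArg Fin.val (f.symm.injective (Subtype.ext hij))
  -- The only hyperedges of the path through `x q` are `e (q - 1)` and `e q`, so the remaining `m -
  -- d` at `x q` lie off the path and complete the count of `m`.
  have hge : ∀ i < m - d, ∀ j < d, g i ≠ e j := by
    intro i hi j hj hij
    obtain ⟨_, h2, h3, h4⟩ := hg i hi
    rcases h.eq_or_eq_of_mem hT.2.2 hqd.le hj (hij ▸ h2) with rfl | h5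
    · exact h4 hij
    · exact h3 (by rw [hij, ← h5]; rfl)
  have hz : ∀ i, ∃ z, i < m - d → z ∈ g i ∧ x q ≠ z := by
    intro i
    by_cases hi : i < m - d
    · obtain ⟨z, hz, hzq⟩ := Set.exists_ne_of_one_lt_ncard
        (by rw [hT.1 _ (hg i hi).1]; omega : 1 < (g i).ncard) (x q)
      exact ⟨z, fun _ => ⟨hz, hzq.symm⟩⟩
    · exact ⟨x q, fun h => absurd h hi⟩
  choose z hz using hz
  have hlen : (armList q (d - q) (m - d)).length = m - d + 2 := by simp
  have hsum : (armList q (d - q) (m - d)).sum = m := by rw [armList_sum]; omega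
  -- Arm 0 runs backwards along the path from `x q`, arm 1 forwards, and each further arm is one
  -- hyperedge `g i`, whose far vertex `z i` is arbitrary.
  refine Hypergraph.iso_starlike hk hV hT.1 hcov _ (hm.trans hsum.symm)
    (by rw [hsum, ← hm]; exact hT.card_eq hk hV)
    (fun a j => if a.val = 0 then e (q - 1 - j) else if a.val = 1 then e (q + j) else g (a.val - 2))
    (fun a j => if a.val = 0 then x (q - j) else if a.val = 1 then x (q + j) else x q)
    (fun a j => if a.val = 0 then x (q - 1 - j) else if a.val = 1 then x (q + j + 1)
      else z (a.val - 2)) (x q) ?_ ?_ ?_ ?_ ?_ ?_ ?_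
  all_goals try simp only [armList_get]
  · intro a j hj
    split_ifs at hj ⊢
    · exact h.edge_mem _ (by omega)
    · exact h.edge_mem _ (by omega)
    · exact (hg _ (by omega)).1
  · intro a b j hj i hi heq
    rw [Fin.ext_iff]
    split_ifs at hj hi heq
    · have := h.edge_inj _ (by omega) _ (by omega) heq
      omega
    · have := h.edge_inj _ (by omega) _ (by omega) heq
      omega
    · exact absurd heq.symm (hge _ (by omega) _ (by omega))
    · have := h.edge_inj _ (by omega) _ (by omega) heq
      omega
    · have := h.edge_inj _ (by omega) _ (by omega) heq
      omega
    · exact absurd heq.symm (hge _ (by omega) _ (by omega))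
    · exact absurd heq (hge _ (by omega) _ (by omega))
    · exact absurd heq (hge _ (by omega) _ (by omega))
    · have := hgi _ (by omega) _ (by omega) heq
      omega
  · intro a j hj
    split_ifs at hj ⊢
    · have := h.right_mem (q - 1 - j) (by omega)
      rwa [show q - 1 - j + 1 = q - j by omega] at this
    · exact h.left_mem _ (by omega)
    · exact (hg _ (by omega)).2.1
  · intro a j hj
    split_ifs at hj ⊢
    · exact h.left_mem _ (by omega)
    · exact h.right_mem _ (by omega)
    · exact (hz _ (by omega)).1
  · intro a j hj
    split_ifs at hj ⊢
    · intro heq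
      have := h.vertex_inj _ (by omega) _ (by omega) heq
      omega
    · intro heq
      have := h.vertex_inj _ (by omega) _ (by omega) heq
      omega
    · exact (hz _ (by omega)).2
  · intro a
    simp
  · intro a j hj
    split_ifs at hj ⊢
    · rw [show q - (j + 1) = q - 1 - j by omega]
    · rfl
    · omega

end
end Hypergraph

/-! ### Sums of squares of degrees -/

namespace Hypergraph

section
variable {V : Type*} {k m d : ℕ}

theorem IsHypertree.exists_mem (hk : 2 ≤ k) {H : Hypergraph V} (hV : H.vertexSet = Set.univ)
    (hT : H.IsHypertree k) (hm : 0 < H.edgeSet.ncard) (v : V) : ∃ e ∈ H.edgeSet, v ∈ e := by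
  obtain ⟨e, he⟩ := Set.nonempty_of_ncard_ne_zero hm.ne'
  obtain ⟨z, hz, hzv⟩ := Set.exists_ne_of_one_lt_ncard (by rw [hT.1 e he]; omega : 1 < e.ncard) v
  obtain ⟨l, x, f, _, _, rfl, rfl, _, h⟩ := hT.2.1.2 v (hV ▸ trivial) z (hV ▸ trivial)
  rcases l with _ | l
  · exact absurd rfl hzv
  · exact ⟨f 0, (h 0).1, (h 0).2.1⟩

variable [Fintype V]

theorem one_le_degree {H : Hypergraph V} {v : V} (h : ∃ e ∈ H.edgeSet, v ∈ e) : 1 ≤ H.degree v :=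
  (Set.ncard_pos (Set.toFinite _)).2 ⟨h.choose, h.choose_spec⟩

theorem IsPath.two_le_degree {H : Hypergraph V} {x : ℕ → V} {e : ℕ → Set V} (h : H.IsPath x e d)
    {i : ℕ} (hi : 0 < i) (hid : i < d) : 2 ≤ H.degree (x i) := by
  have hr := h.right_mem (i - 1) (by omega)
  rw [show i - 1 + 1 = i by omega] at hr
  refine (Set.one_lt_ncard (Set.toFinite _)).2 ⟨e (i - 1), ⟨h.edge_mem _ (by omega), hr⟩, e i,
    ⟨h.edge_mem _ hid, h.left_mem _ hid⟩, fun heq => ?_⟩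
  have := h.edge_inj _ (by omega) _ hid heq
  omega

/-- The degrees of a hypertree exceed those forced by a path of length `d` by `m - d` in total. -/
theorem IsHypertree.exists_excess (hk : 2 ≤ k) {H : Hypergraph V} (hV : H.vertexSet = Set.univ)
    (hT : H.IsHypertree k) (hm : H.edgeSet.ncard = m) (hd : 2 ≤ d) (hdm : d ≤ m)
    {x : ℕ → V} {e : ℕ → Set V} (h : H.IsPath x e d) :
    ∃ (I : Finset V) (b c : V → ℕ), (∀ v, v ∈ I ↔ ∃ i, 0 < i ∧ i < d ∧ x i = v) ∧
      (∀ v, c v = 1 ∧ v ∈ I ∨ c v = 0 ∧ v ∉ I) ∧ (∀ v, H.degree v = 1 + c v + b v) ∧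
      ∑ v, c v = d - 1 ∧ ∑ v, b v = m - d := by
  classical
  let I : Finset V := (Finset.Ioo 0 d).image x
  have hI : ∀ v, v ∈ I ↔ ∃ i, 0 < i ∧ i < d ∧ x i = v := fun v => by
    simp [I, and_assoc]
  have hcard : I.card = d - 1 := by
    rw [Finset.card_image_of_injOn, Nat.card_Ioo]
    · rfl
    · intro i hi j hj hij
      simp only [Finset.coe_Ioo, Set.mem_Ioo] at hi hj
      exact h.vertex_inj _ hi.2.le _ hj.2.le hij
  have hc : ∑ v, (if v ∈ I then 1 else 0) = d - 1 := by
    rw [Finset.sum_ite_mem, Finset.univ_inter, Finset.sum_const, hcard, smul_eq_mul, mul_one]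
  have hdeg : ∀ v, H.degree v = 1 + (if v ∈ I then 1 else 0) +
      (H.degree v - 1 - if v ∈ I then 1 else 0) := by
    intro v
    have h1 := one_le_degree (hT.exists_mem hk hV (by omega) v)
    split_ifs with hv
    · obtain ⟨i, hi, hid, rfl⟩ := (hI v).1 hv
      have := h.two_le_degree hi hid
      omega
    · omega
  refine ⟨I, fun v => H.degree v - 1 - if v ∈ I then 1 else 0, fun v => if v ∈ I then 1 else 0, hI,
    fun v => ?_, hdeg, hc, ?_⟩
  · by_cases hv : v ∈ I <;> simp [hv]
  -- The degrees sum to `k * m`, so the excess is `k * m - n - (d - 1) = m - d`.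
  · have h1 := sum_degree hT.1
    rw [Finset.sum_congr rfl fun v _ => hdeg v, Finset.sum_add_distrib, Finset.sum_add_distrib, hc,
      Finset.sum_const, Finset.card_univ, hT.card_eq hk hV, hm, smul_eq_mul, mul_one] at h1
    obtain ⟨k, rfl⟩ : ∃ j, k = j + 1 := ⟨k - 1, by omega⟩
    simp only [Nat.add_sub_cancel, add_mul, one_mul] at h1 ⊢
    rw [mul_comm k m] at h1
    omega

theorem sum_sq_le_of_sum_eq {b : V → ℕ} {s : ℕ} (hb : ∑ v, b v = s) : ∑ v, b v ^ 2 ≤ s ^ 2 := by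
  rw [← hb]
  rw [sq, Finset.sum_mul]
  refine Finset.sum_le_sum fun v _ => ?_
  rw [sq]
  exact Nat.mul_le_mul_left _ (Finset.single_le_sum (fun _ _ => Nat.zero_le _) (Finset.mem_univ v))

/-- Each `b v` is at most `s`. If none equals `s`, then `b v ^ 2 ≤ b v * s`, strictly wherever `b v`
is nonzero. -/
theorem exists_eq_of_sum_sq_eq {b : V → ℕ} {s : ℕ} (hs : 0 < s) (hb : ∑ v, b v = s)
    (h : ∑ v, b v ^ 2 = s ^ 2) : ∃ v, b v = s := by
  have hle : ∀ v, b v ≤ s := fun v => hb ▸ Finset.single_le_sum (fun _ _ => Nat.zero_le _)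
    (Finset.mem_univ v)
  by_contra hne
  push Not at hne
  have hlt : ∑ v, b v ^ 2 < ∑ v, b v * s := by
    obtain ⟨v, _, hv⟩ := Finset.exists_ne_zero_of_sum_ne_zero (hb ▸ hs.ne')
    refine Finset.sum_lt_sum (fun v _ => ?_) ⟨v, Finset.mem_univ _, ?_⟩
    · rw [sq]; exact Nat.mul_le_mul_left _ (hle v)
    · rw [sq]; exact Nat.mul_lt_mul_of_pos_left ((hle v).lt_of_ne (hne v)) (Nat.pos_of_ne_zero hv)
  rw [← Finset.sum_mul, hb, h, sq] at hlt
  exact lt_irrefl _ hlt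

/-- The largest sum of squares of degrees. -/
def maxSumSq (k m d : ℕ) : ℕ := m * (k - 1) + 1 + 3 * (d - 1) + 4 * (m - d) + (m - d) ^ 2

/-- Squares reward concentration of the excess `b`, and excess on the interior of the path counts
more than elsewhere. The last clause identifies the maximizers by one degree: since `b ≤ m - d` and
`c ≤ 1`, degree `m - d + 2` means that both are attained at one vertex. -/
theorem IsHypertree.sum_degree_sq (hk : 2 ≤ k) {H : Hypergraph V} (hV : H.vertexSet = Set.univ)
    (hT : H.IsHypertree k) (hm : H.edgeSet.ncard = m) (hd : 2 ≤ d) (hdm : d ≤ m)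
    {x : ℕ → V} {e : ℕ → Set V} (h : H.IsPath x e d) :
    ∑ v, H.degree v ^ 2 ≤ maxSumSq k m d ∧
      (∑ v, H.degree v ^ 2 = maxSumSq k m d →
        ∃ q, 0 < q ∧ q < d ∧ H.degree (x q) = m - d + 2) ∧
      ∀ v, H.degree v = m - d + 2 → ∑ v, H.degree v ^ 2 = maxSumSq k m d := by
  classical
  obtain ⟨I, b, c, hI, hc, hdeg, hcs, hbs⟩ := hT.exists_excess hk hV hm hd hdm h
  have hcard : Fintype.card V = m * (k - 1) + 1 := hm ▸ hT.card_eq hk hV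
  -- As `c` is 0 or 1, `(1 + c + b)^2 = 1 + 3c + 4b + b^2 - 2b(1 - c)`; the subtracted term is moved
  -- to the left to stay in `ℕ`.
  have hsq : ∑ v, H.degree v ^ 2 + 2 * ∑ v, b v * (1 - c v) = m * (k - 1) + 1 + 3 * (d - 1) +
      4 * (m - d) + ∑ v, b v ^ 2 := by
    rw [← hcs, ← hbs, ← hcard, ← Finset.card_univ, Finset.card_eq_sum_ones, Finset.mul_sum,
      Finset.mul_sum, Finset.mul_sum, ← Finset.sum_add_distrib, ← Finset.sum_add_distrib,
      ← Finset.sum_add_distrib, ← Finset.sum_add_distrib]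
    refine Finset.sum_congr rfl fun v _ => ?_
    rw [hdeg v]
    rcases hc v with ⟨h1, _⟩ | ⟨h1, _⟩ <;> rw [h1] <;>
      simp only [Nat.sub_self, Nat.sub_zero] <;> ring
  have hble := sum_sq_le_of_sum_eq hbs
  refine ⟨?_, fun heq => ?_, fun v hv => ?_⟩
  · rw [maxSumSq]; omega
  · rw [maxSumSq] at heq
    have h1 : ∑ v, b v ^ 2 = (m - d) ^ 2 := by omega
    have h2 : ∑ v, b v * (1 - c v) = 0 := by omega
    -- Without excess any interior vertex will do; `x 1` is one because `d ≥ 2`.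
    rcases Nat.eq_zero_or_pos (m - d) with h0 | hpos
    · rw [h0] at hbs
      refine ⟨1, one_pos, by omega, ?_⟩
      have h3 := (Finset.sum_eq_zero_iff.1 hbs) (x 1) (Finset.mem_univ _)
      rcases hc (x 1) with ⟨h4, _⟩ | ⟨_, h4⟩
      · rw [hdeg, h3, h4]; omega
      · exact absurd ((hI _).2 ⟨1, one_pos, by omega, rfl⟩) h4
    · obtain ⟨v, hv⟩ := exists_eq_of_sum_sq_eq hpos hbs h1
      have h3 := (Finset.sum_eq_zero_iff.1 h2) v (Finset.mem_univ _)
      rcases hc v with ⟨h4, h5⟩ | ⟨h4, _⟩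
      · obtain ⟨q, hq, hqd, rfl⟩ := (hI v).1 h5
        exact ⟨q, hq, hqd, by rw [hdeg, h4, hv]; omega⟩
      · rw [h4, hv] at h3
        omega
  · have hle : b v ≤ m - d := hbs ▸ Finset.single_le_sum (fun _ _ => Nat.zero_le _)
      (Finset.mem_univ v)
    rw [hdeg] at hv
    have hcv : c v = 1 := by rcases hc v with h | h <;> omega
    have hbv : b v = m - d := by omega
    have h0 : ∀ w, w ≠ v → b w = 0 := by
      rw [← Finset.add_sum_erase _ _ (Finset.mem_univ v), hbv] at hbs
      have h1 : ∑ w ∈ Finset.univ.erase v, b w = 0 := by omega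
      exact fun w hw => Finset.sum_eq_zero_iff.1 h1 w (by simp [hw])
    have h1 : ∑ w, b w * (1 - c w) = 0 := Finset.sum_eq_zero fun w _ => by
      by_cases hw : w = v
      · rw [hw, hcv, Nat.sub_self, mul_zero]
      · rw [h0 w hw, zero_mul]
    rw [h1, Fintype.sum_eq_single (f := fun w => b w ^ 2) v fun w hw => by simp [h0 w hw],
      hbv] at hsq
    rw [maxSumSq]
    simpa using hsq

end

section
variable {k m d : ℕ}

theorem starlike_degree_none (p q s : ℕ) (hp : 0 < p) (hq : 0 < q) (hk : 2 ≤ k) :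
    (starlike k (armList p q s)).degree none = s + 2 := by
  have hpos : ∀ a, 0 < (armList p q s).get a := fun a => by
    rw [armList_get]; split_ifs <;> omega
  have h : {e ∈ (starlike k (armList p q s)).edgeSet | none ∈ e} =
      Set.range fun a => starlikeEdge k (armList p q s) a ⟨0, hpos a⟩ := by
    ext e
    constructor
    · rintro ⟨⟨a, j, rfl⟩, ⟨_, h⟩ | ⟨_, h⟩ | ⟨_, _, h, _⟩⟩
      · exact ⟨a, congrArg _ (Fin.ext h.symm)⟩
      · simp at h
      · simp at h
    · rintro ⟨a, rfl⟩
      exact ⟨⟨a, _, rfl⟩, Or.inl ⟨rfl, rfl⟩⟩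
  rw [degree, h, ← Set.image_univ, Set.ncard_image_of_injective, Set.ncard_univ,
    Nat.card_eq_fintype_card, Fintype.card_fin]
  · simp
  · intro a b hab
    exact congrArg Sigma.fst (starlikeEdge_injective hk (a₁ := ⟨a, 0, hpos a⟩)
      (a₂ := ⟨b, 0, hpos b⟩)
      hab)

/-- The centre has degree `m - d + 2`, which alone characterizes the maximum. -/
theorem starlike_sum_degree_sq (hk : 2 ≤ k) {p : ℕ} (hp : 0 < p) (hpd : p < d) (hdm : d ≤ m) :
    ∑ v, (starlike k (armList p (d - p) (m - d))).degree v ^ 2 = maxSumSq k m d := by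
  obtain ⟨x, e, h⟩ := HasDiameter.exists_isPath (starlike_isHypertree hk).2.1
    (armList_hasDiameter (k := k) hk (m - d) hp (by omega : 0 < d - p))
  rw [show p + (d - p) = d by omega] at h
  exact ((starlike_isHypertree hk).sum_degree_sq hk rfl (by
    rw [starlike_edgeSet_ncard hk, armList_sum]; omega) (by omega) hdm h).2.2 none
    (starlike_degree_none _ _ _ hp (by omega) hk)

/-- A hypertree with the largest sum of squares of degrees is starlike. -/
theorem IsHypertree.exists_iso_starlike {V : Type*} [Fintype V] (hk : 2 ≤ k) {H : Hypergraph V}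
    (hV : H.vertexSet = Set.univ) (hT : H.IsHypertree k) (hm : H.edgeSet.ncard = m) (hd : 2 ≤ d)
    (hdm : d ≤ m) {x : ℕ → V} {e : ℕ → Set V} (h : H.IsPath x e d)
    (hs : ∑ v, H.degree v ^ 2 = maxSumSq k m d) :
    ∃ p, 0 < p ∧ p ≤ d / 2 ∧ H.Iso (starlike k (armList p (d - p) (m - d))) := by
  have hcov := hT.exists_mem hk hV (by omega)
  obtain ⟨q, hq, hqd, hdeg⟩ := (hT.sum_degree_sq hk hV hm hd hdm h).2.1 hs
  by_cases hq2 : q ≤ d / 2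
  · exact ⟨q, hq, hq2, hT.iso_starlike hk hV hm hdm hcov h hq hqd hdeg⟩
  -- Reading the path backwards exchanges the two long arms.
  · refine ⟨d - q, by omega, by omega, hT.iso_starlike hk hV hm hdm hcov h.reverse (by omega)
      (by omega) ?_⟩
    rwa [show d - (d - q) = q by omega]

/-- Hyperpaths are starlike in several ways. -/
theorem starlike_path_iso (hk : 2 ≤ k) {p q : ℕ} (hp : 0 < p) (hpd : p < d) (hq : 0 < q)
    (hqd : q < d) : (starlike k (armList p (d - p) 0)).Iso (starlike k (armList q (d - q) 0)) := by
  have hT := starlike_isHypertree (L := armList p (d - p) 0) hk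
  obtain ⟨x, e, h⟩ := HasDiameter.exists_isPath hT.2.1
    (armList_hasDiameter (k := k) hk 0 hp (by omega : 0 < d - p))
  rw [show p + (d - p) = d by omega] at h
  have hm : (starlike k (armList p (d - p) 0)).edgeSet.ncard = d := by
    rw [starlike_edgeSet_ncard hk, armList_sum]; omega
  obtain ⟨I, b, c, hI, hc, hdeg, _, hbs⟩ := hT.exists_excess hk rfl hm (by omega) le_rfl h
  -- For `m = d` there is no excess, so every interior vertex `x q` has degree 2 and may serve as
  -- the centre.
  have h1 := hT.iso_starlike (m := d) hk rfl hm le_rfl (hT.exists_mem hk rfl (by omega)) h hq hqd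
    (by
      rw [Nat.sub_self] at hbs ⊢
      rw [hdeg, Finset.sum_eq_zero_iff.1 hbs _ (Finset.mem_univ _)]
      rcases hc (x q) with ⟨h4, _⟩ | ⟨_, h4⟩
      · rw [h4]; rfl
      · exact absurd ((hI _).2 ⟨q, hq, hqd, rfl⟩) h4)
  rwa [Nat.sub_self] at h1

end
end Hypergraph

/-! ### Comparison of spectral moments -/

namespace Hypergraph

open Tensor

theorem Iso.trans {U V W : Type*} {H : Hypergraph U} {H' : Hypergraph V} {H'' : Hypergraph W}
    (h : H.Iso H') (h' : H'.Iso H'') : H.Iso H'' := by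
  obtain ⟨φ, rfl⟩ := h
  obtain ⟨ψ, rfl⟩ := h'
  refine ⟨φ.trans ψ, Hypergraph.ext ?_ ?_⟩
  · change (ψ ∘ φ) '' H.vertexSet = ψ '' (φ '' H.vertexSet)
    rw [Set.image_comp]
  · change Set.image (ψ ∘ φ) '' H.edgeSet = Set.image ψ '' (Set.image φ '' H.edgeSet)
    rw [Set.image_image]
    exact Set.image_congr fun e _ => Set.image_comp ψ φ e

section
variable {V W : Type*} [Fintype V] [DecidableEq V] [Fintype W] [DecidableEq W] {k : ℕ} {α : ℝ}

theorem Before.not_momentEq {H : Hypergraph V} {H' : Hypergraph W} (h : H.Before k α H') :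
    ¬ H.MomentEq k α H' := fun h' => by
  obtain ⟨_, d, _, hd, _, hlt⟩ := h
  exact hlt.ne (h'.2 d hd)

theorem lt_card_mul_pow (hk : 2 ≤ k) {N : ℕ} (hN : N < Fintype.card V) :
    N < Fintype.card V * (k - 1) ^ (Fintype.card V - 1) :=
  hN.trans_le (Nat.le_mul_of_pos_right _ (Nat.pow_pos (by omega)))

theorem before_of_circuitSum (hk : 2 ≤ k) {H : Hypergraph V} {H' : Hypergraph W}
    (hcard : Fintype.card V = Fintype.card W) {N : ℕ} (hN : 1 ≤ N) (hNV : N < Fintype.card V)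
    (heq : ∀ i < N, 0 < i → circuitSum (H.alphaTensor k α) i = circuitSum (H'.alphaTensor k α) i)
    (hlt : circuitSum (H.alphaTensor k α) N < circuitSum (H'.alphaTensor k α) N) :
    H.Before k α H' := by
  refine ⟨hcard, N, hN, lt_card_mul_pow hk hNV, fun i hi => ?_, ?_⟩
  · rcases Nat.eq_zero_or_pos i with rfl | hi0
    · rw [moment_zero, moment_zero, hcard]
    · rw [moment_eq_circuitSum hk _ _ hi0, moment_eq_circuitSum hk _ _ hi0, heq i hi hi0, hcard]
  · rw [moment_eq_circuitSum hk _ _ hN, moment_eq_circuitSum hk _ _ hN, hcard]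
    have : 0 < ((k - 1 : ℕ) : ℝ) := Nat.cast_pos.2 (by omega)
    exact mul_lt_mul_of_pos_left hlt (by positivity)

/-- Orders 0 and 1 and the extra term in order 2 depend only on the numbers of vertices and
hyperedges. -/
theorem before_of_sum_degree_sq_lt (hk : 2 ≤ k) (hα : 0 < α) {H : Hypergraph V} {H' : Hypergraph W}
    (hU : H.IsUniform k) (hU' : H'.IsUniform k) (hcard : Fintype.card V = Fintype.card W)
    (hV : 2 < Fintype.card V) (hE : H.edgeSet.ncard = H'.edgeSet.ncard)
    (hlt : ∑ v, H.degree v ^ 2 < ∑ v, H'.degree v ^ 2) : H.Before k α H' := by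
  refine before_of_circuitSum hk hcard one_le_two hV (fun i hi hi0 => ?_) ?_
  · obtain rfl : i = 1 := by omega
    rw [circuitSum_alphaTensor_one hk α hU, circuitSum_alphaTensor_one hk α hU', hE]
  · rw [circuitSum_alphaTensor_two hk α hU, circuitSum_alphaTensor_two hk α hU', hE]
    have : ((∑ v, H.degree v ^ 2 : ℕ) : ℝ) < (∑ v, H'.degree v ^ 2 : ℕ) := Nat.cast_lt.2 hlt
    gcongr

theorem Iso.before {U : Type*} [Fintype U] [DecidableEq U] (hk : 2 ≤ k) {G : Hypergraph U}
    {H : Hypergraph V} {H' : Hypergraph W} (h : G.Iso H) (h' : H.Before k α H') :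
    G.Before k α H' := by
  obtain ⟨hc, d, hd, hlt, heq, hm⟩ := h'
  refine ⟨h.card_eq.trans hc, d, hd, h.card_eq ▸ hlt, fun t ht => ?_, ?_⟩
  · rw [h.moment_eq hk, heq t ht]
  · rwa [h.moment_eq hk]

end

section
variable {k m d p t : ℕ} {α : ℝ}

theorem armList_getD (p q s a : ℕ) :
    (armList p q s).getD a 0 =
      if a = 0 then p else if a = 1 then q else if a < s + 2 then 1 else 0 := by
  rcases a with _ | _ | a
  · simp
  · simp
  · by_cases h : a < s
    · simp [h]
    · simp [h]

theorem circuitSum_armList (k : ℕ) (α : ℝ) (hp : p ≤ d) (hd : 0 < d) (s N : ℕ) :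
    circuitSum ((starlike k (armList p (d - p) s)).alphaTensor k α) N =
      circuitSum ((spider k (armLen (s + 2) p (d - p) 1) :
        Hypergraph (SpiderVertex k (s + 2) d)).alphaTensor k α) N := by
  refine circuitSum_starlike k α _ _ (by simp) (fun a => ?_) (fun a => ?_) N
  · rw [armList_get]; split_ifs <;> omega
  · rw [armList_getD, armLen, if_pos a.isLt]

theorem circuitSum_armList_zero (k : ℕ) (α : ℝ) (hp : p ≤ d) (s N : ℕ) :
    circuitSum ((starlike k (armList p (d - p) 0)).alphaTensor k α) N =
      circuitSum ((spider k (armLen (s + 2) p (d - p) 0) :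
        Hypergraph (SpiderVertex k (s + 2) d)).alphaTensor k α) N := by
  refine circuitSum_starlike k α _ _ (by simp) (fun a => ?_) (fun a => ?_) N
  · have := a.isLt
    rw [armList_get]
    split_ifs
    · omega
    · omega
    · simp at this; omega
  · rw [armList_getD, armLen]
    split_ifs <;> first | rfl | omega

/-- Moving the pendant hyperedges towards the middle of the path increases a moment. -/
theorem starlike_before (hk : 2 ≤ k) (hα0 : 0 < α) (hα1 : α < 1) (hp : 0 < p) (hpt : p < t)
    (htd : 2 * t ≤ d) (hdm : d < m) :
    (starlike k (armList p (d - p) (m - d))).Before k α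
      (starlike k (armList t (d - t) (m - d))) := by
  have hpath : ∀ N, circuitSum ((spider k (armLen (m - d + 2) p (d - p) 0) :
        Hypergraph (SpiderVertex k (m - d + 2) d)).alphaTensor k α) N =
      circuitSum ((spider k (armLen (m - d + 2) t (d - t) 0) :
        Hypergraph (SpiderVertex k (m - d + 2) d)).alphaTensor k α) N := fun N => by
    rw [← circuitSum_armList_zero k α (by omega), ← circuitSum_armList_zero k α (by omega)]
    obtain ⟨φ, hφ⟩ := starlike_path_iso hk hp (by omega : p < d) (by omega : 0 < t) (by omega)
    rw [← hφ]
    exact circuitSum_alphaTensor_eq φ.injective rfl k α N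
  have hcard : ∀ q ≤ d, Fintype.card (StarlikeVertex k (armList q (d - q) (m - d))) =
      m * (k - 1) + 1 := fun q hq => by
    rw [starlikeVertex_card, armList_sum, show q + (d - q) + (m - d) = m by omega]
  -- This order is less than the number of vertices `m * (k - 1) + 1`, because `m ≥ d + 1 ≥ 2 * t +
  -- 1 ≥ 2 * p + 3`.
  refine before_of_circuitSum hk (N := k * p + 2)
    ((hcard p (by omega)).trans (hcard t (by omega)).symm) (by omega) ?_ (fun i hi _ => ?_) ?_
  · rw [hcard p (by omega)]
    obtain ⟨j, rfl⟩ : ∃ j, k = j + 2 := ⟨k - 2, by omega⟩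
    have h1 : (2 * p + 3) * (j + 1) ≤ m * (j + 1) := Nat.mul_le_mul_right _ (by omega)
    have h2 : 0 ≤ p * j := Nat.zero_le _
    simp only [show j + 2 - 1 = j + 1 by omega]
    nlinarith
  · rw [circuitSum_armList k α (by omega) (by omega), circuitSum_armList k α (by omega) (by omega)]
    exact spider_circuitSum_eq hk hα0.le hα1.le hp hpt htd hi (hpath i)
  · rw [circuitSum_armList k α (by omega) (by omega), circuitSum_armList k α (by omega) (by omega)]
    exact spider_circuitSum_lt hk hα0 hα1 hp hpt htd (by omega) (hpath _)

/-- The comparison of a hypertree with the starlike hypertree with a middle branching vertex. -/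
theorem IsHypertree.before_or_iso {V : Type*} [Fintype V] [DecidableEq V] (hk : 2 ≤ k)
    (hα0 : 0 < α) (hα1 : α < 1) (hd : 2 ≤ d) (hdm : d ≤ m) {T : Hypergraph V}
    (hV : T.vertexSet = Set.univ) (hT : T.IsHypertree k) (hm : T.edgeSet.ncard = m)
    (hD : T.HasDiameter d) :
    T.Before k α (starlike k (armLengths m d)) ∨ T.Iso (starlike k (armLengths m d)) := by
  obtain ⟨x, e, h⟩ := hD.exists_isPath hT.2.1
  have hS := starlike_sum_degree_sq (m := m) hk (by omega : 0 < d / 2) (by omega : d / 2 < d) hdm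
  rcases (hT.sum_degree_sq hk hV hm hd hdm h).1.lt_or_eq with hlt | heq
  · left
    have hsum : (armLengths m d).sum = m := by
      rw [show armLengths m d = armList (d / 2) (d - d / 2) (m - d) from rfl, armList_sum]; omega
    have hcT := hT.card_eq hk hV
    refine before_of_sum_degree_sq_lt hk hα0 hT.1 (starlike_isUniform hk) ?_ ?_ ?_ (hS ▸ hlt)
    · rw [starlikeVertex_card, hsum, hcT, hm]
    · have : m * 1 ≤ m * (k - 1) := Nat.mul_le_mul_left _ (by omega)
      rw [hcT, hm]; omega
    · rw [starlike_edgeSet_ncard hk, hsum, hm]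
  · obtain ⟨p, hp, hpt, hiso⟩ := hT.exists_iso_starlike hk hV hm hd hdm h heq
    rcases hpt.lt_or_eq with hlt | rfl
    · rcases hdm.lt_or_eq with hdm | rfl
      · exact Or.inl (hiso.before hk (starlike_before hk hα0 hα1 hp hlt (by omega) hdm))
      -- For `m = d` there are no pendant hyperedges, and all values of `p` give the same hyperpath.
      · right
        rw [Nat.sub_self] at hiso
        have h1 := hiso.trans (starlike_path_iso hk hp (by omega : p < d) (by omega : 0 < d / 2)
          (by omega))
        rwa [armLengths, Nat.sub_self]
    · exact Or.inr hiso

end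
end Hypergraph

/-- Among the `k`-uniform hypertrees with `m` hyperedges and diameter `d`, the starlike hypertree
`S_{t, d-t, 1, …, 1}` with `t = ⌊d/2⌋` (and `m - d` ones) is, up to isomorphism, the unique last
one in `S_α`-order. -/
theorem mainTheorem6 (k m d : ℕ) (hk : 2 ≤ k) (hd : 2 ≤ d) (hdm : d ≤ m)
    (α : ℝ) (hα0 : 0 < α) (hα1 : α < 1) :
    ((Hypergraph.starlike k (Hypergraph.armLengths m d)).IsHypertree k ∧
      (Hypergraph.starlike k (Hypergraph.armLengths m d)).edgeSet.ncard = m ∧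
      (Hypergraph.starlike k (Hypergraph.armLengths m d)).HasDiameter d) ∧
    ∀ (V : Type*) [Fintype V] [DecidableEq V] (T : Hypergraph V), T.vertexSet = Set.univ →
      T.IsHypertree k → T.edgeSet.ncard = m → T.HasDiameter d →
        T.BeforeEq k α (Hypergraph.starlike k (Hypergraph.armLengths m d)) ∧
        (T.MomentEq k α (Hypergraph.starlike k (Hypergraph.armLengths m d)) ↔
          T.Iso (Hypergraph.starlike k (Hypergraph.armLengths m d))) := by
  refine ⟨⟨Hypergraph.starlike_isHypertree hk, ?_, ?_⟩, fun V _ _ T hV hT hm hD => ?_⟩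
  · rw [Hypergraph.starlike_edgeSet_ncard hk]
    exact (Hypergraph.armList_sum (d / 2) (d - d / 2) (m - d)).trans (by omega)
  · have h := Hypergraph.armList_hasDiameter hk (m - d) (by omega : 0 < d / 2)
      (by omega : 0 < d - d / 2)
    rwa [show d / 2 + (d - d / 2) = d by omega] at h
  · refine ⟨?_, fun h => ?_, fun h => h.momentEq hk α⟩
    · exact (hT.before_or_iso hk hα0 hα1 hd hdm hV hm hD).imp_right fun h => h.momentEq hk α
    -- Equality of the moments excludes strict precedence, which leaves the isomorphism.
    · exact (hT.before_or_iso hk hα0 hα1 hd hdm hV hm hD).resolve_left fun h' => h'.not_momentEq h
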